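/- Let $\mathcal J=\{j_n\colon S^{n-1}\to D^n\mid n\ge 0\}$ (with $S^{-1}=\emptyset$), regarded as a discrete category over the arrow category $\mathbf{Top}^{\mathbf 2}$. An algebraic weak factorisation system (awfs) on a category $\mathcal C$ is a functorial factorisation $f=Rf\circ Lf$ through $Mf$, together with a comultiplication $(1,\delta_f)\colon Lf\to LLf$ making $L$ (with counit $(1,Rf)$) a comonad on $\mathcal C^{\mathbf 2}$ and a multiplication $(\mu_f,1)\colon RRf\to Rf$ making $R$ (with unit $(Lf,1)$) a monad on $\mathcal C^{\mathbf 2}$, such that $(\delta_f,\mu_f)\colon LRf\to RLf$ is a distributive law. $L\text{-}\mathbf{Map}$ is the category of $L$-coalgebras. A morphism of awfs $(L,R)\to(L',R')$ is a natural transformation $\chi\colon M\to M'$ such that $(1,\chi)\colon L\to L'$ is a morphism of comonads and $(\chi,1)\colon R\to R'$ is a morphism of monads; it induces a functor $\chi_*\colon L\text{-}\mathbf{Map}\to L'\text{-}\mathbf{Map}$ over $\mathcal C^{\mathbf 2}$. A stratum on a space $X$ is a set of cells, each with a shape $j_k\in\mathcal J$ and an attaching map $S^{k-1}\to X$; its body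 is the space obtained from $X$ by attaching all these cells. A relative cell complex is a sequence of strata, each on the body of the previous one, such that no attaching map of a cell factors through the base of a lower stratum; its body is the colimit of the sequence. With the sequences of maps of base spaces and of cells that preserve shapes and attaching maps and are compatible with the bodies, relative cell complexes form a category $\mathbf{CellCx}$ with a forgetful functor $U\colon\mathbf{CellCx}\to\mathbf{Top}^{\mathbf 2}$ sending a complex to the map from its base to its body. $U$ has a right adjoint $K$: $Kf$ has base the domain of $f\colon A\to B$, and its $n$-th stratum ($n\ge 0$), on $A_n$ (where $A_0=A$, and $A_{n+1}$ is the body of the $n$-th stratum), has one cell for each commutative square from some $j_k$ to the canonical map $A_n\to B$ whose attaching map $S^{k-1}\to A_n$ does not, if $n\ge 1$, factor through $A_{n-1}$. The counit is $(1,Ef)\colon UKf\to f$, where $Ef\colon\overline{Kf}\to B$ is the induced map. Given cell complexes $C$, $D$ such that the body of $C$ is the base of $D$, the composite $D*C$ is the cell complex on $UD\circ UC$ whose cells are those of $C$ and those of $D$, with the same characteristic maps. Then the factorisation $f=Ef\circ UKf$ is an awfs $(UK,E)$, where $UK$ is the comonad of the adjunction $U\dashv K$ and $\mu_f$ is the body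 of the morphism of cell complexes $KEf*Kf\to Kf$ corresponding to $(1,EEf)\colon U(KEf*Kf)\to f$. It is free on $\mathcal J$: each $j_k$ is a left map of $(UK,E)$, with structure map $D^k\to\overline{Kj_k}$ the characteristic map of the cell given by the identity square, and for the resulting functor $\eta\colon\mathcal J\to UK\text{-}\mathbf{Map}$, every awfs $(L',R')$ on $\mathbf{Top}$ and every functor $F\colon\mathcal J\to L'\text{-}\mathbf{Map}$ over $\mathbf{Top}^{\mathbf 2}$ there is a unique morphism of awfs $\chi\colon(UK,E)\to(L',R')$ with $F=\chi_*\circ\eta$. Moreover $(UK,E)$ is isomorphic, as an awfs, to the awfs $(\mathbb L,\mathbb R)$ produced from $\mathcal J$ by Garner's small object argument. That is the following. Let $T$ be the one-step factorisation, which attaches to the domain of $f$ one cell for each square from some $j_k$ to $f$, with its comonad structure. For functorial factorisations $F,G$ let $F\odot G$ factorise $f$ by $G$ and then its right part by $F$. Put $X_0=1$ (the factorisation $f=f\circ 1$) and $X_1=T$, and let $X_{n+2}$ be the coequaliser of the two canonical maps $T\odot X_n\rightrightarrows T\odot X_{n+1}$, one induced by $X_n\to X_{n+1}$ and the other being $T\odot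 X_n\to X_{n+1}\to T\odot X_{n+1}$. The factorisation of $(\mathbb L,\mathbb R)$ is $\operatorname{colim}_n X_n$; its awfs structure is the one for which $T\to\operatorname{colim}_n X_n$ is a morphism of comonads and the multiplication extends the actions $T\odot X_n\to X_{n+1}$. -/

import Mathlib

open CategoryTheory Limits

universe v u w

/-! ### Algebraic weak factorisation systems -/

/-- A functorial factorisation `f = Rf ∘ Lf` through the central functor `M`. -/
structure FunctorialFactorization (C : Type u) [Category.{v} C] where
  M : Arrow C ⥤ C
  L : ∀ f : Arrow C, f.left ⟶ M.obj f
  R : ∀ f : Arrow C, M.obj f ⟶ f.right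
  L_naturality : ∀ {f g : Arrow C} (φ : f ⟶ g), φ.left ≫ L g = L f ≫ M.map φ
  R_naturality : ∀ {f g : Arrow C} (φ : f ⟶ g), M.map φ ≫ R g = R f ≫ φ.right
  fac : ∀ f : Arrow C, L f ≫ R f = f.hom

namespace FunctorialFactorization

variable {C : Type u} [Category.{v} C]

/-- The domain-preserving endofunctor `L` of `C²`. -/
abbrev left (F : FunctorialFactorization C) : Arrow C ⥤ Arrow C where
  obj f := Arrow.mk (F.L f)
  map φ := Arrow.homMk φ.left (F.M.map φ) (F.L_naturality φ)

/-- The codomain-preserving endofunctor `R` of `C²`. -/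
abbrev right (F : FunctorialFactorization C) : Arrow C ⥤ Arrow C where
  obj f := Arrow.mk (F.R f)
  map φ := Arrow.homMk (F.M.map φ) φ.right (F.R_naturality φ)

/-- The copoint `(1, Rf) : Lf ⟶ f`. -/
def counit (F : FunctorialFactorization C) : F.left ⟶ 𝟭 (Arrow C) where
  app f := Arrow.homMk (𝟙 f.left) (F.R f) ((Category.id_comp _).trans (F.fac f).symm)
  naturality f g φ := by
    apply Arrow.hom_ext
    · exact (Category.comp_id _).trans (Category.id_comp _).symm
    · exact F.R_naturality φ

/-- The point `(Lf, 1) : f ⟶ Rf`. -/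
def unit (F : FunctorialFactorization C) : 𝟭 (Arrow C) ⟶ F.right where
  app f := Arrow.homMk (F.L f) (𝟙 f.right) ((F.fac f).trans (Category.comp_id _).symm)
  naturality f g φ := by
    apply Arrow.hom_ext
    · exact F.L_naturality φ
    · exact (Category.comp_id _).trans (Category.id_comp _).symm

/-- A morphism of functorial factorisations: a natural transformation of the central functors
that commutes with the left and the right parts. -/
@[ext]
structure Hom (F G : FunctorialFactorization C) where
  χ : F.M ⟶ G.M
  left_comp : ∀ f, F.L f ≫ χ.app f = G.L f
  comp_right : ∀ f, χ.app f ≫ G.R f = F.R f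

namespace Hom

variable {F G H : FunctorialFactorization C}

def id (F : FunctorialFactorization C) : Hom F F where
  χ := 𝟙 _
  left_comp f := by simp
  comp_right f := by simp

def comp (a : Hom F G) (b : Hom G H) : Hom F H where
  χ := a.χ ≫ b.χ
  left_comp f := by
    rw [NatTrans.comp_app, ← Category.assoc, a.left_comp, b.left_comp]
  comp_right f := by
    rw [NatTrans.comp_app, Category.assoc, b.comp_right, a.comp_right]

/-- The induced transformation `(1, χ) : L ⟶ L'`. -/
def leftTrans (a : Hom F G) : F.left ⟶ G.left where
  app f := Arrow.homMk (𝟙 f.left) (a.χ.app f) ((Category.id_comp _).trans (a.left_comp f).symm)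
  naturality f g φ := by
    apply Arrow.hom_ext
    · exact (Category.comp_id _).trans (Category.id_comp _).symm
    · exact a.χ.naturality φ

/-- The induced transformation `(χ, 1) : R ⟶ R'`. -/
def rightTrans (a : Hom F G) : F.right ⟶ G.right where
  app f := Arrow.homMk (a.χ.app f) (𝟙 f.right) ((a.comp_right f).trans (Category.comp_id _).symm)
  naturality f g φ := by
    apply Arrow.hom_ext
    · exact a.χ.naturality φ
    · exact (Category.comp_id _).trans (Category.id_comp _).symm

end Hom

end FunctorialFactorization

/-- Comultiplication and multiplication making the left part of a functorial factorisation a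
comonad and its right part a monad. -/
structure ComonadMonadStructure {C : Type u} [Category.{v} C]
    (F : FunctorialFactorization C) where
  δ : F.left ⟶ F.left ⋙ F.left
  left_counit : ∀ f, δ.app f ≫ F.counit.app (F.left.obj f) = 𝟙 (F.left.obj f)
  right_counit : ∀ f, δ.app f ≫ F.left.map (F.counit.app f) = 𝟙 (F.left.obj f)
  coassoc : ∀ f, δ.app f ≫ F.left.map (δ.app f) = δ.app f ≫ δ.app (F.left.obj f)
  μ : F.right ⋙ F.right ⟶ F.right
  left_unit : ∀ f, F.unit.app (F.right.obj f) ≫ μ.app f = 𝟙 (F.right.obj f)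
  right_unit : ∀ f, F.right.map (F.unit.app f) ≫ μ.app f = 𝟙 (F.right.obj f)
  assoc : ∀ f, F.right.map (μ.app f) ≫ μ.app f = μ.app (F.right.obj f) ≫ μ.app f

namespace ComonadMonadStructure

variable {C : Type u} [Category.{v} C] {F : FunctorialFactorization C}

/-- The comonad `𝕃` on `C²`. -/
def comonad (A : ComonadMonadStructure F) : Comonad (Arrow C) where
  toFunctor := F.left
  ε := F.counit
  δ := A.δ
  coassoc := A.coassoc
  left_counit := A.left_counit
  right_counit := A.right_counit

/-- The monad `ℝ` on `C²`. -/
def monad (A : ComonadMonadStructure F) : CategoryTheory.Monad (Arrow C) where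
  toFunctor := F.right
  η := F.unit
  μ := A.μ
  assoc := A.assoc
  left_unit := A.left_unit
  right_unit := A.right_unit

/-- The codomain part `δ_f : Mf ⟶ MLf` of the comultiplication. -/
def δMap (A : ComonadMonadStructure F) (f : Arrow C) :
    F.M.obj f ⟶ F.M.obj (Arrow.mk (F.L f)) :=
  (A.δ.app f).right

/-- The domain part `μ_f : MRf ⟶ Mf` of the multiplication. -/
def μMap (A : ComonadMonadStructure F) (f : Arrow C) :
    F.M.obj (Arrow.mk (F.R f)) ⟶ F.M.obj f :=
  (A.μ.app f).left

/-- The transformation `Δ_f = (δ_f, μ_f) : LRf ⟶ RLf`. -/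
def distrib (A : ComonadMonadStructure F) (f : Arrow C) :
    F.left.obj (F.right.obj f) ⟶ F.right.obj (F.left.obj f) :=
  Arrow.homMk (A.δMap f) (A.μMap f) (by
    have h₁ := congrArg Arrow.Hom.right (A.left_counit f)
    have h₂ := congrArg Arrow.Hom.left (A.left_unit f)
    exact h₁.trans h₂.symm)

end ComonadMonadStructure

/-- An algebraic weak factorisation system with underlying functorial factorisation `F`: a
comonad and a monad structure such that `Δ = (δ, μ)` is a distributive law, that is, commutes
with the unit, the counit, the multiplication and the comultiplication. -/
structure AWFSStructure {C : Type u} [Category.{v} C] (F : FunctorialFactorization C) extends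
    ComonadMonadStructure F where
  distrib_unit : ∀ f, F.left.map (F.unit.app f) ≫ toComonadMonadStructure.distrib f =
    F.unit.app (F.left.obj f)
  distrib_counit : ∀ f, toComonadMonadStructure.distrib f ≫ F.right.map (F.counit.app f) =
    F.counit.app (F.right.obj f)
  distrib_mul : ∀ f, F.left.map (μ.app f) ≫ toComonadMonadStructure.distrib f =
    toComonadMonadStructure.distrib (F.right.obj f) ≫
      F.right.map (toComonadMonadStructure.distrib f) ≫ μ.app (F.left.obj f)
  distrib_comul : ∀ f, toComonadMonadStructure.distrib f ≫ F.right.map (δ.app f) =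
    δ.app (F.right.obj f) ≫ F.left.map (toComonadMonadStructure.distrib f) ≫
      toComonadMonadStructure.distrib (F.left.obj f)

/-- An algebraic weak factorisation system on `C`. -/
structure AWFS (C : Type u) [Category.{v} C] where
  fact : FunctorialFactorization C
  str : AWFSStructure fact

namespace AWFS

variable {C : Type u} [Category.{v} C]

/-- A morphism of awfs: a morphism of functorial factorisations `χ` such that `(1, χ)` is a
comonad morphism and `(χ, 1)` is a monad morphism. -/
@[ext]
structure Hom (W W' : AWFS C) extends FunctorialFactorization.Hom W.fact W'.fact where
  comul : ∀ f, toHom.leftTrans.app f ≫ W'.str.δ.app f =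
    W.str.δ.app f ≫ toHom.leftTrans.app (W.fact.left.obj f) ≫
      W'.fact.left.map (toHom.leftTrans.app f)
  mul : ∀ f, W.str.μ.app f ≫ toHom.rightTrans.app f =
    (W.fact.right.map (toHom.rightTrans.app f) ≫
      toHom.rightTrans.app (W'.fact.right.obj f)) ≫ W'.str.μ.app f

/-- The comonad morphism `(1, χ)`. -/
def Hom.comonadHom {W W' : AWFS C} (χ : Hom W W') :
    ComonadHom W.str.comonad W'.str.comonad where
  app := χ.leftTrans.app
  naturality _ _ φ := χ.leftTrans.naturality φ
  app_ε f := by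
    apply Arrow.hom_ext
    · exact Category.id_comp _
    · exact χ.comp_right f
  app_δ := χ.comul

/-- The monad morphism `(χ, 1)`. -/
def Hom.monadHom {W W' : AWFS C} (χ : Hom W W') :
    MonadHom W.str.monad W'.str.monad where
  app := χ.rightTrans.app
  naturality _ _ φ := χ.rightTrans.naturality φ
  app_η f := by
    apply Arrow.hom_ext
    · exact χ.left_comp f
    · exact Category.id_comp _
  app_μ := χ.mul

def Hom.id (W : AWFS C) : Hom W W where
  toHom := FunctorialFactorization.Hom.id W.fact
  comul f := (ComonadHom.app_δ (𝟙 W.str.comonad) f)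
  mul f := (MonadHom.app_μ (𝟙 W.str.monad) f)

def Hom.comp {W W' W'' : AWFS C} (a : Hom W W') (b : Hom W' W'') : Hom W W'' where
  toHom := a.toHom.comp b.toHom
  comul f := by
    have h := ComonadHom.app_δ ((show W.str.comonad ⟶ W'.str.comonad from a.comonadHom) ≫
      (show W'.str.comonad ⟶ W''.str.comonad from b.comonadHom)) f
    have e : ∀ g, (a.toHom.comp b.toHom).leftTrans.app g =
        a.leftTrans.app g ≫ b.leftTrans.app g := fun g => by
      apply Arrow.hom_ext
      · exact (Category.id_comp _).symm
      · rfl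
    rw [e, e]
    exact h
  mul f := by
    have h := MonadHom.app_μ ((show W.str.monad ⟶ W'.str.monad from a.monadHom) ≫
      (show W'.str.monad ⟶ W''.str.monad from b.monadHom)) f
    have e : ∀ g, (a.toHom.comp b.toHom).rightTrans.app g =
        a.rightTrans.app g ≫ b.rightTrans.app g := fun g => by
      apply Arrow.hom_ext
      · rfl
      · exact (Category.id_comp _).symm
    rw [e, e]
    exact h

instance : Category (AWFS C) where
  Hom := Hom
  id := Hom.id
  comp := Hom.comp
  id_comp f := Hom.ext (Category.id_comp f.χ)
  comp_id f := Hom.ext (Category.comp_id f.χ)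
  assoc f g h := Hom.ext (Category.assoc f.χ g.χ h.χ)

/-- The category of left maps: coalgebras for the comonad. -/
abbrev LMap (W : AWFS C) := W.str.comonad.Coalgebra

/-- The functor `α_*` on left maps over `C²` induced by a morphism of awfs. -/
def mapLMap {W W' : AWFS C} (χ : W ⟶ W') : W.LMap ⥤ W'.LMap where
  obj X :=
    { A := X.A
      a := X.a ≫ (Hom.comonadHom χ).app X.A
      counit := by rw [Category.assoc, ComonadHom.app_ε, X.counit]
      coassoc := by
        rw [Category.assoc, ComonadHom.app_δ, X.coassoc_assoc, Functor.map_comp, Category.assoc,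
          ← NatTrans.naturality_assoc] }
  map h :=
    { f := h.f
      h := by
        have := (Hom.comonadHom χ).naturality h.f
        have h' := h.h
        dsimp only
        rw [Category.assoc, ← this, ← Category.assoc, h', Category.assoc] }

/-- An awfs `W` is free on a category `I` over `C²`, via a functor `η` from `I` to the left maps
over `C²`. -/
def IsFreeVia (W : AWFS C) {I : Type w} [Category.{w} I] (P : I ⥤ Arrow C)
    (η : I ⥤ W.LMap) : Prop :=
  η ⋙ W.str.comonad.forget = P ∧
    ∀ (W' : AWFS C) (F : I ⥤ W'.LMap), F ⋙ W'.str.comonad.forget = P →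
      ∃! χ : W ⟶ W', η ⋙ mapLMap χ = F

end AWFS

/-! ### Strata -/

open TopCat

/-- The set `{S^{n-1} ⟶ D^n}` of generating maps, as a discrete category over `Top²`. -/
noncomputable def cellInclusions : Discrete ℕ ⥤ Arrow TopCat.{u} :=
  Discrete.functor fun k => Arrow.mk (diskBoundaryInclusion.{u} k)

/-- A stratum on a space `X`: for each `k` a set of cells of shape `S^{k-1} ⟶ D^k`, each with an
attaching map to `X`. -/
structure Stratum where
  X : TopCat.{u}
  cells : ℕ → Type u
  attach : ∀ k : ℕ, cells k → (diskBoundary.{u} k ⟶ X)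

namespace Stratum

/-- A morphism of strata. -/
@[ext]
structure Hom (P Q : Stratum.{u}) where
  base : P.X ⟶ Q.X
  cells : ∀ k : ℕ, P.cells k → Q.cells k
  attach_comp : ∀ (k : ℕ) (s : P.cells k), P.attach k s ≫ base = Q.attach k (cells k s)

instance : Category Stratum.{u} where
  Hom := Hom
  id P := ⟨𝟙 _, fun _ s => s, fun _ _ => Category.comp_id _⟩
  comp a b := ⟨a.base ≫ b.base, fun k s => b.cells k (a.cells k s), fun k s => by
    rw [← Category.assoc, a.attach_comp, b.attach_comp]⟩
  id_comp a := Hom.ext (Category.id_comp a.base) rfl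
  comp_id a := Hom.ext (Category.comp_id a.base) rfl
  assoc a b c := Hom.ext (Category.assoc a.base b.base c.base) rfl

/-- The body of a stratum: the pushout of the coproduct of its cells along the attaching maps. -/
noncomputable def body (P : Stratum.{u}) : TopCat.{u} :=
  pushout
    (Sigma.desc fun s : (Σ k, P.cells k) => P.attach s.1 s.2)
    (Limits.Sigma.map fun s : (Σ k, P.cells k) => diskBoundaryInclusion.{u} s.1)

/-- The underlying map `X ⟶ body` of a stratum. -/
noncomputable def incl (P : Stratum.{u}) : P.X ⟶ P.body :=
  pushout.inl _ _

/-- The map from the coproduct of the cells to the body. -/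
noncomputable def allChar (P : Stratum.{u}) :
    (∐ fun s : (Σ k, P.cells k) => disk.{u} s.1) ⟶ P.body :=
  pushout.inr _ _

/-- The characteristic map of a cell. -/
noncomputable def char (P : Stratum.{u}) (k : ℕ) (s : P.cells k) : disk.{u} k ⟶ P.body :=
  Sigma.ι (fun s : (Σ k, P.cells k) => disk.{u} s.1) ⟨k, s⟩ ≫ P.allChar

theorem attach_incl (P : Stratum.{u}) (k : ℕ) (s : P.cells k) :
    P.attach k s ≫ P.incl = diskBoundaryInclusion.{u} k ≫ P.char k s := by
  have h := congrArg
    (fun t => Sigma.ι (fun s : (Σ k, P.cells k) => diskBoundary.{u} s.1) ⟨k, s⟩ ≫ t)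
    (pushout.condition
      (f := Sigma.desc fun s : (Σ k, P.cells k) => P.attach s.1 s.2)
      (g := Limits.Sigma.map fun s : (Σ k, P.cells k) => diskBoundaryInclusion.{u} s.1))
  dsimp only at h
  rw [← Category.assoc, ← Category.assoc, Sigma.ι_desc, Limits.Sigma.ι_map,
    Category.assoc] at h
  exact h

/-- The map out of the body determined by maps out of the boundary and out of each cell. -/
noncomputable def desc (P : Stratum.{u}) {Z : TopCat.{u}} (a : P.X ⟶ Z)
    (c : ∀ k : ℕ, P.cells k → (disk.{u} k ⟶ Z))
    (h : ∀ (k : ℕ) (s : P.cells k),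
      P.attach k s ≫ a = diskBoundaryInclusion.{u} k ≫ c k s) :
    P.body ⟶ Z :=
  pushout.desc a (Sigma.desc fun s : (Σ k, P.cells k) => c s.1 s.2) (by
    apply Sigma.hom_ext
    intro s
    rw [← Category.assoc, ← Category.assoc, Sigma.ι_desc, Limits.Sigma.ι_map,
      Category.assoc, Sigma.ι_desc]
    exact h s.1 s.2)

section

variable (P : Stratum.{u}) {Z : TopCat.{u}} (a : P.X ⟶ Z)
    (c : ∀ k : ℕ, P.cells k → (disk.{u} k ⟶ Z))
    (h : ∀ (k : ℕ) (s : P.cells k), P.attach k s ≫ a = diskBoundaryInclusion.{u} k ≫ c k s)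

theorem incl_desc : P.incl ≫ P.desc a c h = a :=
  pushout.inl_desc _ _ _

theorem allChar_desc :
    P.allChar ≫ P.desc a c h = Sigma.desc fun s : (Σ k, P.cells k) => c s.1 s.2 :=
  pushout.inr_desc _ _ _

theorem char_desc (k : ℕ) (s : P.cells k) : P.char k s ≫ P.desc a c h = c k s := by
  unfold char
  rw [Category.assoc, allChar_desc]
  exact Sigma.ι_desc _ _

variable {P} in
theorem body_hom_ext {a b : P.body ⟶ Z} (h₀ : P.incl ≫ a = P.incl ≫ b)
    (h₁ : ∀ (k : ℕ) (s : P.cells k), P.char k s ≫ a = P.char k s ≫ b) : a = b := by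
  refine pushout.hom_ext h₀ (?_ : P.allChar ≫ a = P.allChar ≫ b)
  apply Sigma.hom_ext
  intro s
  have := h₁ s.1 s.2
  unfold char at this
  rwa [Category.assoc, Category.assoc] at this

end

/-- The map of bodies induced by a morphism of strata. -/
noncomputable def bodyMap {P Q : Stratum.{u}} (a : P ⟶ Q) : P.body ⟶ Q.body :=
  P.desc (a.base ≫ Q.incl) (fun k s => Q.char k (a.cells k s)) (fun k s => by
    rw [← Category.assoc, a.attach_comp, Q.attach_incl])

theorem incl_bodyMap {P Q : Stratum.{u}} (a : P ⟶ Q) : P.incl ≫ bodyMap a = a.base ≫ Q.incl :=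
  incl_desc _ _ _ _

theorem char_bodyMap {P Q : Stratum.{u}} (a : P ⟶ Q) (k : ℕ) (s : P.cells k) :
    P.char k s ≫ bodyMap a = Q.char k (a.cells k s) :=
  char_desc _ _ _ _ k s

theorem bodyMap_id (P : Stratum.{u}) : bodyMap (𝟙 P) = 𝟙 P.body := by
  apply body_hom_ext
  · rw [incl_bodyMap, Category.comp_id]; exact Category.id_comp _
  · intro k s
    rw [char_bodyMap, Category.comp_id]; rfl

theorem bodyMap_comp {P Q T : Stratum.{u}} (a : P ⟶ Q) (b : Q ⟶ T) :
    bodyMap (a ≫ b) = bodyMap a ≫ bodyMap b := by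
  apply body_hom_ext
  · rw [incl_bodyMap, ← Category.assoc, incl_bodyMap, Category.assoc, incl_bodyMap]
    exact Category.assoc _ _ _
  · intro k s
    rw [char_bodyMap, ← Category.assoc, char_bodyMap, char_bodyMap]; rfl

theorem isInducing_diskBoundaryInclusion (k : ℕ) :
    Topology.IsInducing (diskBoundaryInclusion.{u} k) := by
  have : T2Space (disk.{u} k) := by
    unfold disk
    exact inferInstanceAs
      (T2Space (ULift.{u} (Metric.closedBall (0 : EuclideanSpace ℝ (Fin k)) 1)))
  exact ((diskBoundaryInclusion.{u} k).hom.continuous.isClosedEmbedding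
    ((TopCat.mono_iff_injective _).mp inferInstance)).isInducing

/-- The boundary of a stratum carries the topology induced from the body. -/
theorem isInducing_incl (P : Stratum.{u}) : Topology.IsInducing P.incl := by
  let S : TopCat.{u} := TopCat.of (ULift.{u} Prop)
  let mkS : ∀ {Y : TopCat.{u}} (t : Y → Prop), Continuous t → (Y ⟶ S) :=
    fun {Y} t ht => TopCat.ofHom ⟨fun y => ULift.up (t y), continuous_uliftUp.comp ht⟩
  have key : ∀ U : Set P.X, IsOpen U → ∃ V : Set P.body, IsOpen V ∧ P.incl ⁻¹' V = U := by
    intro U hU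
    have ext : ∀ (k : ℕ) (s : P.cells k), ∃ W : Set (disk.{u} k), IsOpen W ∧
        diskBoundaryInclusion.{u} k ⁻¹' W = P.attach k s ⁻¹' U := fun k s =>
      (isInducing_diskBoundaryInclusion k).isOpen_iff.mp
        (hU.preimage (P.attach k s).hom.continuous)
    choose W hW hWU using ext
    let m : P.body ⟶ S := P.desc
      (mkS (fun x => x ∈ U) (isOpen_iff_continuous_mem.mp hU))
      (fun k s => mkS (fun d => d ∈ W k s) (isOpen_iff_continuous_mem.mp (hW k s)))
      (fun k s => by
        ext x
        have := congrArg (fun A : Set (diskBoundary.{u} k) => x ∈ A) (hWU k s)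
        exact Iff.of_eq this.symm)
    refine ⟨{y | (m y : ULift Prop).down}, ?_, ?_⟩
    · exact isOpen_iff_continuous_mem.mpr (continuous_uliftDown.comp m.hom.continuous)
    · ext x
      have := congrArg (fun n : P.X ⟶ S => (n x : ULift Prop).down) (P.incl_desc
        (mkS (fun x => x ∈ U) (isOpen_iff_continuous_mem.mp hU)) _ _ : P.incl ≫ m = _)
      exact Iff.of_eq this
  refine ⟨le_antisymm (continuous_iff_le_induced.mp P.incl.hom.continuous) ?_⟩
  intro U hU
  obtain ⟨V, hV, rfl⟩ := key U hU
  exact ⟨V, hV, rfl⟩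

/-- If `b` becomes a map into the boundary after a morphism of strata, then it already is a map
into the boundary. -/
theorem factors_of_bodyMap_factors {P Q : Stratum.{u}} (a : P ⟶ Q) {Z : TopCat.{u}}
    (b : Z ⟶ P.body) (c : Z ⟶ Q.X) (h : b ≫ bodyMap a = c ≫ Q.incl) :
    ∃ c' : Z ⟶ P.X, c' ≫ P.incl = b := by
  -- maps to an indiscrete space
  let I : TopCat.{u} := @TopCat.of (ULift.{u} Prop) ⊤
  let mkI : ∀ {Y : TopCat.{u}} (t : Y → Prop), (Y ⟶ I) :=
    fun {Y} t => @TopCat.ofHom Y (ULift Prop) _ ⊤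
      (@ContinuousMap.mk _ _ _ ⊤ (fun y => ULift.up (t y)) continuous_top)
  have mkI_down : ∀ {Y : TopCat.{u}} (t : Y → Prop) (y : Y), (mkI t y : ULift Prop).down = t y :=
    fun t y => rfl
  have mkI_comp : ∀ {Y Y' : TopCat.{u}} (g : Y' ⟶ Y) (t : Y → Prop),
      g ≫ mkI t = mkI (fun y => t (g y)) := fun g t => rfl
  have mkI_inj : ∀ {Y : TopCat.{u}} {t t' : Y → Prop}, mkI t = mkI t' → ∀ y, t y = t' y :=
    fun {Y t t'} e y => by
      have := congrArg (fun m : Y ⟶ I => (m y : ULift Prop).down) e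
      exact this
  -- every point of a body lies in the boundary or in a cell
  have cover : ∀ (T : Stratum.{u}) (y : T.body),
      (∃ x, T.incl x = y) ∨ ∃ (k : ℕ) (s : T.cells k) (d : disk.{u} k), T.char k s d = y := by
    intro T y
    have e : mkI (fun y : T.body => (∃ x, T.incl x = y) ∨
        ∃ (k : ℕ) (s : T.cells k) (d : disk.{u} k), T.char k s d = y) = mkI (fun _ => True) := by
      apply body_hom_ext
      · rw [mkI_comp, mkI_comp]
        congr 1
        funext x
        exact eq_true (Or.inl ⟨x, rfl⟩)
      · intro k s
        rw [mkI_comp, mkI_comp]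
        congr 1
        funext d
        exact eq_true (Or.inr ⟨k, s, d, rfl⟩)
    exact of_eq_true (mkI_inj e y)
  -- the indicator of the open cells
  let ind : ∀ T : Stratum.{u}, T.body ⟶ I := fun T =>
    T.desc (mkI fun _ => False)
      (fun k _ => mkI fun d => d ∉ Set.range (diskBoundaryInclusion.{u} k)) (fun k s => by
        rw [mkI_comp, mkI_comp]
        congr 1
        funext x
        exact (eq_false (not_not_intro ⟨x, rfl⟩)).symm)
  have ind_nat : bodyMap a ≫ ind Q = ind P := by
    apply body_hom_ext
    · rw [← Category.assoc, incl_bodyMap, Category.assoc, incl_desc, incl_desc, mkI_comp]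
    · intro k s
      rw [← Category.assoc, char_bodyMap, char_desc, char_desc]
  have hb : b ≫ ind P = mkI fun _ => False := by
    rw [← ind_nat, ← Category.assoc, h, Category.assoc, incl_desc, mkI_comp]
  have hr : ∀ z, ∃ x, P.incl x = b z := by
    intro z
    rcases cover P (b z) with hx | ⟨k, s, d, hd⟩
    · exact hx
    · have h₁ : (ind P (b z) : ULift Prop).down = False :=
        congrArg (fun m : Z ⟶ I => (m z : ULift Prop).down) hb
      have h₂ : (ind P (P.char k s d) : ULift Prop).down =
          (d ∉ Set.range (diskBoundaryInclusion.{u} k)) :=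
        congrArg (fun m : disk.{u} k ⟶ I => (m d : ULift Prop).down) (char_desc P _ _ _ k s)
      rw [hd, h₁] at h₂
      obtain ⟨d', rfl⟩ := not_not.mp (of_eq_false h₂.symm)
      refine ⟨P.attach k s d', ?_⟩
      rw [← hd]
      exact congrArg (fun m : diskBoundary.{u} k ⟶ P.body => m d') (P.attach_incl k s)
  choose c' hc' using hr
  have hcont : Continuous c' := by
    rw [P.isInducing_incl.continuous_iff]
    have : (P.incl ∘ c' : Z → P.body) = b := funext hc'
    rw [this]
    exact b.hom.continuous
  exact ⟨TopCat.ofHom ⟨c', hcont⟩, by ext z; exact hc' z⟩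

end Stratum

/-! ### Cell complexes -/

/-- A relative cell complex: a sequence of strata which is connected (the boundary of each stratum
is identified with the body of the previous one) and proper (no attaching map of a cell factors
through the boundary of a lower stratum; it is enough to exclude the previous stratum). -/
structure CellCx where
  stratum : ℕ → Stratum.{u}
  link : ∀ n : ℕ, (stratum n).body ≅ (stratum (n + 1)).X
  proper : ∀ (n k : ℕ) (s : (stratum (n + 1)).cells k),
    ¬ ∃ c : diskBoundary.{u} k ⟶ (stratum n).X,
      c ≫ (stratum n).incl ≫ (link n).hom = (stratum (n + 1)).attach k s

namespace CellCx

/-- A morphism of cell complexes: a coherent sequence of morphisms of strata. -/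
@[ext]
structure Hom (A B : CellCx.{u}) where
  strat : ∀ n : ℕ, A.stratum n ⟶ B.stratum n
  coherent : ∀ n : ℕ, (A.link n).hom ≫ (strat (n + 1)).base =
    Stratum.bodyMap (strat n) ≫ (B.link n).hom

instance : Category CellCx.{u} where
  Hom := Hom
  id A := ⟨fun n => 𝟙 (A.stratum n), fun n => by
    rw [Stratum.bodyMap_id, Category.id_comp]; exact Category.comp_id _⟩
  comp a b := ⟨fun n => a.strat n ≫ b.strat n, fun n => by
    rw [Stratum.bodyMap_comp, Category.assoc, ← b.coherent, ← Category.assoc, ← a.coherent,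
      Category.assoc]
    rfl⟩
  id_comp a := Hom.ext (funext fun n => Category.id_comp (a.strat n))
  comp_id a := Hom.ext (funext fun n => Category.comp_id (a.strat n))
  assoc a b c := Hom.ext (funext fun n => Category.assoc (a.strat n) (b.strat n) (c.strat n))

/-- The base space of a cell complex. -/
abbrev base (A : CellCx.{u}) : TopCat.{u} := (A.stratum 0).X

/-- The map `X_n ⟶ X_{n+1}`. -/
noncomputable def step (A : CellCx.{u}) (n : ℕ) : (A.stratum n).X ⟶ (A.stratum (n + 1)).X :=
  (A.stratum n).incl ≫ (A.link n).hom

/-- The sequence `X_0 ⟶ X_1 ⟶ X_2 ⟶ ⋯`. -/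
noncomputable def sequence (A : CellCx.{u}) : ℕ ⥤ TopCat.{u} :=
  Functor.ofSequence (X := fun n => (A.stratum n).X) A.step

/-- The body of a cell complex: the colimit of the spaces `X_n`. -/
noncomputable def body (A : CellCx.{u}) : TopCat.{u} := colimit A.sequence

/-- The map from `X_n` to the body. -/
noncomputable def toBody (A : CellCx.{u}) (n : ℕ) : (A.stratum n).X ⟶ A.body :=
  colimit.ι A.sequence n

theorem step_toBody (A : CellCx.{u}) (n : ℕ) : A.step n ≫ A.toBody (n + 1) = A.toBody n := by
  have h := colimit.w A.sequence (homOfLE (Nat.le_add_right n 1))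
  rwa [show A.sequence.map (homOfLE (Nat.le_add_right n 1)) = A.step n from
    Functor.ofSequence_map_homOfLE_succ (X := fun n => (A.stratum n).X) A.step n] at h

/-- The map out of the body determined by compatible maps out of the `X_n`. -/
noncomputable def desc (A : CellCx.{u}) {Z : TopCat.{u}} (h : ∀ n, (A.stratum n).X ⟶ Z)
    (w : ∀ n, A.step n ≫ h (n + 1) = h n) : A.body ⟶ Z :=
  colimit.desc A.sequence
    { pt := Z
      ι := NatTrans.ofSequence (G := (Functor.const ℕ).obj Z) h (fun n => by
        rw [show A.sequence.map (homOfLE (Nat.le_add_right n 1)) = A.step n from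
          Functor.ofSequence_map_homOfLE_succ (X := fun n => (A.stratum n).X) A.step n]
        exact (w n).trans (Category.comp_id _).symm) }

theorem toBody_desc (A : CellCx.{u}) {Z : TopCat.{u}} (h : ∀ n, (A.stratum n).X ⟶ Z)
    (w : ∀ n, A.step n ≫ h (n + 1) = h n) (n : ℕ) : A.toBody n ≫ A.desc h w = h n :=
  colimit.ι_desc _ n

theorem body_hom_ext {A : CellCx.{u}} {Z : TopCat.{u}} {a b : A.body ⟶ Z}
    (h : ∀ n, A.toBody n ≫ a = A.toBody n ≫ b) : a = b :=
  colimit.hom_ext h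

theorem step_comp_base {A B : CellCx.{u}} (φ : A ⟶ B) (n : ℕ) :
    A.step n ≫ (φ.strat (n + 1)).base = (φ.strat n).base ≫ B.step n := by
  unfold step
  rw [Category.assoc, φ.coherent, ← Category.assoc, Stratum.incl_bodyMap, Category.assoc]

/-- The map of bodies induced by a morphism of cell complexes. -/
noncomputable def bodyMap {A B : CellCx.{u}} (φ : A ⟶ B) : A.body ⟶ B.body :=
  A.desc (fun n => (φ.strat n).base ≫ B.toBody n) (fun n => by
    rw [← Category.assoc, step_comp_base, Category.assoc, step_toBody])

theorem toBody_bodyMap {A B : CellCx.{u}} (φ : A ⟶ B) (n : ℕ) :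
    A.toBody n ≫ bodyMap φ = (φ.strat n).base ≫ B.toBody n :=
  toBody_desc _ _ _ n

/-- The underlying map of a cell complex: the transfinite composite of its strata. -/
noncomputable def map (A : CellCx.{u}) : A.base ⟶ A.body := A.toBody 0

/-- The forgetful functor from cell complexes to `Top²`. -/
noncomputable def U : CellCx.{u} ⥤ Arrow TopCat.{u} where
  obj A := Arrow.mk A.map
  map φ := Arrow.homMk (φ.strat 0).base (bodyMap φ) (toBody_bodyMap φ 0).symm
  map_id A := by
    apply Arrow.hom_ext
    · rfl
    · apply body_hom_ext
      intro n
      exact (toBody_bodyMap (𝟙 A) n).trans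
        ((Category.id_comp _).trans (Category.comp_id _).symm)
  map_comp {A B D} φ ψ := by
    apply Arrow.hom_ext
    · rfl
    · refine body_hom_ext (A := A) (Z := D.body) (a := bodyMap (φ ≫ ψ))
        (b := bodyMap φ ≫ bodyMap ψ) fun n => ?_
      rw [toBody_bodyMap, ← Category.assoc, toBody_bodyMap, Category.assoc, toBody_bodyMap]
      exact Category.assoc _ _ _

/-- The cells of dimension `k` of a cell complex, in all strata. -/
def Cell (A : CellCx.{u}) (k : ℕ) : Type u := Σ n : ℕ, (A.stratum n).cells k

/-- The characteristic map of a cell, as a map to the body of the cell complex. -/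
noncomputable def char (A : CellCx.{u}) {k : ℕ} (s : A.Cell k) : disk.{u} k ⟶ A.body :=
  (A.stratum s.1).char k s.2 ≫ (A.link s.1).hom ≫ A.toBody (s.1 + 1)

/-! ### The right adjoint `K` -/

/-- A space over `B`, with a condition on attaching maps: one stage in the construction of the
free cell complex. -/
structure FreeStage (B : TopCat.{u}) where
  X : TopCat.{u}
  e : X ⟶ B
  ok : ∀ k : ℕ, (diskBoundary.{u} k ⟶ X) → Prop

namespace FreeStage

variable {B : TopCat.{u}}

/-- One cell for each commutative square from a generating map to `e` whose attaching map
satisfies the condition. -/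
noncomputable abbrev stratum (T : FreeStage B) : Stratum.{u} where
  X := T.X
  cells k := {s : Arrow.mk (diskBoundaryInclusion.{u} k) ⟶ Arrow.mk T.e // T.ok k s.left}
  attach _ s := s.1.left

/-- The map from the body to `B`. -/
noncomputable def ext (T : FreeStage B) : T.stratum.body ⟶ B :=
  T.stratum.desc T.e (fun _ s => s.1.right) (fun _ s => s.1.w)

theorem incl_ext (T : FreeStage B) : T.stratum.incl ≫ T.ext = T.e :=
  Stratum.incl_desc _ _ _ _

theorem char_ext (T : FreeStage B) (k : ℕ) (s : T.stratum.cells k) :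
    T.stratum.char k s ≫ T.ext = s.1.right :=
  Stratum.char_desc T.stratum _ _ _ k s

/-- The next stage: only attaching maps that do not factor through the previous space are
allowed. -/
noncomputable abbrev next (T : FreeStage B) : FreeStage B where
  X := T.stratum.body
  e := T.ext
  ok k b := ¬ ∃ c : diskBoundary.{u} k ⟶ T.X, c ≫ T.stratum.incl = b

end FreeStage

/-- The stages of the free cell complex on `f`, starting from `f` itself, where all attaching maps
are allowed. -/
noncomputable def freeStage (f : Arrow TopCat.{u}) : ℕ → FreeStage f.right
  | 0 => ⟨f.left, f.hom, fun _ _ => True⟩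
  | n + 1 => (freeStage f n).next

/-- The free cell complex on `f`. -/
noncomputable abbrev free (f : Arrow TopCat.{u}) : CellCx.{u} where
  stratum n := (freeStage f n).stratum
  link _ := Iso.refl _
  proper n k s h := s.2 (by
    obtain ⟨c, hc⟩ := h
    exact ⟨c, (Category.comp_id _).symm.trans ((Category.assoc _ _ _).trans hc)⟩)

theorem free_step_e (f : Arrow TopCat.{u}) (n : ℕ) :
    (free f).step n ≫ (freeStage f (n + 1)).e = (freeStage f n).e := by
  have h : (free f).step n = (freeStage f n).stratum.incl := Category.comp_id _
  rw [h]
  exact Stratum.incl_desc _ _ _ _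

/-- The map `Ef` from the body of the free cell complex on `f : A ⟶ B` to `B`. -/
noncomputable def E (f : Arrow TopCat.{u}) : (free f).body ⟶ f.right :=
  (free f).desc (fun n => (freeStage f n).e) (free_step_e f)

theorem toBody_E (f : Arrow TopCat.{u}) (n : ℕ) :
    (free f).toBody n ≫ E f = (freeStage f n).e :=
  toBody_desc (free f) (fun n => (freeStage f n).e) (free_step_e f) n

/-- The morphism `(1, Ef) : U(Kf) ⟶ f`. -/
noncomputable def freeCounit (f : Arrow TopCat.{u}) : U.obj (free f) ⟶ f :=
  Arrow.homMk (𝟙 f.left) (E f) ((Category.id_comp f.hom).trans (toBody_E f 0).symm)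

theorem map_freeCounit_left {A : CellCx.{u}} {f : Arrow TopCat.{u}} (φ : A ⟶ free f) :
    (U.map φ ≫ freeCounit f).left = (φ.strat 0).base :=
  (Arrow.comp_left (U.map φ) (freeCounit f)).trans (Category.comp_id (φ.strat 0).base)

theorem map_freeCounit_right {A : CellCx.{u}} {f : Arrow TopCat.{u}} (φ : A ⟶ free f) :
    (U.map φ ≫ freeCounit f).right = bodyMap φ ≫ E f :=
  Arrow.comp_right (U.map φ) (freeCounit f)

theorem toBody_bodyMap_E {A : CellCx.{u}} {f : Arrow TopCat.{u}} (φ : A ⟶ free f) (n : ℕ) :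
    A.toBody n ≫ bodyMap φ ≫ E f = (φ.strat n).base ≫ (freeStage f n).e := by
  rw [← Category.assoc, toBody_bodyMap, Category.assoc, toBody_E]

theorem cells_right {A : CellCx.{u}} {f : Arrow TopCat.{u}} (φ : A ⟶ free f) (n k : ℕ)
    (s : (A.stratum n).cells k) :
    (show (freeStage f n).stratum.cells k from (φ.strat n).cells k s).1.right =
      (A.stratum n).char k s ≫ (A.link n).hom ≫ A.toBody (n + 1) ≫ bodyMap φ ≫ E f := by
  have e₁ : (A.link n).hom ≫ (φ.strat (n + 1)).base = Stratum.bodyMap (φ.strat n) :=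
    (φ.coherent n).trans (Category.comp_id _)
  have e₂ : (A.link n).hom ≫ A.toBody (n + 1) ≫ bodyMap φ ≫ E f =
      Stratum.bodyMap (φ.strat n) ≫ (freeStage f n).ext :=
    (congrArg ((A.link n).hom ≫ ·) (toBody_bodyMap_E φ (n + 1))).trans
      ((Category.assoc _ _ _).symm.trans (congrArg (· ≫ (freeStage f n).ext) e₁))
  rw [e₂, ← Category.assoc, Stratum.char_bodyMap]
  exact ((freeStage f n).char_ext k _).symm

theorem freeCounit_injective (A : CellCx.{u}) (f : Arrow TopCat.{u}) :
    Function.Injective fun φ : A ⟶ free f => U.map φ ≫ freeCounit f := by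
  intro φ ψ h
  have hl : (φ.strat 0).base = (ψ.strat 0).base :=
    (map_freeCounit_left φ).symm.trans
      ((congrArg Arrow.Hom.left h).trans (map_freeCounit_left ψ))
  have hr : bodyMap φ ≫ E f = bodyMap ψ ≫ E f :=
    (map_freeCounit_right φ).symm.trans
      ((congrArg Arrow.Hom.right h).trans (map_freeCounit_right ψ))
  have hbase : ∀ n, (φ.strat n).base = (ψ.strat n).base → φ.strat n = ψ.strat n := by
    intro n hn
    refine Stratum.Hom.ext hn (funext fun k => funext fun s => ?_)
    apply Subtype.ext
    apply Arrow.hom_ext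
    · have h₁ := (φ.strat n).attach_comp k s
      have h₂ := (ψ.strat n).attach_comp k s
      rw [hn] at h₁
      exact h₁.symm.trans h₂
    · refine (cells_right φ n k s).trans (Eq.trans ?_ (cells_right ψ n k s).symm)
      rw [hr]
  have hall : ∀ n, φ.strat n = ψ.strat n := by
    intro n
    induction n with
    | zero => exact hbase 0 hl
    | succ n ih =>
      apply hbase
      rw [← cancel_epi (A.link n).hom, φ.coherent, ψ.coherent, ih]
  exact Hom.ext (funext hall)

/-- A map from `X_n` to a stage of the free cell complex over the given map, for which the images
of the cells are allowed. -/
structure LiftStage (A : CellCx.{u}) {f : Arrow TopCat.{u}} (h : A.body ⟶ f.right) (n : ℕ) where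
  g : (A.stratum n).X ⟶ (freeStage f n).X
  w : g ≫ (freeStage f n).e = A.toBody n ≫ h
  ok : ∀ (k : ℕ) (s : (A.stratum n).cells k), (freeStage f n).ok k ((A.stratum n).attach k s ≫ g)

namespace LiftStage

variable {A : CellCx.{u}} {f : Arrow TopCat.{u}} {h : A.body ⟶ f.right} {n : ℕ}

theorem incl_link (A : CellCx.{u}) {Z : TopCat.{u}} (h : A.body ⟶ Z) (n : ℕ) :
    (A.stratum n).incl ≫ (A.link n).hom ≫ A.toBody (n + 1) ≫ h = A.toBody n ≫ h := by
  rw [← A.step_toBody n, step, Category.assoc, Category.assoc]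

noncomputable def strat (T : LiftStage A h n) : A.stratum n ⟶ (freeStage f n).stratum :=
  Stratum.Hom.mk (Q := (freeStage f n).stratum) T.g
    (fun k s => ⟨Arrow.homMk ((A.stratum n).attach k s ≫ T.g)
      ((A.stratum n).char k s ≫ (A.link n).hom ≫ A.toBody (n + 1) ≫ h) (by
        change ((A.stratum n).attach k s ≫ T.g) ≫ (freeStage f n).e =
          diskBoundaryInclusion k ≫ (A.stratum n).char k s ≫ (A.link n).hom ≫
            A.toBody (n + 1) ≫ h
        rw [Category.assoc, T.w, ← incl_link, ← Category.assoc (diskBoundaryInclusion k),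
          ← Stratum.attach_incl, Category.assoc]), T.ok k s⟩)
    (fun _ _ => rfl)

theorem bodyMap_strat (T : LiftStage A h n) :
    Stratum.bodyMap T.strat ≫ (freeStage f n).ext = (A.link n).hom ≫ A.toBody (n + 1) ≫ h := by
  apply Stratum.body_hom_ext
  · rw [← Category.assoc, Stratum.incl_bodyMap, Category.assoc, FreeStage.incl_ext, incl_link]
    exact T.w
  · intro k s
    rw [← Category.assoc, Stratum.char_bodyMap, FreeStage.char_ext]
    rfl

noncomputable def next (T : LiftStage A h n) : LiftStage A h (n + 1) where
  g := (A.link n).inv ≫ Stratum.bodyMap T.strat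
  w := (Category.assoc _ _ _).trans ((Iso.inv_comp_eq _).mpr T.bodyMap_strat)
  ok k s := by
    rintro ⟨c, hc⟩
    obtain ⟨c', hc'⟩ := Stratum.factors_of_bodyMap_factors T.strat
      ((A.stratum (n + 1)).attach k s ≫ (A.link n).inv) c
      ((Category.assoc _ _ _).trans hc.symm)
    exact A.proper n k s ⟨c', by
      rw [← Category.assoc, hc', Category.assoc, Iso.inv_hom_id, Category.comp_id]⟩

end LiftStage

noncomputable def liftStage (A : CellCx.{u}) {f : Arrow TopCat.{u}} (h : U.obj A ⟶ f) :
    ∀ n, LiftStage A (f := f) h.right n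
  | 0 => ⟨h.left, h.w, fun _ _ => trivial⟩
  | n + 1 => (liftStage A h n).next

noncomputable def lift (A : CellCx.{u}) {f : Arrow TopCat.{u}} (h : U.obj A ⟶ f) :
    A ⟶ free f :=
  Hom.mk (B := free f) (fun n => (liftStage A h n).strat) (fun n =>
    (Iso.hom_inv_id_assoc (A.link n) (Stratum.bodyMap (liftStage A h n).strat)).trans
      (Category.comp_id (Stratum.bodyMap (liftStage A h n).strat)).symm)

theorem freeCounit_surjective (A : CellCx.{u}) (f : Arrow TopCat.{u}) :
    Function.Surjective fun φ : A ⟶ free f => U.map φ ≫ freeCounit f := by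
  intro h
  refine ⟨lift A h, ?_⟩
  apply Arrow.hom_ext
  · exact map_freeCounit_left (lift A h)
  · refine (map_freeCounit_right (lift A h)).trans (body_hom_ext (A := A) fun n => ?_)
    exact (toBody_bodyMap_E (lift A h) n).trans (liftStage A h n).w

/-- The bijection between maps `UA ⟶ f` and morphisms of cell complexes `A ⟶ Kf`. -/
noncomputable def freeEquiv (A : CellCx.{u}) (f : Arrow TopCat.{u}) :
    (U.obj A ⟶ f) ≃ (A ⟶ free f) :=
  (Equiv.ofBijective _ ⟨freeCounit_injective A f, freeCounit_surjective A f⟩).symm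

theorem freeEquiv_naturality (A' A : CellCx.{u}) (f : Arrow TopCat.{u}) (φ : A' ⟶ A)
    (h : U.obj A ⟶ f) : freeEquiv A' f (U.map φ ≫ h) = φ ≫ freeEquiv A f h := by
  rw [← Equiv.eq_symm_apply]
  have e : U.map (freeEquiv A f h) ≫ freeCounit f = h := (freeEquiv A f).symm_apply_apply h
  have e' : (freeEquiv A' f).symm (φ ≫ freeEquiv A f h) =
      U.map (φ ≫ freeEquiv A f h) ≫ freeCounit f := rfl
  rw [e', U.map_comp, Category.assoc, e]

/-- The functor `K`, sending `f` to the free cell complex on `f`. -/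
noncomputable def K : Arrow TopCat.{u} ⥤ CellCx.{u} :=
  Adjunction.rightAdjointOfEquiv freeEquiv freeEquiv_naturality

/-- The adjunction between `U` and `K`, with counit `(1, Ef)`. -/
noncomputable def adj : U.{u} ⊣ K.{u} :=
  Adjunction.adjunctionOfEquivRight freeEquiv freeEquiv_naturality

theorem map_K_freeCounit {f g : Arrow TopCat.{u}} (φ : f ⟶ g) :
    U.map (K.map φ) ≫ freeCounit g = freeCounit f ≫ φ := by
  have e : (freeEquiv (free f) f).symm (𝟙 (free f)) = freeCounit f := by
    change U.map (𝟙 (free f)) ≫ freeCounit f = freeCounit f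
    rw [U.map_id, Category.id_comp]
  have h : (freeEquiv (free f) g).symm (K.map φ) =
      (freeEquiv (free f) f).symm (𝟙 (free f)) ≫ φ :=
    (freeEquiv (free f) g).symm_apply_apply _
  rw [e] at h
  exact h

/-- The functorial factorisation of `f` as `Ef ∘ UKf`. -/
noncomputable def factorization : FunctorialFactorization TopCat.{u} where
  M :=
    { obj := fun f => (free f).body
      map := fun φ => bodyMap (K.map φ)
      map_id := fun f => by
        have h := congrArg Arrow.Hom.right ((K ⋙ U).map_id f)
        exact h
      map_comp := fun φ ψ => by
        have h := congrArg Arrow.Hom.right ((K ⋙ U).map_comp φ ψ)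
        exact h }
  L f := (free f).map
  R f := E f
  L_naturality {f g} φ := by
    have h := congrArg Arrow.Hom.left (map_K_freeCounit φ)
    have h' : ((K.map φ).strat 0).base = φ.left :=
      (map_freeCounit_left (K.map φ)).symm.trans (h.trans (Category.id_comp φ.left))
    exact (congrArg (· ≫ (free g).map) h'.symm).trans (toBody_bodyMap (K.map φ) 0).symm
  R_naturality {f g} φ :=
    (map_freeCounit_right (K.map φ)).symm.trans
      (congrArg Arrow.Hom.right (map_K_freeCounit φ))
  fac f := toBody_E f 0

/-! ### Composition of cell complexes and the awfs `(UK, E)` -/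

/-- A composite `B * A` of cell complexes, where the body of `A` is identified with the base space
of `B` by `e`: a cell complex over the composite of the underlying maps, whose cells are the cells
of `A` and the cells of `B`, with the same characteristic maps. Since a cell of a cell complex lies
in the lowest stratum into which it can be attached, this determines the cell complex up to unique
isomorphism: each cell of `B` is moved down to the lowest possible stratum. -/
structure Composite (A B : CellCx.{u}) (e : A.body ≅ B.base) where
  cx : CellCx.{u}
  baseIso : cx.base ≅ A.base
  bodyIso : cx.body ≅ B.body
  w : cx.map ≫ bodyIso.hom = baseIso.hom ≫ A.map ≫ e.hom ≫ B.map
  cells : ∀ k : ℕ, A.Cell k ⊕ B.Cell k ≃ cx.Cell k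
  char_inl : ∀ (k : ℕ) (s : A.Cell k),
    cx.char (cells k (Sum.inl s)) ≫ bodyIso.hom = A.char s ≫ e.hom ≫ B.map
  char_inr : ∀ (k : ℕ) (t : B.Cell k),
    cx.char (cells k (Sum.inr t)) ≫ bodyIso.hom = B.char t

/-- The base space of `KEf` is the body of `Kf`. -/
noncomputable def baseEIso (f : Arrow TopCat.{u}) : (free f).body ≅ (free (Arrow.mk (E f))).base :=
  Iso.refl (free f).body

theorem comp_EE {f : Arrow TopCat.{u}}
    (c : Composite (free f) (free (Arrow.mk (E f))) (baseEIso f)) :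
    c.baseIso.hom ≫ f.hom = c.cx.map ≫ c.bodyIso.hom ≫ E (Arrow.mk (E f)) := by
  have h₁ : (free f).map ≫ E f = f.hom := toBody_E f 0
  have h₂ : (baseEIso f).hom ≫ (free (Arrow.mk (E f))).map ≫ E (Arrow.mk (E f)) = E f :=
    (Category.id_comp _).trans (toBody_E (Arrow.mk (E f)) 0)
  rw [← Category.assoc c.cx.map, c.w, ← h₁]
  simp only [Category.assoc]
  exact congrArg (fun t => c.baseIso.hom ≫ (free f).map ≫ t) h₂.symm

/-- For a composite `C` of `Kf` and `KEf`, the body of the morphism of cell complexes `C ⟶ Kf` that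
corresponds under the adjunction to `(1, EEf) : UC ⟶ f`. -/
noncomputable def Composite.mul {f : Arrow TopCat.{u}}
    (c : Composite (free f) (free (Arrow.mk (E f))) (baseEIso f)) :
    (free (Arrow.mk (E f))).body ⟶ (free f).body :=
  c.bodyIso.inv ≫ bodyMap ((adj.homEquiv c.cx f)
    (Arrow.homMk c.baseIso.hom (c.bodyIso.hom ≫ E (Arrow.mk (E f))) (comp_EE c)))

/-- The awfs structure of `(UK, E)`: the comultiplication is the one of the comonad of the
adjunction, and the multiplication is `Composite.mul` for the composite of `Kf` and `KEf`. -/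
structure IsCellStructure (A : AWFSStructure factorization.{u}) : Prop where
  comul : ∀ f, A.δMap f = (adj.toComonad.δ.app f).right
  mul : ∀ f, ∃ c : Composite (free f) (free (Arrow.mk (E f))) (baseEIso f), A.μMap f = c.mul

/-- The structure map of the generating map `S^{k-1} ⟶ D^k` as a left map: the characteristic map
of the cell given by the identity square. -/
noncomputable def genStructure (k : ℕ) :
    Arrow.mk (diskBoundaryInclusion.{u} k) ⟶
      factorization.left.obj (Arrow.mk (diskBoundaryInclusion.{u} k)) :=
  Arrow.homMk (𝟙 _)
    ((free (Arrow.mk (diskBoundaryInclusion.{u} k))).char (k := k) ⟨0, ⟨𝟙 _, trivial⟩⟩) (by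
      let f := Arrow.mk (diskBoundaryInclusion.{u} k)
      let s : ((free f).stratum 0).cells k := ⟨𝟙 f, trivial⟩
      have h : ((free f).stratum 0).attach k s ≫ (free f).step 0 =
          diskBoundaryInclusion k ≫ ((free f).stratum 0).char k s ≫ ((free f).link 0).hom := by
        rw [step, ← Category.assoc, Stratum.attach_incl, Category.assoc]
      change 𝟙 _ ≫ (free f).toBody 0 =
        diskBoundaryInclusion k ≫ ((free f).stratum 0).char k s ≫ ((free f).link 0).hom ≫
          (free f).toBody 1
      have h' := congrArg (· ≫ (free f).toBody 1) h
      simp only [Category.assoc] at h'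
      rw [← h', step_toBody]
      rfl)

end CellCx

/-! ### The small object argument of Garner -/

namespace FunctorialFactorization

variable {C : Type u} [Category.{v} C]

/-- The right parts, as a natural transformation. -/
def trans (F : FunctorialFactorization C) : F.M ⟶ Arrow.rightFunc where
  app := F.R
  naturality _ _ φ := F.R_naturality φ

/-- The trivial factorisation `f = f ∘ 1`. -/
def trivial (C : Type u) [Category.{v} C] : FunctorialFactorization C where
  M := Arrow.leftFunc
  L f := 𝟙 f.left
  R f := f.hom
  L_naturality _ := (Category.comp_id _).trans (Category.id_comp _).symm
  R_naturality φ := φ.w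
  fac _ := Category.id_comp _

/-- The composite `F ⊙ G`: factorise `f` by `G`, and then `R_G f` by `F`. -/
def comp (F G : FunctorialFactorization C) : FunctorialFactorization C where
  M := G.right ⋙ F.M
  L f := G.L f ≫ F.L (Arrow.mk (G.R f))
  R f := F.R (Arrow.mk (G.R f))
  L_naturality {f g} φ :=
    (Category.assoc _ _ _).symm.trans
      ((congrArg (· ≫ F.L (Arrow.mk (G.R g))) (G.L_naturality φ)).trans
        ((Category.assoc _ _ _).trans
          ((congrArg (G.L f ≫ ·) (F.L_naturality (G.right.map φ))).trans
            (Category.assoc _ _ _).symm)))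
  R_naturality φ := F.R_naturality (G.right.map φ)
  fac f := (Category.assoc _ _ _).trans
    ((congrArg (G.L f ≫ ·) (F.fac (Arrow.mk (G.R f)))).trans (G.fac f))

/-- The canonical morphism `G ⟶ F ⊙ G`. -/
def point (F G : FunctorialFactorization C) : Hom G (F.comp G) where
  χ :=
    { app := fun f => F.L (Arrow.mk (G.R f))
      naturality := fun _ _ φ => F.L_naturality (G.right.map φ) }
  left_comp _ := rfl
  comp_right f := F.fac (Arrow.mk (G.R f))

/-- The morphism `F ⊙ G ⟶ F ⊙ H` induced by `G ⟶ H`. -/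
def compMap (F : FunctorialFactorization C) {G H : FunctorialFactorization C} (a : Hom G H) :
    Hom (F.comp G) (F.comp H) where
  χ := Functor.whiskerRight a.rightTrans F.M
  left_comp f :=
    (Category.assoc _ _ _).trans
      ((congrArg (G.L f ≫ ·) (F.L_naturality (a.rightTrans.app f)).symm).trans
        ((Category.assoc _ _ _).symm.trans
          (congrArg (· ≫ F.L (Arrow.mk (H.R f))) (a.left_comp f))))
  comp_right f :=
    (F.R_naturality (a.rightTrans.app f)).trans (Category.comp_id _)

section

variable [HasCoequalizers C]

/-- The coequaliser of two morphisms of functorial factorisations, formed on the central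
functors. -/
noncomputable def coeq {F G : FunctorialFactorization C} (a b : Hom F G) :
    FunctorialFactorization C where
  M := coequalizer a.χ b.χ
  L f := G.L f ≫ (coequalizer.π a.χ b.χ).app f
  R f := (coequalizer.desc (f := a.χ) (g := b.χ) G.trans (by
      ext f
      exact (a.comp_right f).trans (b.comp_right f).symm)).app f
  L_naturality {f g} φ := by
    rw [← Category.assoc, G.L_naturality, Category.assoc, Category.assoc, NatTrans.naturality]
  R_naturality φ := NatTrans.naturality _ φ
  fac f := (Category.assoc _ _ _).trans
    ((congrArg (G.L f ≫ ·) (NatTrans.congr_app (coequalizer.π_desc _ _) f)).trans (G.fac f))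

/-- The projection to the coequaliser. -/
noncomputable def coeqProj {F G : FunctorialFactorization C} (a b : Hom F G) :
    Hom G (coeq a b) where
  χ := coequalizer.π a.χ b.χ
  left_comp _ := rfl
  comp_right f := NatTrans.congr_app (coequalizer.π_desc _ _) f

/-- Two consecutive terms `X ⟶ Y` of the free monoid sequence of the pointed object `T`, with the
action `T ⊙ X ⟶ Y`. -/
structure MonoidStage (T : FunctorialFactorization C) where
  X : FunctorialFactorization C
  Y : FunctorialFactorization C
  x : Hom X Y
  σ : Hom (T.comp X) Y

/-- The free monoid sequence: it starts with `1 ⟶ T`, and the term after `X ⟶ Y` is the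
coequaliser of the two maps `T ⊙ X ⟶ T ⊙ Y` given by `T ⊙ x` and by `T ⊙ X ⟶ Y ⟶ T ⊙ Y`. -/
noncomputable def monoidStage (T : FunctorialFactorization C) : ℕ → MonoidStage T
  | 0 =>
    { X := trivial C
      Y := T
      x :=
        { χ := { app := T.L, naturality := fun _ _ φ => T.L_naturality φ }
          left_comp := fun _ => Category.id_comp _
          comp_right := T.fac }
      σ :=
        { χ := { app := fun f => 𝟙 (T.M.obj f)
                 naturality := fun _ _ _ => (Category.comp_id _).trans (Category.id_comp _).symm }
          left_comp := fun _ => (Category.comp_id _).trans (Category.id_comp _)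
          comp_right := fun _ => Category.id_comp _ } }
  | n + 1 =>
    let S := monoidStage T n
    { X := S.Y
      Y := coeq (T.compMap S.x) (S.σ.comp (T.point S.Y))
      x := (T.point S.Y).comp (coeqProj (T.compMap S.x) (S.σ.comp (T.point S.Y)))
      σ := coeqProj (T.compMap S.x) (S.σ.comp (T.point S.Y)) }

/-- The `n`-th term of the free monoid sequence. -/
noncomputable abbrev term (T : FunctorialFactorization C) (n : ℕ) : FunctorialFactorization C :=
  (monoidStage T n).X

/-- The connecting map of the free monoid sequence. -/
noncomputable def termMap (T : FunctorialFactorization C) (n : ℕ) :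
    Hom (T.term n) (T.term (n + 1)) :=
  (monoidStage T n).x

/-- The action `T ⊙ X_n ⟶ X_{n+1}`. -/
noncomputable def termAct (T : FunctorialFactorization C) (n : ℕ) :
    Hom (T.comp (T.term n)) (T.term (n + 1)) :=
  (monoidStage T n).σ

/-- The sequence of the central functors. -/
noncomputable def termSeq (T : FunctorialFactorization C) : ℕ ⥤ Arrow C ⥤ C :=
  Functor.ofSequence (X := fun n => (T.term n).M) fun n => (T.termMap n).χ

theorem termSeq_map (T : FunctorialFactorization C) (n : ℕ) :
    T.termSeq.map (homOfLE (Nat.le_add_right n 1)) = (T.termMap n).χ :=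
  Functor.ofSequence_map_homOfLE_succ (X := fun n => (T.term n).M) (fun n => (T.termMap n).χ) n

variable [HasColimitsOfShape ℕ C]

/-- The map from a term to the colimit. -/
noncomputable def toColim (T : FunctorialFactorization C) (n : ℕ) :
    (T.term n).M ⟶ colimit T.termSeq :=
  colimit.ι T.termSeq n

theorem termMap_toColim (T : FunctorialFactorization C) (n : ℕ) :
    (T.termMap n).χ ≫ T.toColim (n + 1) = T.toColim n :=
  (congrArg (· ≫ T.toColim (n + 1)) (T.termSeq_map n).symm).trans
    (colimit.w T.termSeq (homOfLE (Nat.le_add_right n 1)))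

/-- The right part of the colimit. -/
noncomputable def colimTrans (T : FunctorialFactorization C) :
    colimit T.termSeq ⟶ Arrow.rightFunc :=
  colimit.desc T.termSeq
    { pt := Arrow.rightFunc
      ι := NatTrans.ofSequence (G := (Functor.const ℕ).obj Arrow.rightFunc)
        (fun n => (T.term n).trans) (fun n => by
          rw [termSeq_map]
          refine Eq.trans ?_ (Category.comp_id _).symm
          ext f
          exact (T.termMap n).comp_right f) }

theorem toColim_colimTrans (T : FunctorialFactorization C) (n : ℕ) :
    T.toColim n ≫ T.colimTrans = (T.term n).trans :=
  colimit.ι_desc _ n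

/-- The colimit of the free monoid sequence at stage `ω`. -/
noncomputable def colim (T : FunctorialFactorization C) : FunctorialFactorization C where
  M := colimit T.termSeq
  L f := (T.toColim 0).app f
  R f := T.colimTrans.app f
  L_naturality φ := (T.toColim 0).naturality φ
  R_naturality φ := T.colimTrans.naturality φ
  fac f := NatTrans.congr_app (T.toColim_colimTrans 0) f

/-- The morphism from a term to the colimit. -/
noncomputable def ι (T : FunctorialFactorization C) (n : ℕ) : Hom (T.term n) T.colim where
  χ := T.toColim n
  left_comp f := by
    induction n with
    | zero => exact Category.id_comp _
    | succ n ih =>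
      rw [← ih, ← termMap_toColim T n, ← (T.termMap n).left_comp, NatTrans.comp_app,
        Category.assoc]
      rfl
  comp_right f := NatTrans.congr_app (T.toColim_colimTrans n) f

/-- The morphism from `T`, the first term, to the colimit. -/
noncomputable def ιOne (T : FunctorialFactorization C) : Hom T T.colim :=
  T.ι 1

end

end FunctorialFactorization

namespace Garner

/-- The stratum with one cell for each commutative square from a generating map to `f`. -/
noncomputable abbrev oneStratum (f : Arrow TopCat.{u}) : Stratum.{u} where
  X := f.left
  cells k := Arrow.mk (diskBoundaryInclusion.{u} k) ⟶ f
  attach _ s := s.left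

/-- The morphism of strata induced by a morphism of `Top²`. -/
noncomputable def oneStratumMap {f g : Arrow TopCat.{u}} (φ : f ⟶ g) :
    oneStratum f ⟶ oneStratum g :=
  Stratum.Hom.mk (P := oneStratum f) (Q := oneStratum g) φ.left (fun _ s => s ≫ φ)
    (fun _ s => (Arrow.comp_left s φ).symm)

/-- The map from the body to the codomain of `f`. -/
noncomputable def oneExt (f : Arrow TopCat.{u}) : (oneStratum f).body ⟶ f.right :=
  (oneStratum f).desc f.hom (fun _ s => s.right) (fun _ s => s.w)

/-- The one-step factorisation: all cells that fit into a square over `f` are attached. -/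
noncomputable def oneStep : FunctorialFactorization TopCat.{u} where
  M :=
    { obj := fun f => (oneStratum f).body
      map := fun φ => Stratum.bodyMap (oneStratumMap φ)
      map_id := fun f => by
        have h : oneStratumMap (𝟙 f) = 𝟙 (oneStratum f) :=
          Stratum.Hom.ext rfl (funext fun _ => funext fun s => Category.comp_id s)
        rw [h, Stratum.bodyMap_id]
      map_comp := fun φ ψ => by
        have h : oneStratumMap (φ ≫ ψ) = oneStratumMap φ ≫ oneStratumMap ψ :=
          Stratum.Hom.ext rfl (funext fun _ => funext fun s => (Category.assoc s φ ψ).symm)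
        rw [h, Stratum.bodyMap_comp] }
  L f := (oneStratum f).incl
  R f := oneExt f
  L_naturality φ := (Stratum.incl_bodyMap (oneStratumMap φ)).symm
  R_naturality {f g} φ := by
    apply Stratum.body_hom_ext
    · rw [← Category.assoc, Stratum.incl_bodyMap, Category.assoc, oneExt, oneExt,
        Stratum.incl_desc, ← Category.assoc, Stratum.incl_desc]
      exact φ.w
    · intro k s
      rw [← Category.assoc, Stratum.char_bodyMap, oneExt, oneExt, Stratum.char_desc,
        ← Category.assoc, Stratum.char_desc]
      exact Arrow.comp_right s φ
  fac f := Stratum.incl_desc _ _ _ _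

/-- The comultiplication of the one-step comonad: the cell of a square `s` goes to the cell of the
square formed by the attaching map and the characteristic map of `s`. -/
noncomputable def oneComul (f : Arrow TopCat.{u}) :
    (oneStratum f).body ⟶ (oneStratum (Arrow.mk (oneStratum f).incl)).body :=
  Stratum.bodyMap (Stratum.Hom.mk (P := oneStratum f)
    (Q := oneStratum (Arrow.mk (oneStratum f).incl)) (𝟙 f.left)
    (fun k s => Arrow.homMk s.left ((oneStratum f).char k s) ((oneStratum f).attach_incl k s))
    (fun _ _ => Category.comp_id _))

/-- The functorial factorisation produced by the small object argument, which for the generating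
maps `S^{n-1} ⟶ D^n` stops at stage `ω`. -/
noncomputable def factorization : FunctorialFactorization TopCat.{u} := oneStep.{u}.colim

/-- The awfs structure produced by the small object argument: the free monoid on the one-step
comonad. The inclusion of the one-step comonad is a morphism of comonads, and the multiplication
restricts to the actions of the free monoid sequence. -/
structure IsFreeMonoidStructure (G : AWFSStructure factorization.{u}) : Prop where
  comul : ∀ f : Arrow TopCat.{u},
    oneStep.{u}.ιOne.χ.app f ≫ G.δMap f =
      oneComul f ≫ oneStep.{u}.ιOne.χ.app (oneStep.{u}.left.obj f) ≫
        factorization.{u}.M.map (oneStep.{u}.ιOne.leftTrans.app f)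
  mul : ∀ (n : ℕ) (f : Arrow TopCat.{u}),
    (oneStep.{u}.ιOne.χ.app ((oneStep.{u}.term n).right.obj f) ≫
      factorization.{u}.M.map ((oneStep.{u}.ι n).rightTrans.app f)) ≫ G.μMap f =
        (oneStep.{u}.termAct n).χ.app f ≫ (oneStep.{u}.ι (n + 1)).χ.app f

end Garner

/-!
A lifting operation on `f` fills every square from some `j_k` to `f`. Squares from `j_k` to `Ef` are
in bijection with the cells of `Kf`: by compactness and properness every square to `Ef` arises in
exactly one stratum. The characteristic maps thus define a lifting operation on `Ef`, and since the
body of `Kf` is built from the domain of `f` by these cells, it is the free one on `f`. Lifting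
operations compose, and this alone yields the comultiplication of an awfs whose right maps they are.
A functor from `J` to the left maps of another awfs turns the free maps of its monad into maps with
a lifting operation, which gives the unique comparison.

The terms of the free monoid sequence map to the body of `Kf` by freeness, and by properness the
`n`-th term is identified with the `n`-th stage of `Kf`, so both sequences have the same colimit.
-/

universe t

/-! ### Lifting operations -/

section LiftingOperations

variable {C : Type u} [Category.{v} C] {ι : Type t} {j : ι → Arrow C}

/-- A choice of a diagonal filler for every commutative square from a member of the family `j` to
`f`. It plays the role of an algebra structure on `f` for the monad of an awfs generated by `j`. -/
@[ext]
structure Lifting (j : ι → Arrow C) (f : Arrow C) where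
  fill : ∀ k, (j k ⟶ f) → ((j k).right ⟶ f.left)
  hom_fill : ∀ k s, (j k).hom ≫ fill k s = s.left
  fill_hom : ∀ k s, fill k s ≫ f.hom = s.right

namespace Lifting

/-- The commutative squares that preserve the chosen fillers. -/
def IsHom {f g : Arrow C} (Γ : Lifting j f) (Δ : Lifting j g) (φ : f ⟶ g) : Prop :=
  ∀ k s, Γ.fill k s ≫ φ.left = Δ.fill k (s ≫ φ)

theorem IsHom.id {f : Arrow C} (Γ : Lifting j f) : Γ.IsHom Γ (𝟙 f) := fun k s => by
  rw [Category.comp_id s]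
  exact Category.comp_id _

theorem IsHom.comp {f g h : Arrow C} {Γ : Lifting j f} {Δ : Lifting j g} {Θ : Lifting j h}
    {φ : f ⟶ g} {ψ : g ⟶ h} (hφ : Γ.IsHom Δ φ) (hψ : Δ.IsHom Θ ψ) : Γ.IsHom Θ (φ ≫ ψ) :=
  fun k s => by
    rw [Arrow.comp_left, ← Category.assoc, hφ, hψ, Category.assoc]

section Comp

variable {X Y Z V X' Y' Z' : C} {f : X ⟶ Y} {g : Y ⟶ Z} {f' : X' ⟶ Y'} {g' : Y' ⟶ Z'}

/-- The square from `f ≫ g` to `g` with domain part `f`. -/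
abbrev compSnd (f : X ⟶ Y) (g : Y ⟶ Z) : Arrow.mk (f ≫ g) ⟶ Arrow.mk g :=
  Arrow.homMk f (𝟙 Z) (Category.comp_id _).symm

/-- The square to `f` that remains of a square to `f ≫ g` once it has been filled against `g`. -/
def upperSquare (Δ : Lifting j (Arrow.mk g)) {k : ι} (s : j k ⟶ Arrow.mk (f ≫ g)) :
    j k ⟶ Arrow.mk f :=
  Arrow.homMk s.left (Δ.fill k (s ≫ compSnd f g)) (Δ.hom_fill k (s ≫ compSnd f g)).symm

theorem upperSquare_right_comp (Δ : Lifting j (Arrow.mk g)) {k : ι}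
    (s : j k ⟶ Arrow.mk (f ≫ g)) : (Δ.upperSquare s).right ≫ g = s.right :=
  (Δ.fill_hom k (s ≫ compSnd f g)).trans (Category.comp_id _)

/-- The composite of lifting operations on composable maps: fill first against `g`, then against
`f`. -/
def comp (Γ : Lifting j (Arrow.mk f)) (Δ : Lifting j (Arrow.mk g)) :
    Lifting j (Arrow.mk (f ≫ g)) where
  fill k s := Γ.fill k (Δ.upperSquare s)
  hom_fill k s := Γ.hom_fill k (Δ.upperSquare s)
  fill_hom k s := calc
    Γ.fill k (Δ.upperSquare s) ≫ f ≫ g = (Γ.fill k (Δ.upperSquare s) ≫ f) ≫ g :=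
      (Category.assoc _ _ _).symm
    _ = (Δ.upperSquare s).right ≫ g := congrArg (· ≫ g) (Γ.fill_hom k (Δ.upperSquare s))
    _ = s.right := Δ.upperSquare_right_comp s

theorem isHom_compSnd (Γ : Lifting j (Arrow.mk f)) (Δ : Lifting j (Arrow.mk g)) :
    (Γ.comp Δ).IsHom Δ (compSnd f g) := fun k s => Γ.fill_hom k (Δ.upperSquare s)

theorem IsHom.of_comp {h : Arrow C} {Γ : Lifting j (Arrow.mk f)} {Θ : Lifting j h}
    {φ : Arrow.mk f ⟶ h} (hφ : Γ.IsHom Θ φ) (Δ : Lifting j (Arrow.mk g))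
    {ψ : Arrow.mk (f ≫ g) ⟶ h} (hl : ψ.left = φ.left) (hr : g ≫ ψ.right = φ.right) :
    (Γ.comp Δ).IsHom Θ ψ := fun k s => by
  have hs : Δ.upperSquare s ≫ φ = s ≫ ψ := by
    ext
    · exact congrArg (s.left ≫ ·) hl.symm
    · calc (Δ.upperSquare s).right ≫ φ.right = ((Δ.upperSquare s).right ≫ g) ≫ ψ.right := by
            rw [← hr, Category.assoc]
        _ = s.right ≫ ψ.right := congrArg (· ≫ ψ.right) (Δ.upperSquare_right_comp s)
  rw [hl, ← hs]
  exact hφ k (Δ.upperSquare s)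

/-- The pasting of two squares along their common vertical edge. -/
abbrev paste (φ : Arrow.mk f ⟶ Arrow.mk f') (ψ : Arrow.mk g ⟶ Arrow.mk g')
    (h : φ.right = ψ.left) : Arrow.mk (f ≫ g) ⟶ Arrow.mk (f' ≫ g') :=
  Arrow.homMk φ.left ψ.right (calc
    φ.left ≫ f' ≫ g' = (φ.left ≫ f') ≫ g' := (Category.assoc _ _ _).symm
    _ = (f ≫ ψ.left) ≫ g' := congrArg (· ≫ g') (h ▸ φ.w)
    _ = f ≫ ψ.left ≫ g' := Category.assoc _ _ _
    _ = f ≫ g ≫ ψ.right := congrArg (f ≫ ·) ψ.w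
    _ = (f ≫ g) ≫ ψ.right := (Category.assoc _ _ _).symm)

theorem IsHom.paste {Γ : Lifting j (Arrow.mk f)} {Δ : Lifting j (Arrow.mk g)}
    {Γ' : Lifting j (Arrow.mk f')} {Δ' : Lifting j (Arrow.mk g')} {φ : Arrow.mk f ⟶ Arrow.mk f'}
    {ψ : Arrow.mk g ⟶ Arrow.mk g'} (hφ : Γ.IsHom Γ' φ) (hψ : Δ.IsHom Δ' ψ)
    (h : φ.right = ψ.left) : (Γ.comp Δ).IsHom (Γ'.comp Δ') (Lifting.paste φ ψ h) := fun k s => by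
  have hg : (s ≫ compSnd f g) ≫ ψ = (s ≫ Lifting.paste φ ψ h) ≫ compSnd f' g' := by
    rw [Category.assoc, Category.assoc]
    refine congrArg (s ≫ ·) (Arrow.hom_ext _ _ ?_ ?_)
    · exact (h ▸ φ.w.symm : f ≫ ψ.left = φ.left ≫ f')
    · exact (Category.id_comp _).trans (Category.comp_id _).symm
  have hf : Δ.upperSquare s ≫ φ = Δ'.upperSquare (s ≫ Lifting.paste φ ψ h) := by
    refine Arrow.hom_ext _ _ rfl ?_
    calc Δ.fill k (s ≫ compSnd f g) ≫ φ.right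
      _ = Δ.fill k (s ≫ compSnd f g) ≫ ψ.left := by rw [h]
      _ = Δ'.fill k ((s ≫ Lifting.paste φ ψ h) ≫ compSnd f' g') := by rw [hψ, hg]
  exact (hφ k (Δ.upperSquare s)).trans (congrArg (Γ'.fill k) hf)

theorem isHom_assoc {h : Z ⟶ V} (Γ : Lifting j (Arrow.mk f)) (Δ : Lifting j (Arrow.mk g))
    (Θ : Lifting j (Arrow.mk h)) : ((Γ.comp Δ).comp Θ).IsHom (Γ.comp (Δ.comp Θ))
      (Arrow.homMk (𝟙 X) (𝟙 V) (by simp)) := fun k s => by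
  have hgh : Θ.upperSquare s ≫ compSnd f g = Θ.upperSquare ((s ≫ Arrow.homMk (𝟙 X) (𝟙 V)
      (by simp) : j k ⟶ Arrow.mk (f ≫ g ≫ h)) ≫ compSnd f (g ≫ h)) := by
    ext
    · exact congrArg (· ≫ f) (Category.comp_id s.left).symm
    · refine (Category.comp_id _).trans (congrArg (Θ.fill k) ?_)
      ext <;> simp
  refine (Category.comp_id _).trans (congrArg (Γ.fill k) ?_)
  ext
  · exact (Category.comp_id s.left).symm
  · exact congrArg (Δ.fill k) hgh

end Comp

end Lifting

end LiftingOperations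

section FreeLiftings

variable {C : Type u} [Category.{v} C] {ι : Type t} {j : ι → Arrow C}
  {F : FunctorialFactorization C}

theorem FunctorialFactorization.L_map_comp (F : FunctorialFactorization C) {f g : Arrow C}
    (φ : f ⟶ g) {X : C} (h : F.M.obj g ⟶ X) : F.L f ≫ F.M.map φ ≫ h = φ.left ≫ F.L g ≫ h := by
  rw [← Category.assoc, ← F.L_naturality, Category.assoc]

/-- Lifting operations exhibiting `Rf` as the free map with a lifting operation on `f`, with unit
`(Lf, 1) : f ⟶ Rf`. The universal property only quantifies over arrows with a lifting operation,
so it determines the awfs without mentioning algebras of a monad. -/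
structure FreeLifting (j : ι → Arrow C) (F : FunctorialFactorization C) where
  lifting : ∀ f, Lifting j (F.right.obj f)
  isHom_map : ∀ {f g : Arrow C} (φ : f ⟶ g), (lifting f).IsHom (lifting g) (F.right.map φ)
  desc : ∀ {f g : Arrow C}, Lifting j g → (f ⟶ g) → (F.right.obj f ⟶ g)
  isHom_desc : ∀ {f g : Arrow C} (Γ : Lifting j g) (φ : f ⟶ g),
    (lifting f).IsHom Γ (desc Γ φ)
  L_desc : ∀ {f g : Arrow C} (Γ : Lifting j g) (φ : f ⟶ g), F.L f ≫ (desc Γ φ).left = φ.left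
  desc_right : ∀ {f g : Arrow C} (Γ : Lifting j g) (φ : f ⟶ g), (desc Γ φ).right = φ.right
  hom_ext : ∀ {f g : Arrow C} {Γ : Lifting j g} {ψ ψ' : F.right.obj f ⟶ g},
    (lifting f).IsHom Γ ψ → (lifting f).IsHom Γ ψ' → F.L f ≫ ψ.left = F.L f ≫ ψ'.left →
      ψ.right = ψ'.right → ψ = ψ'

namespace FreeLifting

variable (Ψ : FreeLifting j F)

/-- The multiplication `(μ_f, 1) : RRf ⟶ Rf`. -/
def mul (f : Arrow C) : F.right.obj (F.right.obj f) ⟶ F.right.obj f :=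
  Ψ.desc (Ψ.lifting f) (𝟙 _)

theorem isHom_mul (f : Arrow C) :
    (Ψ.lifting (F.right.obj f)).IsHom (Ψ.lifting f) (Ψ.mul f) := Ψ.isHom_desc _ _

theorem L_mul (f : Arrow C) : F.L (F.right.obj f) ≫ (Ψ.mul f).left = 𝟙 _ := Ψ.L_desc _ _

theorem L_mul_comp (f : Arrow C) {X : C} (h : F.M.obj f ⟶ X) :
    F.L (F.right.obj f) ≫ (Ψ.mul f).left ≫ h = h :=
  (Category.assoc _ _ _).symm.trans ((congrArg (· ≫ h) (Ψ.L_mul f)).trans (Category.id_comp h))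

theorem mul_right (f : Arrow C) : (Ψ.mul f).right = 𝟙 _ := Ψ.desc_right _ _

theorem mul_naturality {f g : Arrow C} (φ : f ⟶ g) :
    F.right.map (F.right.map φ) ≫ Ψ.mul g = Ψ.mul f ≫ F.right.map φ := by
  refine Ψ.hom_ext ((Ψ.isHom_map _).comp (Ψ.isHom_mul g)) ((Ψ.isHom_mul f).comp (Ψ.isHom_map φ))
    ?_ ?_
  · exact (F.L_map_comp _ _).trans ((congrArg (_ ≫ ·) (Ψ.L_mul g)).trans
      ((Category.comp_id _).trans (Ψ.L_mul_comp f _).symm))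
  · rw [Arrow.comp_right, Arrow.comp_right, mul_right, mul_right]
    exact (Category.comp_id _).trans (Category.id_comp _).symm

theorem unit_mul (f : Arrow C) : F.unit.app (F.right.obj f) ≫ Ψ.mul f = 𝟙 _ := by
  ext
  · exact Ψ.L_mul f
  · exact (Category.id_comp _).trans (Ψ.mul_right f)

theorem map_unit_mul (f : Arrow C) : F.right.map (F.unit.app f) ≫ Ψ.mul f = 𝟙 _ := by
  refine Ψ.hom_ext ((Ψ.isHom_map _).comp (Ψ.isHom_mul f)) (Lifting.IsHom.id _) ?_ ?_
  · exact (F.L_map_comp _ _).trans (congrArg (F.L f ≫ ·) (Ψ.L_mul f))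
  · exact (Category.id_comp _).trans (Ψ.mul_right f)

theorem mul_assoc (f : Arrow C) :
    F.right.map (Ψ.mul f) ≫ Ψ.mul f = Ψ.mul (F.right.obj f) ≫ Ψ.mul f := by
  refine Ψ.hom_ext ((Ψ.isHom_map _).comp (Ψ.isHom_mul f))
    ((Ψ.isHom_mul _).comp (Ψ.isHom_mul f)) ?_ ?_
  · exact (F.L_map_comp _ _).trans ((congrArg (_ ≫ ·) (Ψ.L_mul f)).trans
      ((Category.comp_id _).trans (Ψ.L_mul_comp _ _).symm))
  · exact congrArg (· ≫ (Ψ.mul f).right) ((Ψ.mul_right f).trans (Ψ.mul_right (F.right.obj f)).symm)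

/-- The comultiplication as a map `(δ_f, 1) : Rf ⟶ Rf ∘ RLf`, where the composite carries the
composite lifting operation. -/
def comulHom (f : Arrow C) : F.right.obj f ⟶ Arrow.mk (F.R (F.left.obj f) ≫ F.R f) :=
  Ψ.desc (Lifting.comp (Ψ.lifting (F.left.obj f)) (Ψ.lifting f))
    (Arrow.homMk (F.L (F.left.obj f)) (𝟙 _) (by
      refine (Category.assoc _ _ _).symm.trans ((congrArg (· ≫ F.R f) (F.fac _)).trans ?_)
      exact (F.fac f).trans (Category.comp_id _).symm))

/-- The codomain part `δ_f : Mf ⟶ MLf` of the comultiplication. -/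
def comul (f : Arrow C) : F.M.obj f ⟶ F.M.obj (F.left.obj f) := (Ψ.comulHom f).left

theorem isHom_comulHom (f : Arrow C) : (Ψ.lifting f).IsHom
    (Lifting.comp (Ψ.lifting (F.left.obj f)) (Ψ.lifting f)) (Ψ.comulHom f) := Ψ.isHom_desc _ _

theorem L_comul (f : Arrow C) : F.L f ≫ Ψ.comul f = F.L (F.left.obj f) := Ψ.L_desc _ _

theorem L_comul_comp (f : Arrow C) {X : C} (h : F.M.obj (F.left.obj f) ⟶ X) :
    F.L f ≫ Ψ.comul f ≫ h = F.L (F.left.obj f) ≫ h :=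
  (Category.assoc _ _ _).symm.trans (congrArg (· ≫ h) (Ψ.L_comul f))

theorem comulHom_right (f : Arrow C) : (Ψ.comulHom f).right = 𝟙 _ := Ψ.desc_right _ _

theorem comulHom_compSnd (f : Arrow C) : Ψ.comulHom f ≫ Lifting.compSnd _ _ = 𝟙 _ := by
  refine Ψ.hom_ext ((Ψ.isHom_comulHom f).comp (Lifting.isHom_compSnd _ _)) (Lifting.IsHom.id _)
    ?_ ?_
  · exact (Ψ.L_comul_comp f _).trans ((F.fac _).trans (Category.comp_id _).symm)
  · exact (Category.comp_id _).trans (Ψ.comulHom_right f)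

theorem comul_R (f : Arrow C) : Ψ.comul f ≫ F.R (F.left.obj f) = 𝟙 _ :=
  congrArg Arrow.Hom.left (Ψ.comulHom_compSnd f)

/-- The comultiplication `(1, δ_f) : Lf ⟶ LLf`. -/
def comulLeft (f : Arrow C) : F.left.obj f ⟶ F.left.obj (F.left.obj f) :=
  Arrow.homMk (𝟙 f.left) (Ψ.comul f) ((Category.id_comp _).trans (Ψ.L_comul f).symm)

/-- The square `(δ_f, μ_f) : LRf ⟶ RLf`. -/
def distrib (f : Arrow C) : F.left.obj (F.right.obj f) ⟶ F.right.obj (F.left.obj f) :=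
  Arrow.homMk (Ψ.comul f) (Ψ.mul f).left ((Ψ.comul_R f).trans (Ψ.L_mul f).symm)

theorem comul_naturality {f g : Arrow C} (φ : f ⟶ g) :
    F.M.map φ ≫ Ψ.comul g = Ψ.comul f ≫ F.M.map (F.left.map φ) := by
  have h : F.right.map φ ≫ Ψ.comulHom g =
      Ψ.comulHom f ≫ Lifting.paste (F.right.map (F.left.map φ)) (F.right.map φ) rfl := by
    refine Ψ.hom_ext ((Ψ.isHom_map φ).comp (Ψ.isHom_comulHom g)) ((Ψ.isHom_comulHom f).comp
      ((Ψ.isHom_map (F.left.map φ)).paste (Ψ.isHom_map φ) rfl)) ?_ ?_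
    · refine (F.L_map_comp φ _).trans ((congrArg (φ.left ≫ ·) (Ψ.L_comul g)).trans ?_)
      exact (F.L_naturality (F.left.map φ)).trans (Ψ.L_comul_comp f _).symm
    · rw [Arrow.comp_right, Arrow.comp_right, comulHom_right, comulHom_right]
      exact (Category.comp_id _).trans (Category.id_comp _).symm
  exact congrArg Arrow.Hom.left h

theorem comul_map_counit (f : Arrow C) : Ψ.comul f ≫ F.M.map (F.counit.app f) = 𝟙 _ := by
  let σ : Arrow.mk (F.R (F.left.obj f) ≫ F.R f) ⟶ F.right.obj f :=
    Arrow.homMk (F.M.map (F.counit.app f)) (𝟙 _)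
      ((F.R_naturality (F.counit.app f)).trans (Category.comp_id _).symm)
  have h : Ψ.comulHom f ≫ σ = 𝟙 _ := by
    refine Ψ.hom_ext ((Ψ.isHom_comulHom f).comp
      ((Ψ.isHom_map (F.counit.app f)).of_comp _ rfl (Category.comp_id _))) (.id _) ?_ ?_
    · refine (Ψ.L_comul_comp f _).trans ((F.L_naturality _).symm.trans ?_)
      exact (Category.id_comp _).trans (Category.comp_id _).symm
    · exact (Category.comp_id _).trans (Ψ.comulHom_right f)
  exact congrArg Arrow.Hom.left h

theorem comul_assoc (f : Arrow C) : Ψ.comul f ≫ F.M.map (Ψ.comulLeft f) =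
    Ψ.comul f ≫ Ψ.comul (F.left.obj f) := by
  let σ := Lifting.paste (F.right.map (Ψ.comulLeft f)) (Ψ.comulHom f) rfl
  let τ := Lifting.paste (Ψ.comulHom (F.left.obj f)) (𝟙 (F.right.obj f)) (Ψ.comulHom_right _)
  let α : Arrow.mk ((F.R (F.left.obj (F.left.obj f)) ≫ F.R (F.left.obj f)) ≫ F.R f) ⟶
      Arrow.mk (F.R (F.left.obj (F.left.obj f)) ≫ F.R (F.left.obj f) ≫ F.R f) :=
    Arrow.homMk (𝟙 _) (𝟙 _) (by simp)
  have hσ := (Ψ.isHom_map (Ψ.comulLeft f)).paste (Ψ.isHom_comulHom f) rfl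
  have hτ := ((Ψ.isHom_comulHom (F.left.obj f)).paste (.id (Ψ.lifting f))
    (Ψ.comulHom_right _)).comp (Lifting.isHom_assoc _ _ _)
  have h : Ψ.comulHom f ≫ σ = Ψ.comulHom f ≫ τ ≫ α := by
    refine Ψ.hom_ext ((Ψ.isHom_comulHom f).comp hσ) ((Ψ.isHom_comulHom f).comp hτ) ?_ ?_
    · calc F.L f ≫ Ψ.comul f ≫ F.M.map (Ψ.comulLeft f)
        _ = F.L (F.left.obj f) ≫ F.M.map (Ψ.comulLeft f) := Ψ.L_comul_comp f _
        _ = F.L (F.left.obj (F.left.obj f)) :=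
          (F.L_naturality (Ψ.comulLeft f)).symm.trans (Category.id_comp _)
        _ = F.L (F.left.obj f) ≫ Ψ.comul (F.left.obj f) ≫ 𝟙 _ :=
          ((congrArg (_ ≫ ·) (Category.comp_id _)).trans (Ψ.L_comul _)).symm
        _ = F.L f ≫ Ψ.comul f ≫ Ψ.comul (F.left.obj f) ≫ 𝟙 _ := (Ψ.L_comul_comp f _).symm
    · exact congrArg ((Ψ.comulHom f).right ≫ ·)
        ((Ψ.comulHom_right f).trans (Category.comp_id _).symm)
  exact (congrArg Arrow.Hom.left h).trans (congrArg (Ψ.comul f ≫ ·) (Category.comp_id _))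

theorem mul_comul (f : Arrow C) : (Ψ.mul f).left ≫ Ψ.comul f =
    Ψ.comul (F.right.obj f) ≫ F.M.map (Ψ.distrib f) ≫ (Ψ.mul (F.left.obj f)).left := by
  have hr : (F.right.map (Ψ.distrib f) ≫ Ψ.mul (F.left.obj f)).right = (Ψ.mul f).left :=
    (congrArg ((Ψ.mul f).left ≫ ·) (Ψ.mul_right _)).trans (Category.comp_id _)
  have hσ := ((Ψ.isHom_map (Ψ.distrib f)).comp (Ψ.isHom_mul (F.left.obj f))).paste
    (Ψ.isHom_mul f) hr
  have h : Ψ.mul f ≫ Ψ.comulHom f = Ψ.comulHom (F.right.obj f) ≫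
      Lifting.paste (F.right.map (Ψ.distrib f) ≫ Ψ.mul (F.left.obj f)) (Ψ.mul f) hr := by
    refine Ψ.hom_ext ((Ψ.isHom_mul f).comp (Ψ.isHom_comulHom f))
      ((Ψ.isHom_comulHom (F.right.obj f)).comp hσ) ?_ ?_
    · calc F.L (F.right.obj f) ≫ (Ψ.mul f).left ≫ Ψ.comul f
        _ = Ψ.comul f := Ψ.L_mul_comp f _
        _ = Ψ.comul f ≫ F.L (F.right.obj (F.left.obj f)) ≫ (Ψ.mul (F.left.obj f)).left :=
          ((congrArg (_ ≫ ·) (Ψ.L_mul (F.left.obj f))).trans (Category.comp_id _)).symm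
        _ = F.L (F.left.obj (F.right.obj f)) ≫ F.M.map (Ψ.distrib f) ≫
            (Ψ.mul (F.left.obj f)).left := (F.L_map_comp (Ψ.distrib f) _).symm
        _ = _ := (Ψ.L_comul_comp (F.right.obj f) _).symm
    · rw [Arrow.comp_right, comulHom_right, Arrow.comp_right, comulHom_right]
      exact (Category.comp_id _).trans (Category.id_comp _).symm
  exact congrArg Arrow.Hom.left h

/-- The awfs structure of a free lifting operation. -/
def awfsStructure : AWFSStructure F where
  δ :=
    { app := Ψ.comulLeft
      naturality := fun f g φ => by
        ext
        · exact (Category.comp_id _).trans (Category.id_comp _).symm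
        · exact Ψ.comul_naturality φ }
  left_counit f := by
    ext
    · exact Category.id_comp _
    · exact Ψ.comul_R f
  right_counit f := by
    ext
    · exact Category.id_comp _
    · exact Ψ.comul_map_counit f
  coassoc f := by
    ext
    · rfl
    · exact Ψ.comul_assoc f
  μ :=
    { app := Ψ.mul
      naturality := fun _ _ φ => Ψ.mul_naturality φ }
  left_unit := Ψ.unit_mul
  right_unit := Ψ.map_unit_mul
  assoc := Ψ.mul_assoc
  distrib_unit f := by
    ext
    · exact Ψ.L_comul f
    · exact congrArg Arrow.Hom.left (Ψ.map_unit_mul f)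
  distrib_counit f := by
    ext
    · exact Ψ.comul_map_counit f
    · exact (Ψ.mul f).w.trans ((congrArg (F.R (F.right.obj f) ≫ ·) (Ψ.mul_right f)).trans
        (Category.comp_id _))
  distrib_mul f := by
    ext
    · exact Ψ.mul_comul f
    · refine (congrArg Arrow.Hom.left (Ψ.mul_assoc f)).trans
        (congrArg ((Ψ.mul (F.right.obj f)).left ≫ ·) ?_)
      exact ((congrArg (_ ≫ ·) (Ψ.mul_right (F.left.obj f))).trans (Category.comp_id _)).symm
  distrib_comul f := by
    ext
    · exact (Ψ.comul_assoc f).trans (Category.id_comp _).symm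
    · exact Ψ.mul_comul f

/-- The awfs of a free lifting operation. -/
abbrev awfs : AWFS C := ⟨F, Ψ.awfsStructure⟩

end FreeLifting

end FreeLiftings

namespace AWFS

variable {C : Type u} [Category.{v} C]

theorem μ_app_right (W : AWFS C) (f : Arrow C) : (W.str.μ.app f).right = 𝟙 _ :=
  (Category.id_comp _).symm.trans (congrArg Arrow.Hom.right (W.str.left_unit f))

theorem δ_app_left (W : AWFS C) (f : Arrow C) : (W.str.δ.app f).left = 𝟙 _ :=
  (Category.comp_id _).symm.trans (congrArg Arrow.Hom.left (W.str.left_counit f))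

theorem μMap_R (W : AWFS C) (f : Arrow C) :
    W.str.μMap f ≫ W.fact.R f = W.fact.R (W.fact.right.obj f) :=
  (W.str.μ.app f).w.trans ((congrArg (_ ≫ ·) (W.μ_app_right f)).trans (Category.comp_id _))

theorem L_δMap (W : AWFS C) (f : Arrow C) :
    W.fact.L f ≫ W.str.δMap f = W.fact.L (W.fact.left.obj f) :=
  (W.str.δ.app f).w.symm.trans ((congrArg (· ≫ _) (W.δ_app_left f)).trans (Category.id_comp _))

theorem δMap_R (W : AWFS C) (f : Arrow C) :
    W.str.δMap f ≫ W.fact.R (W.fact.left.obj f) = 𝟙 _ :=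
  congrArg Arrow.Hom.right (W.str.left_counit f)

theorem μMap_naturality (W : AWFS C) {f g : Arrow C} (φ : f ⟶ g) :
    W.fact.M.map (W.fact.right.map φ) ≫ W.str.μMap g = W.str.μMap f ≫ W.fact.M.map φ :=
  congrArg Arrow.Hom.left (W.str.μ.naturality φ)

theorem δMap_naturality (W : AWFS C) {f g : Arrow C} (φ : f ⟶ g) :
    W.fact.M.map φ ≫ W.str.δMap g = W.str.δMap f ≫ W.fact.M.map (W.fact.left.map φ) :=
  congrArg Arrow.Hom.right (W.str.δ.naturality φ)

theorem μMap_δMap (W : AWFS C) (f : Arrow C) : W.str.μMap f ≫ W.str.δMap f =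
    W.str.δMap (W.fact.right.obj f) ≫ W.fact.M.map (W.str.distrib f) ≫
      W.str.μMap (W.fact.left.obj f) :=
  congrArg Arrow.Hom.right (W.str.distrib_comul f)

/-- The comultiplication of an awfs as a square `(δ_f, 1) : Rf ⟶ Rf ∘ RLf`. -/
def comulHom (W : AWFS C) (f : Arrow C) :
    W.fact.right.obj f ⟶ Arrow.mk (W.fact.R (W.fact.left.obj f) ≫ W.fact.R f) :=
  Arrow.homMk (W.str.δMap f) (𝟙 _) ((Category.assoc _ _ _).symm.trans
    ((congrArg (· ≫ W.fact.R f) (W.δMap_R f)).trans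
      ((Category.id_comp _).trans (Category.comp_id _).symm)))

theorem comulHom_compSnd (W : AWFS C) (f : Arrow C) :
    W.comulHom f ≫ Lifting.compSnd _ _ = 𝟙 _ :=
  Arrow.hom_ext _ _ (W.δMap_R f) (Category.comp_id _)

variable {ι : Type t} {j : ι → Arrow C} {W : AWFS C}

/-- Coalgebra structures for the comonad of `W` on the members of the family `j`. -/
structure CoalgebraFamily (W : AWFS C) (j : ι → Arrow C) where
  a : ∀ k, j k ⟶ W.fact.left.obj (j k)
  counit : ∀ k, a k ≫ W.fact.counit.app (j k) = 𝟙 (j k)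
  coassoc : ∀ k, a k ≫ W.str.δ.app (j k) = a k ≫ W.fact.left.map (a k)

namespace CoalgebraFamily

variable (c : CoalgebraFamily W j)

theorem a_left (k : ι) : (c.a k).left = 𝟙 _ :=
  (Category.comp_id _).symm.trans (congrArg Arrow.Hom.left (c.counit k))

theorem hom_a_right (k : ι) : (j k).hom ≫ (c.a k).right = W.fact.L (j k) :=
  (c.a k).w.symm.trans ((congrArg (· ≫ _) (c.a_left k)).trans (Category.id_comp _))

theorem a_right_R (k : ι) : (c.a k).right ≫ W.fact.R (j k) = 𝟙 _ :=
  congrArg Arrow.Hom.right (c.counit k)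

theorem a_right_δMap (k : ι) :
    (c.a k).right ≫ W.str.δMap (j k) = (c.a k).right ≫ W.fact.M.map (c.a k) :=
  congrArg Arrow.Hom.right (c.coassoc k)

/-- The functor from the discrete category on the family to the left maps. -/
def functor : Discrete ι ⥤ W.LMap :=
  Discrete.functor fun k =>
    { A := j k
      a := c.a k
      counit := c.counit k
      coassoc := c.coassoc k }

/-- The canonical lifting operation of a right map of the form `Rf` against left maps. -/
def lifting (f : Arrow C) : Lifting j (W.fact.right.obj f) where
  fill k s := (c.a k).right ≫ W.fact.M.map s ≫ W.str.μMap f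
  hom_fill k s := by
    rw [← Category.assoc, hom_a_right, W.fact.L_map_comp]
    exact (congrArg (s.left ≫ ·) (congrArg Arrow.Hom.left (W.str.left_unit f))).trans
      (Category.comp_id _)
  fill_hom k s := by
    have h : W.fact.M.map s ≫ W.str.μMap f ≫ W.fact.R f = W.fact.R (j k) ≫ s.right := by
      rw [μMap_R, W.fact.R_naturality]
    simp only [Category.assoc, Arrow.mk_hom, h]
    rw [← Category.assoc, a_right_R]
    exact Category.id_comp _

theorem fill_unit (k : ι) : (c.lifting (j k)).fill k (W.fact.unit.app (j k)) = (c.a k).right :=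
  (congrArg ((c.a k).right ≫ ·) (congrArg Arrow.Hom.left (W.str.right_unit (j k)))).trans
    (Category.comp_id _)

theorem isHom_map {f g : Arrow C} (φ : f ⟶ g) :
    (c.lifting f).IsHom (c.lifting g) (W.fact.right.map φ) := fun k s => by
  change ((c.a k).right ≫ W.fact.M.map s ≫ W.str.μMap f) ≫ W.fact.M.map φ =
    (c.a k).right ≫ W.fact.M.map (s ≫ W.fact.right.map φ) ≫ W.str.μMap g
  rw [W.fact.M.map_comp]
  simp only [Category.assoc]
  exact congrArg (fun m => (c.a k).right ≫ W.fact.M.map s ≫ m) (W.μMap_naturality φ).symm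

theorem isHom_μ (f : Arrow C) :
    (c.lifting (W.fact.right.obj f)).IsHom (c.lifting f) (W.str.μ.app f) := fun k s => by
  have h := congrArg Arrow.Hom.left (W.str.assoc f)
  change ((c.a k).right ≫ W.fact.M.map s ≫ W.str.μMap (W.fact.right.obj f)) ≫ W.str.μMap f =
    (c.a k).right ≫ W.fact.M.map (s ≫ W.str.μ.app f) ≫ W.str.μMap f
  rw [W.fact.M.map_comp]
  simp only [Category.assoc]
  exact congrArg (fun m => (c.a k).right ≫ W.fact.M.map s ≫ m) h.symm

theorem isHom_comulHom (f : Arrow C) : (c.lifting f).IsHom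
    (Lifting.comp (c.lifting (W.fact.left.obj f)) (c.lifting f)) (W.comulHom f) := fun k s => by
  have h : c.a k ≫ W.fact.left.map s ≫ W.str.distrib f =
      (c.lifting f).upperSquare (s ≫ W.comulHom f) := by
    ext
    · change (c.a k).left ≫ s.left ≫ W.str.δMap f = s.left ≫ W.str.δMap f
      rw [a_left]
      exact Category.id_comp _
    · change (c.lifting f).fill k s = (c.lifting f).fill k _
      rw [Category.assoc, comulHom_compSnd, Category.comp_id]
  calc ((c.a k).right ≫ W.fact.M.map s ≫ W.str.μMap f) ≫ W.str.δMap f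
    _ = (c.a k).right ≫ (W.fact.M.map s ≫ W.str.δMap (W.fact.right.obj f)) ≫
          W.fact.M.map (W.str.distrib f) ≫ W.str.μMap (W.fact.left.obj f) := by
      simp only [Category.assoc, μMap_δMap]
    _ = ((c.a k).right ≫ W.str.δMap (j k)) ≫ W.fact.M.map (W.fact.left.map s) ≫
          W.fact.M.map (W.str.distrib f) ≫ W.str.μMap (W.fact.left.obj f) := by
      rw [δMap_naturality]
      simp only [Category.assoc]
    _ = (c.a k).right ≫ W.fact.M.map (c.a k ≫ W.fact.left.map s ≫ W.str.distrib f) ≫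
          W.str.μMap (W.fact.left.obj f) := by
      rw [a_right_δMap]
      simp only [Category.assoc, W.fact.M.map_comp]
    _ = _ := by rw [h]; rfl

/-- A morphism of awfs that preserves coalgebra structures on `j` preserves the induced lifting
operations. -/
theorem isHom_rightTrans {W' : AWFS C} {d : CoalgebraFamily W' j} (χ : W ⟶ W')
    (h : ∀ k, (c.a k).right ≫ (Hom.toHom χ).χ.app (j k) = (d.a k).right) (f : Arrow C) :
    (c.lifting f).IsHom (d.lifting f) ((Hom.toHom χ).rightTrans.app f) := fun k s => by
  have hμ : W.str.μMap f ≫ (Hom.toHom χ).χ.app f =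
      (W.fact.M.map ((Hom.toHom χ).rightTrans.app f) ≫
        (Hom.toHom χ).χ.app (W'.fact.right.obj f)) ≫ W'.str.μMap f :=
    congrArg Arrow.Hom.left (AWFS.Hom.mul χ f)
  have hn := (Hom.toHom χ).χ.naturality (s ≫ (Hom.toHom χ).rightTrans.app f)
  calc ((c.a k).right ≫ W.fact.M.map s ≫ W.str.μMap f) ≫ (Hom.toHom χ).χ.app f
    _ = (c.a k).right ≫ (W.fact.M.map (s ≫ (Hom.toHom χ).rightTrans.app f) ≫
          (Hom.toHom χ).χ.app (W'.fact.right.obj f)) ≫ W'.str.μMap f := by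
      simp only [Category.assoc, hμ, W.fact.M.map_comp]
    _ = ((c.a k).right ≫ (Hom.toHom χ).χ.app (j k)) ≫
          W'.fact.M.map (s ≫ (Hom.toHom χ).rightTrans.app f) ≫ W'.str.μMap f := by
      rw [hn]
      simp only [Category.assoc]
    _ = _ := by rw [h]; rfl

end CoalgebraFamily

theorem discrete_functor_ext {D : Type*} [Category D] {F G : Discrete ι ⥤ D}
    (h : ∀ k, F.obj ⟨k⟩ = G.obj ⟨k⟩) : F = G := by
  refine CategoryTheory.Functor.ext (fun X => h X.as) fun ⟨X⟩ ⟨Y⟩ f => ?_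
  obtain rfl : X = Y := Discrete.eq_of_hom f
  obtain rfl : f = 𝟙 _ := Subsingleton.elim _ _
  simp

theorem LMap_mk_inj {A : Arrow C} {a b : A ⟶ W.str.comonad.toFunctor.obj A} {h₁ h₂ h₃ h₄}
    (h : (⟨A, a, h₁, h₂⟩ : W.LMap) = ⟨A, b, h₃, h₄⟩) : a = b := by
  injection h

theorem exists_coalgebra_eq (X : W.LMap) {A : Arrow C} (h : X.A = A) :
    ∃ a h₁ h₂, X = (⟨A, a, h₁, h₂⟩ : W.LMap) := by
  subst h
  exact ⟨X.a, X.counit, X.coassoc, rfl⟩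

theorem exists_eq_coalgebraFamily_functor (F : Discrete ι ⥤ W.LMap)
    (hF : F ⋙ W.str.comonad.forget = Discrete.functor j) :
    ∃ c : CoalgebraFamily W j, F = c.functor := by
  have h : ∀ k, ∃ a h₁ h₂, F.obj ⟨k⟩ = (⟨j k, a, h₁, h₂⟩ : W.LMap) := fun k =>
    exists_coalgebra_eq _ (Functor.congr_obj hF ⟨k⟩)
  choose a h₁ h₂ h using h
  exact ⟨⟨a, h₁, h₂⟩, discrete_functor_ext h⟩

theorem functor_comp_mapLMap_eq_iff {W' : AWFS C} (χ : W ⟶ W') (c : CoalgebraFamily W j)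
    (d : CoalgebraFamily W' j) : c.functor ⋙ mapLMap χ = d.functor ↔
      ∀ k, (c.a k).right ≫ (Hom.toHom χ).χ.app (j k) = (d.a k).right := by
  have e : ∀ k, c.a k ≫ (Hom.comonadHom χ).app (j k) = d.a k ↔
      (c.a k).right ≫ (Hom.toHom χ).χ.app (j k) = (d.a k).right := fun k =>
    ⟨fun h => congrArg Arrow.Hom.right h, fun h => Arrow.hom_ext _ _
      (((Category.comp_id _).trans (c.a_left k)).trans (d.a_left k).symm) h⟩
  refine ⟨fun h k => (e k).mp (LMap_mk_inj (Functor.congr_obj h ⟨k⟩)), fun h => ?_⟩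
  refine discrete_functor_ext fun k => ?_
  change (⟨j k, c.a k ≫ (Hom.comonadHom χ).app (j k), _, _⟩ : W'.LMap) = ⟨j k, d.a k, _, _⟩
  have := (e k).mpr (h k)
  congr 1

end AWFS

namespace FreeLifting

variable {C : Type u} [Category.{v} C] {ι : Type t} {j : ι → Arrow C}
  {F : FunctorialFactorization C} (Ψ : FreeLifting j F)

/-- The universal left-map structure on a member of the family: the filler of its unit square. -/
def generator (k : ι) : (j k).right ⟶ F.M.obj (j k) := (Ψ.lifting (j k)).fill k (F.unit.app (j k))

theorem hom_generator (k : ι) : (j k).hom ≫ Ψ.generator k = F.L (j k) :=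
  (Ψ.lifting (j k)).hom_fill k (F.unit.app (j k))

theorem generator_map {f : Arrow C} (k : ι) (φ : j k ⟶ f) :
    Ψ.generator k ≫ F.M.map φ = (Ψ.lifting f).fill k (φ ≫ F.unit.app f) :=
  (Ψ.isHom_map φ k _).trans (congrArg ((Ψ.lifting f).fill k) (F.unit.naturality φ).symm)

/-- The coalgebra structures on the generating maps. -/
def generatorFamily : Ψ.awfs.CoalgebraFamily j where
  a k := Arrow.homMk (𝟙 _) (Ψ.generator k) ((Category.id_comp _).trans (Ψ.hom_generator k).symm)
  counit k := by
    ext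
    · exact Category.id_comp _
    · exact (Ψ.lifting (j k)).fill_hom k (F.unit.app (j k))
  coassoc k := by
    ext
    · rfl
    · refine (Ψ.isHom_comulHom (j k) k _).trans (Eq.trans ?_ (Ψ.generator_map k _).symm)
      refine congrArg ((Ψ.lifting (F.left.obj (j k))).fill k) (Arrow.hom_ext _ _ ?_ ?_)
      · exact (Ψ.L_comul (j k)).trans (Category.id_comp _).symm
      · refine Eq.trans (congrArg ((Ψ.lifting (j k)).fill k) ?_) (Category.comp_id _).symm
        rw [Category.assoc, comulHom_compSnd, Category.comp_id]

theorem generatorFamily_lifting (f : Arrow C) : Ψ.generatorFamily.lifting f = Ψ.lifting f := by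
  ext k s
  refine (Category.assoc _ _ _).symm.trans ((congrArg (· ≫ (Ψ.mul f).left)
    (Ψ.generator_map k s)).trans ((Ψ.isHom_mul f k _).trans ?_))
  refine congrArg ((Ψ.lifting f).fill k) ((Category.assoc _ _ _).trans ?_)
  exact (congrArg (s ≫ ·) (Ψ.unit_mul f)).trans (Category.comp_id s)

section Comparison

variable {W : AWFS C} (c : W.CoalgebraFamily j)

/-- The comparison map of right parts, the extension of the unit of `W`. -/
def compare (f : Arrow C) : F.right.obj f ⟶ W.fact.right.obj f :=
  Ψ.desc (c.lifting f) (W.fact.unit.app f)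

theorem isHom_compare (f : Arrow C) : (Ψ.lifting f).IsHom (c.lifting f) (Ψ.compare c f) :=
  Ψ.isHom_desc _ _

theorem L_compare (f : Arrow C) : F.L f ≫ (Ψ.compare c f).left = W.fact.L f := Ψ.L_desc _ _

theorem compare_right (f : Arrow C) : (Ψ.compare c f).right = 𝟙 _ := Ψ.desc_right _ _

theorem compare_naturality {f g : Arrow C} (φ : f ⟶ g) :
    F.right.map φ ≫ Ψ.compare c g = Ψ.compare c f ≫ W.fact.right.map φ := by
  refine Ψ.hom_ext ((Ψ.isHom_map φ).comp (Ψ.isHom_compare c g))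
    ((Ψ.isHom_compare c f).comp (c.isHom_map φ)) ?_ ?_
  · refine (F.L_map_comp φ _).trans ((congrArg (φ.left ≫ ·) (Ψ.L_compare c g)).trans ?_)
    rw [Arrow.comp_left, ← Category.assoc, L_compare]
    exact W.fact.L_naturality φ
  · rw [Arrow.comp_right, Arrow.comp_right, compare_right, compare_right]
    exact (Category.comp_id _).trans (Category.id_comp _).symm

/-- The comparison as a morphism of functorial factorisations. -/
def compareHom : FunctorialFactorization.Hom F W.fact where
  χ :=
    { app := fun f => (Ψ.compare c f).left
      naturality := fun _ _ φ => congrArg Arrow.Hom.left (Ψ.compare_naturality c φ) }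
  left_comp := Ψ.L_compare c
  comp_right f := (Ψ.compare c f).w.trans
    ((congrArg (F.R f ≫ ·) (Ψ.compare_right c f)).trans (Category.comp_id _))

theorem compareHom_rightTrans (f : Arrow C) :
    (Ψ.compareHom c).rightTrans.app f = Ψ.compare c f :=
  Arrow.hom_ext _ _ rfl (Ψ.compare_right c f).symm

theorem mul_compare (f : Arrow C) : Ψ.mul f ≫ Ψ.compare c f =
    (F.right.map (Ψ.compare c f) ≫ Ψ.compare c (W.fact.right.obj f)) ≫ W.str.μ.app f := by
  refine Ψ.hom_ext ((Ψ.isHom_mul f).comp (Ψ.isHom_compare c f))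
    (((Ψ.isHom_map _).comp (Ψ.isHom_compare c _)).comp (c.isHom_μ f)) ?_ ?_
  · calc F.L (F.right.obj f) ≫ (Ψ.mul f).left ≫ (Ψ.compare c f).left
      _ = (Ψ.compare c f).left := Ψ.L_mul_comp f _
      _ = (Ψ.compare c f).left ≫ W.fact.L (W.fact.right.obj f) ≫ W.str.μMap f :=
        ((congrArg (_ ≫ ·) (congrArg Arrow.Hom.left (W.str.left_unit f))).trans
          (Category.comp_id _)).symm
      _ = F.L (F.right.obj f) ≫ (F.M.map (Ψ.compare c f) ≫
          (Ψ.compare c (W.fact.right.obj f)).left) ≫ W.str.μMap f := by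
        rw [← Ψ.L_compare c (W.fact.right.obj f), Category.assoc, Category.assoc]
        exact (F.L_map_comp (Ψ.compare c f) _).symm
  · calc (Ψ.mul f).right ≫ (Ψ.compare c f).right
      _ = (Ψ.compare c f).right ≫ 𝟙 _ ≫ 𝟙 _ := by
        rw [mul_right, compare_right]
        simp
      _ = ((Ψ.compare c f).right ≫ (Ψ.compare c (W.fact.right.obj f)).right) ≫
          (W.str.μ.app f).right := by
        rw [compare_right, compare_right, W.μ_app_right]
        simp

theorem compare_comulHom (f : Arrow C) : (Ψ.compare c f).left ≫ W.str.δMap f =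
    Ψ.comul f ≫ (Ψ.compare c (F.left.obj f)).left ≫
      W.fact.M.map ((Ψ.compareHom c).leftTrans.app f) := by
  have hr : (Ψ.compare c (F.left.obj f) ≫
      W.fact.right.map ((Ψ.compareHom c).leftTrans.app f)).right = (Ψ.compare c f).left :=
    (congrArg (· ≫ (Ψ.compare c f).left) (Ψ.compare_right c _)).trans (Category.id_comp _)
  have h : Ψ.compare c f ≫ W.comulHom f = Ψ.comulHom f ≫ Lifting.paste
      (Ψ.compare c (F.left.obj f) ≫ W.fact.right.map ((Ψ.compareHom c).leftTrans.app f))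
      (Ψ.compare c f) hr := by
    refine Ψ.hom_ext ((Ψ.isHom_compare c f).comp (c.isHom_comulHom f)) ((Ψ.isHom_comulHom f).comp
      (((Ψ.isHom_compare c _).comp (c.isHom_map _)).paste (Ψ.isHom_compare c f) hr)) ?_ ?_
    · calc F.L f ≫ (Ψ.compare c f).left ≫ W.str.δMap f
        _ = W.fact.L (W.fact.left.obj f) := by
          rw [← Category.assoc, L_compare, W.L_δMap]
        _ = W.fact.L (F.left.obj f) ≫ W.fact.M.map ((Ψ.compareHom c).leftTrans.app f) :=
          (Category.id_comp _).symm.trans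
            (W.fact.L_naturality ((Ψ.compareHom c).leftTrans.app f))
        _ = F.L (F.left.obj f) ≫ (Ψ.compare c (F.left.obj f)).left ≫
            W.fact.M.map ((Ψ.compareHom c).leftTrans.app f) := by
          rw [← Category.assoc, L_compare]
        _ = _ := (Ψ.L_comul_comp f _).symm
    · rw [Arrow.comp_right, Arrow.comp_right, comulHom_right, compare_right]
      exact (Category.comp_id _).trans ((Category.id_comp _).trans (Ψ.compare_right c f)).symm
  exact congrArg Arrow.Hom.left h

/-- The comparison as a morphism of awfs. -/
def compareAWFS : Ψ.awfs ⟶ W where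
  toHom := Ψ.compareHom c
  comul f := by
    ext
    · refine (Category.id_comp _).trans ((W.δ_app_left f).trans ?_)
      exact ((Category.id_comp _).trans (Category.id_comp _)).symm
    · exact Ψ.compare_comulHom c f
  mul f := by
    simp only [compareHom_rightTrans]
    exact Ψ.mul_compare c f

theorem generator_compare (k : ι) : Ψ.generator k ≫ (Ψ.compare c (j k)).left = (c.a k).right := by
  refine (Ψ.isHom_compare c (j k) k _).trans (Eq.trans ?_ (c.fill_unit k))
  refine congrArg ((c.lifting (j k)).fill k) (Arrow.hom_ext _ _ (Ψ.L_compare c (j k)) ?_)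
  exact (Category.id_comp _).trans (Ψ.compare_right c (j k))

theorem eq_compareAWFS (χ : Ψ.awfs ⟶ W)
    (h : ∀ k, Ψ.generator k ≫ (AWFS.Hom.toHom χ).χ.app (j k) = (c.a k).right) :
    χ = Ψ.compareAWFS c := by
  refine AWFS.Hom.ext (NatTrans.ext (funext fun f => congrArg Arrow.Hom.left
    (?_ : (AWFS.Hom.toHom χ).rightTrans.app f = Ψ.compare c f)))
  have hχ := Ψ.generatorFamily.isHom_rightTrans χ h f
  rw [generatorFamily_lifting] at hχ
  refine Ψ.hom_ext hχ (Ψ.isHom_compare c f) ?_ (Ψ.compare_right c f).symm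
  exact ((AWFS.Hom.toHom χ).left_comp f).trans (Ψ.L_compare c f).symm

end Comparison

theorem isFreeVia : Ψ.awfs.IsFreeVia (Discrete.functor j) Ψ.generatorFamily.functor := by
  refine ⟨AWFS.discrete_functor_ext fun _ => rfl, fun W G hG => ?_⟩
  obtain ⟨c, rfl⟩ := AWFS.exists_eq_coalgebraFamily_functor G hG
  simp only [AWFS.functor_comp_mapLMap_eq_iff]
  exact ⟨Ψ.compareAWFS c, Ψ.generator_compare c, Ψ.eq_compareAWFS c⟩

theorem nonempty_awfs_iso {F' : FunctorialFactorization C} (Ψ' : FreeLifting j F') :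
    Nonempty (Ψ.awfs ≅ Ψ'.awfs) := by
  have key : ∀ {F F' : FunctorialFactorization C} (Ψ : FreeLifting j F) (Ψ' : FreeLifting j F'),
      Ψ.compareAWFS Ψ'.generatorFamily ≫ Ψ'.compareAWFS Ψ.generatorFamily = 𝟙 Ψ.awfs := by
    intro F F' Ψ Ψ'
    refine (Ψ.eq_compareAWFS Ψ.generatorFamily _ fun k => ?_).trans
      (Ψ.eq_compareAWFS Ψ.generatorFamily (𝟙 Ψ.awfs) fun k => Category.comp_id _).symm
    refine (Category.assoc _ _ _).symm.trans ?_
    exact (congrArg (· ≫ (Ψ'.compare Ψ.generatorFamily (j k)).left)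
      (Ψ.generator_compare Ψ'.generatorFamily k)).trans
        (Ψ'.generator_compare Ψ.generatorFamily k)
  exact ⟨⟨_, _, key Ψ Ψ', key Ψ' Ψ⟩⟩

end FreeLifting

/-! ### The topology of cell complexes -/

instance compactSpace_diskBoundary (k : ℕ) : CompactSpace (diskBoundary.{u} k) := by
  unfold diskBoundary
  exact inferInstanceAs
    (CompactSpace (ULift.{u} (Metric.sphere (0 : EuclideanSpace ℝ (Fin k)) 1)))

instance t2Space_disk (k : ℕ) : T2Space (disk.{u} k) := by
  unfold disk
  exact inferInstanceAs
    (T2Space (ULift.{u} (Metric.closedBall (0 : EuclideanSpace ℝ (Fin k)) 1)))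

theorem isClosedEmbedding_diskBoundaryInclusion (k : ℕ) :
    Topology.IsClosedEmbedding (diskBoundaryInclusion.{u} k) :=
  (diskBoundaryInclusion.{u} k).hom.continuous.isClosedEmbedding
    ((TopCat.mono_iff_injective _).mp inferInstance)

theorem exists_factor_of_range_subset {X Y Z : TopCat.{u}} {i : X ⟶ Y}
    (hi : Topology.IsInducing i) (f : Z ⟶ Y) (h : Set.range f ⊆ Set.range i) :
    ∃ g : Z ⟶ X, g ≫ i = f := by
  choose g hg using fun z => h ⟨z, rfl⟩
  have hcomp : (i ∘ g : Z → Y) = f := funext hg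
  exact ⟨TopCat.ofHom ⟨g, hi.continuous_iff.mpr (hcomp ▸ f.hom.continuous)⟩, by
    ext z; exact hg z⟩

namespace Stratum

variable (P : Stratum.{u})

theorem incl_attach_apply (k : ℕ) (s : P.cells k) (x : diskBoundary.{u} k) :
    P.incl (P.attach k s x) = P.char k s (diskBoundaryInclusion.{u} k x) :=
  congrArg (fun m : diskBoundary.{u} k ⟶ P.body => m x) (P.attach_incl k s)

theorem exists_incl_or_char (y : P.body) :
    (∃ x, P.incl x = y) ∨ ∃ (k : ℕ) (s : P.cells k) (d : disk.{u} k), P.char k s d = y := by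
  obtain ⟨_ | _ | _, x, rfl⟩ := Concrete.colimit_exists_rep _ y
  · let attaching := Sigma.desc fun s : (Σ k, P.cells k) => P.attach s.1 s.2
    have h : attaching ≫ P.incl = colimit.ι (span attaching _) WalkingSpan.zero :=
      colimit.w (span _ _) WalkingSpan.Hom.fst
    exact Or.inl ⟨attaching x, congrArg (fun m : _ ⟶ P.body => m x) h⟩
  · exact Or.inl ⟨x, rfl⟩
  · obtain ⟨⟨s⟩, d, rfl⟩ := Concrete.colimit_exists_rep _ x
    exact Or.inr ⟨s.1, s.2, d, rfl⟩

theorem isClosed_body {V : Set P.body} (h₀ : IsClosed (P.incl ⁻¹' V))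
    (h₁ : ∀ k s, IsClosed (P.char k s ⁻¹' V)) : IsClosed V := by
  have h_cells : IsClosed (P.allChar ⁻¹' V) :=
    (TopCat.isClosed_iff_of_isColimit _ (colimit.isColimit _) _).mpr fun s => h₁ s.as.1 s.as.2
  refine (TopCat.isClosed_iff_of_isColimit _ (colimit.isColimit _) _).mpr ?_
  rintro (_ | _ | _)
  · let attaching := Sigma.desc fun s : (Σ k, P.cells k) => P.attach s.1 s.2
    have h : attaching ≫ P.incl = colimit.ι (span attaching _) WalkingSpan.zero :=
      colimit.w (span _ _) WalkingSpan.Hom.fst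
    change IsClosed (colimit.ι (span attaching _) WalkingSpan.zero ⁻¹' V)
    rw [← h]
    exact h₀.preimage attaching.hom.continuous
  · exact h₀
  · exact h_cells

open Classical in
/-- The place of a point of the body: a point of the base, or else a cell and a point of its open
disc. The indiscrete topology on the set of places makes the universal property of the body apply to
arbitrary functions. -/
noncomputable def position : P.body → P.X ⊕ Σ k, P.cells k × disk.{u} k :=
  P.desc (Z := TopCat.trivial.obj (P.X ⊕ Σ k, P.cells k × disk.{u} k))
    (@TopCat.ofHom _ _ _ ⊤ (@ContinuousMap.mk _ _ _ ⊤ Sum.inl continuous_top))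
    (fun k s => @TopCat.ofHom _ _ _ ⊤ (@ContinuousMap.mk _ _ _ ⊤ (fun d =>
      if h : ∃ b, diskBoundaryInclusion.{u} k b = d then Sum.inl (P.attach k s h.choose)
      else Sum.inr ⟨k, s, d⟩) continuous_top))
    (fun k s => by
      ext b
      have h : ∃ c, diskBoundaryInclusion.{u} k c = diskBoundaryInclusion.{u} k b := ⟨b, rfl⟩
      have hb : h.choose = b :=
        (isClosedEmbedding_diskBoundaryInclusion k).injective h.choose_spec
      exact ((dif_pos h).trans (congrArg (fun c => Sum.inl (P.attach k s c)) hb)).symm)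

theorem position_incl (x : P.X) : P.position (P.incl x) = Sum.inl x :=
  congrArg (fun m : P.X ⟶ TopCat.trivial.obj _ => m x) (P.incl_desc _ _ _)

theorem position_char_of_notMem {k : ℕ} (s : P.cells k) {d : disk.{u} k}
    (hd : d ∉ Set.range (diskBoundaryInclusion.{u} k)) :
    P.position (P.char k s d) = Sum.inr ⟨k, s, d⟩ :=
  (congrArg (fun m : disk.{u} k ⟶ TopCat.trivial.obj _ => m d) (P.char_desc _ _ _ k s)).trans
    (dif_neg hd)

theorem incl_injective : Function.Injective P.incl := fun x y h =>
  Sum.inl_injective <| by rw [← P.position_incl, h, P.position_incl]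

theorem exists_boundary_of_char_eq_incl {k : ℕ} {s : P.cells k} {d : disk.{u} k} {x : P.X}
    (h : P.char k s d = P.incl x) :
    ∃ b, diskBoundaryInclusion.{u} k b = d ∧ P.attach k s b = x := by
  by_cases hd : d ∈ Set.range (diskBoundaryInclusion.{u} k)
  · obtain ⟨b, rfl⟩ := hd
    exact ⟨b, rfl, P.incl_injective ((P.incl_attach_apply k s b).trans h)⟩
  · have := P.position_char_of_notMem s hd
    rw [h, position_incl] at this
    exact absurd this Sum.inl_ne_inr

theorem isClosedEmbedding_incl : Topology.IsClosedEmbedding P.incl := by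
  refine Topology.IsClosedEmbedding.of_continuous_injective_isClosedMap
    P.incl.hom.continuous P.incl_injective fun F hF => P.isClosed_body ?_ fun k s => ?_
  · rwa [Set.preimage_image_eq F P.incl_injective]
  · have e : P.char k s ⁻¹' (P.incl '' F) =
        diskBoundaryInclusion.{u} k '' (P.attach k s ⁻¹' F) := by
      ext d
      constructor
      · rintro ⟨x, hx, h⟩
        obtain ⟨b, rfl, rfl⟩ := P.exists_boundary_of_char_eq_incl h.symm
        exact ⟨b, hx, rfl⟩
      · rintro ⟨b, hb, rfl⟩
        exact ⟨_, hb, P.incl_attach_apply k s b⟩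
    rw [e]
    exact (isClosedEmbedding_diskBoundaryInclusion k).isClosedMap _
      (hF.preimage (P.attach k s).hom.continuous)

theorem isClosed_singleton_of_notMem_range {y : P.body} (hy : y ∉ Set.range P.incl) :
    IsClosed {y} := by
  refine P.isClosed_body ?_ fun k s => Set.Subsingleton.isClosed fun d hd d' hd' => ?_
  · rw [Set.preimage_singleton_eq_empty.mpr hy]
    exact isClosed_empty
  · have position_y : ∀ d, P.char k s d = y → P.position y = Sum.inr ⟨k, s, d⟩ := by
      rintro d rfl
      refine P.position_char_of_notMem s ?_
      rintro ⟨b, rfl⟩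
      exact hy ⟨_, P.incl_attach_apply k s b⟩
    simpa using (position_y d hd).symm.trans (position_y d' hd')

end Stratum

namespace CellCx

variable (A : CellCx.{u})

theorem isClosedEmbedding_step (n : ℕ) : Topology.IsClosedEmbedding (A.step n) :=
  (TopCat.homeoOfIso (A.link n)).isClosedEmbedding.comp (A.stratum n).isClosedEmbedding_incl

/-- The map `X_m ⟶ X_n` between two stages of a cell complex. -/
noncomputable def stepMap {m n : ℕ} (h : m ≤ n) : (A.stratum m).X ⟶ (A.stratum n).X :=
  A.sequence.map (homOfLE h)

theorem stepMap_self (n : ℕ) : A.stepMap (le_refl n) = 𝟙 _ := A.sequence.map_id n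

theorem stepMap_succ {m n : ℕ} (h : m ≤ n) :
    A.stepMap (Nat.le_succ_of_le h) = A.stepMap h ≫ A.step n :=
  (A.sequence.map_comp (homOfLE h) (homOfLE (Nat.le_add_right n 1))).trans
    (congrArg (A.stepMap h ≫ ·)
      (Functor.ofSequence_map_homOfLE_succ (X := fun n => (A.stratum n).X) A.step n))

theorem isClosedEmbedding_stepMap {m n : ℕ} (h : m ≤ n) :
    Topology.IsClosedEmbedding (A.stepMap h) := by
  induction n, h using Nat.le_induction with
  | base =>
    rw [stepMap_self]
    exact Topology.IsClosedEmbedding.id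
  | succ n h ih =>
    rw [stepMap_succ A h]
    exact (A.isClosedEmbedding_step n).comp ih

theorem stepMap_toBody {m n : ℕ} (h : m ≤ n) : A.stepMap h ≫ A.toBody n = A.toBody m :=
  colimit.w A.sequence (homOfLE h)

theorem toBody_stepMap_apply {m n : ℕ} (h : m ≤ n) (x : (A.stratum m).X) :
    A.toBody n (A.stepMap h x) = A.toBody m x :=
  congrArg (fun t : (A.stratum m).X ⟶ A.body => t x) (A.stepMap_toBody h)

theorem toBody_injective (n : ℕ) : Function.Injective (A.toBody n) := by
  intro x y h
  obtain ⟨m, f, g, e⟩ := Concrete.colimit_exists_of_rep_eq A.sequence x y h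
  obtain rfl : f = g := Subsingleton.elim _ _
  exact (A.isClosedEmbedding_stepMap (leOfHom f)).injective e

instance mono_toBody (n : ℕ) : Mono (A.toBody n) :=
  (TopCat.mono_iff_injective _).mpr (A.toBody_injective n)

theorem isClosed_body {V : Set A.body} (h : ∀ n, IsClosed (A.toBody n ⁻¹' V)) : IsClosed V :=
  (TopCat.isClosed_iff_of_isColimit _ (colimit.isColimit A.sequence) _).mpr h

theorem isClosedEmbedding_toBody (n : ℕ) : Topology.IsClosedEmbedding (A.toBody n) := by
  refine Topology.IsClosedEmbedding.of_continuous_injective_isClosedMap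
    (A.toBody n).hom.continuous (A.toBody_injective n) fun F hF => A.isClosed_body fun m => ?_
  rcases le_total m n with h | h
  · have e : A.toBody m ⁻¹' (A.toBody n '' F) = A.stepMap h ⁻¹' F := by
      ext x
      rw [Set.mem_preimage, ← A.toBody_stepMap_apply h,
        (A.toBody_injective n).mem_set_image, Set.mem_preimage]
    rw [e]
    exact hF.preimage (A.stepMap h).hom.continuous
  · have e : A.toBody m ⁻¹' (A.toBody n '' F) = A.stepMap h '' F := by
      rw [← Set.preimage_image_eq (A.stepMap h '' F) (A.toBody_injective m), Set.image_image]
      simp only [A.toBody_stepMap_apply h]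
    rw [e]
    exact (A.isClosedEmbedding_stepMap h).isClosedMap F hF

theorem exists_toBody (y : A.body) : ∃ n, y ∈ Set.range (A.toBody n) :=
  Concrete.colimit_exists_rep A.sequence y

theorem range_toBody_mono {m n : ℕ} (h : m ≤ n) :
    Set.range (A.toBody m) ⊆ Set.range (A.toBody n) := by
  rintro _ ⟨x, rfl⟩
  exact ⟨_, A.toBody_stepMap_apply h x⟩

theorem isClosed_singleton_toBody_of_notMem_range {n : ℕ} {x : (A.stratum (n + 1)).X}
    (hx : x ∉ Set.range (A.step n)) : IsClosed {A.toBody (n + 1) x} := by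
  obtain ⟨z, rfl⟩ := (TopCat.homeoOfIso (A.link n)).surjective x
  have hz : z ∉ Set.range (A.stratum n).incl := by
    rintro ⟨w, rfl⟩
    exact hx ⟨w, rfl⟩
  have h := (A.isClosedEmbedding_toBody (n + 1)).isClosedMap _
    ((TopCat.homeoOfIso (A.link n)).isClosedMap _
      ((A.stratum n).isClosed_singleton_of_notMem_range hz))
  rwa [Set.image_singleton, Set.image_singleton] at h

theorem isClosed_singleton_of_notMem_range {y : A.body} (hy : y ∉ Set.range (A.toBody 0)) :
    IsClosed {y} := by
  obtain ⟨n, hn⟩ := A.exists_toBody y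
  induction n with
  | zero => exact absurd hn hy
  | succ n ih =>
    obtain ⟨x, rfl⟩ := hn
    by_cases hx : x ∈ Set.range (A.step n)
    · obtain ⟨w, rfl⟩ := hx
      exact ih ⟨w, (congrArg (fun r : (A.stratum n).X ⟶ A.body => r w) (A.step_toBody n)).symm⟩
    · exact A.isClosed_singleton_toBody_of_notMem_range hx

theorem isClosed_of_finite_inter {T : Set A.body} (hT₀ : Disjoint T (Set.range (A.toBody 0)))
    (hT : ∀ n, (T ∩ Set.range (A.toBody n)).Finite) : IsClosed T := by
  refine A.isClosed_body fun n => ?_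
  have h : IsClosed (T ∩ Set.range (A.toBody n)) := by
    rw [← Set.biUnion_of_singleton (T ∩ Set.range (A.toBody n))]
    exact (hT n).isClosed_biUnion fun y hy =>
      A.isClosed_singleton_of_notMem_range (Set.disjoint_left.mp hT₀ hy.1)
  rw [← Set.preimage_inter_range]
  exact h.preimage (A.toBody n).hom.continuous

/-- Otherwise the set would contain a sequence leaving every stage; all subsets of that sequence are
closed, so it is compact and discrete, hence finite. -/
theorem exists_subset_range_toBody {S : Set A.body} (hS : IsCompact S) :
    ∃ n, S ⊆ Set.range (A.toBody n) := by
  by_contra! hne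
  choose z hzS hz using fun n => Set.not_subset.mp (hne n)
  have isClosed_of_subset : ∀ T ⊆ Set.range z, IsClosed T := by
    refine fun T hT => A.isClosed_of_finite_inter ?_ fun n =>
      ((Set.finite_lt_nat n).image z).subset ?_
    · refine Set.disjoint_left.mpr fun y hy h => ?_
      obtain ⟨m, rfl⟩ := hT hy
      exact hz m (A.range_toBody_mono (Nat.zero_le m) h)
    · rintro y ⟨hyT, hyn⟩
      obtain ⟨m, rfl⟩ := hT hyT
      exact ⟨m, not_le.mp fun hm => hz m (A.range_toBody_mono hm hyn), rfl⟩
  have hdiscrete : DiscreteTopology (Set.range z) := by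
    refine discreteTopology_iff_forall_isClosed.mpr fun T => ?_
    have := (isClosed_of_subset (Subtype.val '' T) (Subtype.coe_image_subset _ _)).preimage
      (continuous_subtype_val (p := (· ∈ Set.range z)))
    rwa [Set.preimage_image_eq T Subtype.val_injective] at this
  have hfinite : (Set.range z).Finite :=
    (hS.of_isClosed_subset (isClosed_of_subset _ subset_rfl)
      (Set.range_subset_iff.mpr hzS)).finite ⟨hdiscrete⟩
  choose N hN using A.exists_toBody
  obtain ⟨M, hM⟩ := (hfinite.image N).bddAbove
  exact hz M (A.range_toBody_mono (hM ⟨z M, ⟨M, rfl⟩, rfl⟩) (hN (z M)))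

theorem exists_toBody_factor {Z : TopCat.{u}} [CompactSpace Z] (f : Z ⟶ A.body) :
    ∃ (n : ℕ) (c : Z ⟶ (A.stratum n).X), c ≫ A.toBody n = f := by
  obtain ⟨n, hn⟩ := A.exists_subset_range_toBody (isCompact_range f.hom.continuous)
  exact ⟨n, exists_factor_of_range_subset (A.isClosedEmbedding_toBody n).isInducing f hn⟩

/-- A map into a stage is new if it does not factor through the previous stage; properness says that
the attaching maps of a cell complex are new. -/
def IsNew {Z : TopCat.{u}} : ∀ n : ℕ, (Z ⟶ (A.stratum n).X) → Prop
  | 0, _ => True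
  | n + 1, c => ¬ ∃ c' : Z ⟶ (A.stratum n).X, c' ≫ A.step n = c

theorem isNew_attach (n k : ℕ) (s : (A.stratum n).cells k) :
    A.IsNew n ((A.stratum n).attach k s) := by
  cases n with
  | zero => exact True.intro
  | succ n => exact A.proper n k s

theorem exists_isNew {Z : TopCat.{u}} [CompactSpace Z] (f : Z ⟶ A.body) :
    ∃ (n : ℕ) (c : Z ⟶ (A.stratum n).X), A.IsNew n c ∧ c ≫ A.toBody n = f := by
  obtain ⟨n, c, rfl⟩ := A.exists_toBody_factor f
  induction n with
  | zero => exact ⟨0, c, True.intro, rfl⟩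
  | succ n ih =>
    by_cases hc : ∃ c' : Z ⟶ (A.stratum n).X, c' ≫ A.step n = c
    · obtain ⟨c', rfl⟩ := hc
      rw [Category.assoc, step_toBody]
      exact ih c'
    · exact ⟨n + 1, c, hc, rfl⟩

theorem IsNew.le {Z : TopCat.{u}} {A : CellCx.{u}} {n m : ℕ} {c : Z ⟶ (A.stratum n).X}
    (hc : A.IsNew n c) (d : Z ⟶ (A.stratum m).X) (h : c ≫ A.toBody n = d ≫ A.toBody m) :
    n ≤ m := by
  by_contra! hlt
  obtain ⟨n, rfl⟩ := Nat.exists_eq_succ_of_ne_zero (Nat.ne_zero_of_lt hlt)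
  refine hc ⟨d ≫ A.stepMap (Nat.le_of_lt_succ hlt), ?_⟩
  rw [← cancel_mono (A.toBody (n + 1)), h, Category.assoc, step_toBody, Category.assoc,
    stepMap_toBody]

theorem IsNew.unique {Z : TopCat.{u}} {A : CellCx.{u}} {n m : ℕ} {c : Z ⟶ (A.stratum n).X}
    {d : Z ⟶ (A.stratum m).X} (hc : A.IsNew n c) (hd : A.IsNew m d)
    (h : c ≫ A.toBody n = d ≫ A.toBody m) :
    (⟨n, c⟩ : Σ n, Z ⟶ (A.stratum n).X) = ⟨m, d⟩ := by
  obtain rfl : n = m := le_antisymm (hc.le d h) (hd.le c h.symm)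
  rw [(cancel_mono _).mp h]

end CellCx

/-! ### The free lifting operation on free cell complexes -/

/-- The generating maps as a family indexed by the natural numbers. -/
noncomputable abbrev cellMap (k : ℕ) : Arrow TopCat.{u} := Arrow.mk (diskBoundaryInclusion.{u} k)

namespace CellCx

section Cells

variable {A B : CellCx.{u}}

/-- A cell of a stratum, as a cell of the cell complex. -/
def mkCell (A : CellCx.{u}) {n k : ℕ} (s : (A.stratum n).cells k) : A.Cell k := ⟨n, s⟩

theorem char_mkCell {n k : ℕ} (s : (A.stratum n).cells k) : A.char (A.mkCell s) =
    (A.stratum n).char k s ≫ (A.link n).hom ≫ A.toBody (n + 1) := rfl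

theorem hom_char_mkCell {n k : ℕ} (s : (A.stratum n).cells k) :
    diskBoundaryInclusion.{u} k ≫ A.char (A.mkCell s) =
      (A.stratum n).attach k s ≫ A.toBody n := by
  rw [char_mkCell, ← Category.assoc, ← Stratum.attach_incl, ← A.step_toBody n, step]
  simp only [Category.assoc]

theorem char_bodyMap (φ : A ⟶ B) {k : ℕ} (s : A.Cell k) :
    A.char s ≫ bodyMap φ = B.char (B.mkCell ((φ.strat s.1).cells k s.2)) := by
  rw [char, char_mkCell, Category.assoc, Category.assoc, toBody_bodyMap,
    ← Category.assoc (A.link s.1).hom, φ.coherent, Category.assoc, ← Category.assoc,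
    Stratum.char_bodyMap]

theorem body_hom_ext_cells {X : TopCat.{u}} {h h' : A.body ⟶ X} (h₀ : A.map ≫ h = A.map ≫ h')
    (h₁ : ∀ (k : ℕ) (s : A.Cell k), diskBoundaryInclusion.{u} k ≫ A.char s ≫ h =
      diskBoundaryInclusion.{u} k ≫ A.char s ≫ h' → A.char s ≫ h = A.char s ≫ h') : h = h' := by
  refine body_hom_ext fun n => ?_
  induction n with
  | zero => exact h₀
  | succ n ih =>
    rw [← cancel_epi (A.link n).hom]
    apply Stratum.body_hom_ext
    · rw [← A.step_toBody n, step] at ih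
      simpa only [Category.assoc] using ih
    · intro k s
      have e := h₁ k (A.mkCell s) (by
        rw [← Category.assoc, ← Category.assoc, hom_char_mkCell, Category.assoc, Category.assoc,
          ih])
      simpa only [char_mkCell, Category.assoc] using e

end Cells

/-- For `p : X ⟶ Y` and `q : A.body ⟶ Y`, a choice of a filler for every square from a generating
map to `p` whose lower edge is the image under `q` of a cell of `A`. Such a choice is what is needed
to lift `q` through `p` cell by cell. -/
structure CellFilling (A : CellCx.{u}) {X Y : TopCat.{u}} (p : X ⟶ Y) (q : A.body ⟶ Y) where
  fill : ∀ (k : ℕ) (s : A.Cell k) (x : diskBoundary.{u} k ⟶ X),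
    x ≫ p = diskBoundaryInclusion.{u} k ≫ A.char s ≫ q → (disk.{u} k ⟶ X)
  hom_fill : ∀ k s x w, diskBoundaryInclusion.{u} k ≫ fill k s x w = x
  fill_hom : ∀ k s x w, fill k s x w ≫ p = A.char s ≫ q

namespace CellFilling

variable {A : CellCx.{u}} {X Y : TopCat.{u}} {p : X ⟶ Y} {q : A.body ⟶ Y}
  (Φ : A.CellFilling p q) (a : A.base ⟶ X)

/-- `h` lifts `q` through `p`, extends `a`, and maps every cell to the chosen filler. -/
structure IsLift (h : A.body ⟶ X) : Prop where
  map_comp : A.map ≫ h = a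
  comp_right : h ≫ p = q
  char_comp : ∀ k s w, A.char s ≫ h = Φ.fill k s (diskBoundaryInclusion.{u} k ≫ A.char s ≫ h) w

variable {Φ a} in
theorem IsLift.unique {h h' : A.body ⟶ X} (H : Φ.IsLift a h) (H' : Φ.IsLift a h') : h = h' := by
  refine body_hom_ext_cells (H.map_comp.trans H'.map_comp.symm) fun k s hs => ?_
  have w : (diskBoundaryInclusion k ≫ A.char s ≫ h) ≫ p =
      diskBoundaryInclusion k ≫ A.char s ≫ q := by
    rw [Category.assoc, Category.assoc, H.comp_right]
  rw [H.char_comp k s w, H'.char_comp k s (hs ▸ w)]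
  congr 1

theorem attach_comp {n : ℕ} {h : (A.stratum n).X ⟶ X} (hq : h ≫ p = A.toBody n ≫ q) {k : ℕ}
    (s : (A.stratum n).cells k) : ((A.stratum n).attach k s ≫ h) ≫ p =
      diskBoundaryInclusion.{u} k ≫ A.char (A.mkCell s) ≫ q := by
  rw [← Category.assoc (diskBoundaryInclusion k), hom_char_mkCell, Category.assoc, hq,
    Category.assoc]

/-- The extension of a lift over the cells of the `n`-th stratum. -/
noncomputable def extend {n : ℕ} (h : (A.stratum n).X ⟶ X) (hq : h ≫ p = A.toBody n ≫ q) :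
    (A.stratum (n + 1)).X ⟶ X :=
  (A.link n).inv ≫ (A.stratum n).desc h
    (fun k s => Φ.fill k (A.mkCell s) ((A.stratum n).attach k s ≫ h) (attach_comp hq s))
    fun k s => (Φ.hom_fill k (A.mkCell s) _ (attach_comp hq s)).symm

section

variable {n : ℕ} (h : (A.stratum n).X ⟶ X) (hq : h ≫ p = A.toBody n ≫ q)

theorem step_extend : A.step n ≫ Φ.extend h hq = h := by
  rw [step, extend, Category.assoc, Iso.hom_inv_id_assoc, Stratum.incl_desc]

theorem char_extend {k : ℕ} (s : (A.stratum n).cells k) :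
    (A.stratum n).char k s ≫ (A.link n).hom ≫ Φ.extend h hq =
      Φ.fill k (A.mkCell s) ((A.stratum n).attach k s ≫ h) (attach_comp hq s) := by
  rw [extend, Iso.hom_inv_id_assoc, Stratum.char_desc]

theorem extend_comp : Φ.extend h hq ≫ p = A.toBody (n + 1) ≫ q := by
  rw [← cancel_epi (A.link n).hom]
  apply Stratum.body_hom_ext
  · have e := (congrArg (· ≫ p) (Φ.step_extend h hq)).trans hq
    rw [← A.step_toBody n, step] at e
    simpa only [Category.assoc] using e
  · intro k s
    have e := (congrArg (· ≫ p) (Φ.char_extend h hq s)).trans (Φ.fill_hom k _ _ _)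
    simpa only [char_mkCell, Category.assoc] using e

end

/-- The restriction of the lift to the base space of each stratum. -/
noncomputable def stage (w : a ≫ p = A.map ≫ q) :
    ∀ n, {h : (A.stratum n).X ⟶ X // h ≫ p = A.toBody n ≫ q}
  | 0 => ⟨a, w⟩
  | n + 1 => ⟨Φ.extend (stage w n).1 (stage w n).2, Φ.extend_comp _ _⟩

/-- The lift of `q` through `p` by recursion over the cells. -/
noncomputable def lift (w : a ≫ p = A.map ≫ q) : A.body ⟶ X :=
  A.desc (fun n => (Φ.stage a w n).1) fun n => Φ.step_extend (Φ.stage a w n).1 (Φ.stage a w n).2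

theorem toBody_lift (w : a ≫ p = A.map ≫ q) (n : ℕ) :
    A.toBody n ≫ Φ.lift a w = (Φ.stage a w n).1 := toBody_desc _ _ _ n

theorem isLift_lift (w : a ≫ p = A.map ≫ q) : Φ.IsLift a (Φ.lift a w) where
  map_comp := Φ.toBody_lift a w 0
  comp_right := body_hom_ext fun n => by
    rw [← Category.assoc, toBody_lift, (Φ.stage a w n).2]
  char_comp := by
    rintro k ⟨n, s⟩ w'
    have hs : diskBoundaryInclusion k ≫ A.char (A.mkCell s) ≫ Φ.lift a w =
        (A.stratum n).attach k s ≫ (Φ.stage a w n).1 := by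
      rw [← Category.assoc, hom_char_mkCell, Category.assoc, toBody_lift]
    calc A.char (A.mkCell s) ≫ Φ.lift a w
      _ = (A.stratum n).char k s ≫ (A.link n).hom ≫ (Φ.stage a w (n + 1)).1 := by
        rw [char_mkCell, Category.assoc, Category.assoc, toBody_lift]
      _ = Φ.fill k (A.mkCell s) ((A.stratum n).attach k s ≫ (Φ.stage a w n).1)
          (attach_comp (Φ.stage a w n).2 s) := Φ.char_extend _ (Φ.stage a w n).2 s
      _ = Φ.fill k (A.mkCell s) _ w' := by congr 1; exact hs.symm

end CellFilling

/-- The square from a generating map to `p : A.body ⟶ Y` given by a cell of `A`. -/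
noncomputable abbrev charSquare {A : CellCx.{u}} {Y : TopCat.{u}} (p : A.body ⟶ Y) {k : ℕ}
    (s : A.Cell k) : cellMap.{u} k ⟶ Arrow.mk p :=
  Arrow.homMk (diskBoundaryInclusion k ≫ A.char s) (A.char s ≫ p) (Category.assoc _ _ _)

section Free

variable {f : Arrow TopCat.{u}} {k : ℕ}

theorem free_step (f : Arrow TopCat.{u}) (n : ℕ) :
    (free f).step n = (freeStage f n).stratum.incl :=
  Category.comp_id _

theorem ok_of_isNew {n : ℕ} {c : diskBoundary.{u} k ⟶ ((free f).stratum n).X}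
    (hc : (free f).IsNew n c) : (freeStage f n).ok k c := by
  cases n with
  | zero => exact True.intro
  | succ n =>
    rintro ⟨c', h⟩
    exact hc ⟨c', (congrArg (c' ≫ ·) (free_step f n)).trans h⟩

/-- The square to a stage of the construction that indexes a cell of the free cell complex. -/
def indexSquare (s : (free f).Cell k) : cellMap.{u} k ⟶ Arrow.mk (freeStage f s.1).e :=
  (show (freeStage f s.1).stratum.cells k from s.2).1

theorem char_E (s : (free f).Cell k) : (free f).char s ≫ E f = (indexSquare s).right := by
  rw [char, Category.assoc, Category.assoc, toBody_E]
  exact (congrArg (_ ≫ ·) (Category.id_comp _)).trans ((freeStage f s.1).char_ext k s.2)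

theorem hom_char_free (s : (free f).Cell k) : diskBoundaryInclusion.{u} k ≫ (free f).char s =
    (indexSquare s).left ≫ (free f).toBody s.1 :=
  (free f).hom_char_mkCell s.2

theorem charSquare_E_injective (f : Arrow TopCat.{u}) (k : ℕ) :
    Function.Injective (charSquare (E f) (k := k)) := by
  intro s t h
  have h₁ : diskBoundaryInclusion k ≫ (free f).char s = diskBoundaryInclusion k ≫ (free f).char t :=
    congrArg Arrow.Hom.left h
  have h₂ : (free f).char s ≫ E f = (free f).char t ≫ E f := congrArg Arrow.Hom.right h
  rw [hom_char_free, hom_char_free] at h₁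
  rw [char_E, char_E] at h₂
  have e := IsNew.unique ((free f).isNew_attach s.1 k s.2) ((free f).isNew_attach t.1 k t.2) h₁
  obtain ⟨n, s, hs⟩ := s
  obtain ⟨m, t, ht⟩ := t
  obtain rfl : n = m := congrArg Sigma.fst e
  have e' : s.left = t.left := eq_of_heq (Sigma.mk.inj e).2
  obtain rfl : s = t := Arrow.hom_ext _ _ e' h₂
  rfl

theorem charSquare_E_surjective (f : Arrow TopCat.{u}) (k : ℕ) :
    Function.Surjective (charSquare (E f) (k := k)) := by
  intro s
  obtain ⟨n, c, hc, h⟩ := (free f).exists_isNew (Z := diskBoundary k) s.left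
  have w : c ≫ (freeStage f n).e = diskBoundaryInclusion.{u} k ≫ s.right := by
    rw [← toBody_E, ← Category.assoc, h]
    exact s.w
  let t : (free f).Cell k :=
    ⟨n, ⟨(Arrow.homMk c s.right w : cellMap k ⟶ Arrow.mk (freeStage f n).e), ok_of_isNew hc⟩⟩
  exact ⟨t, Arrow.hom_ext _ _ ((hom_char_free t).trans h) (char_E t)⟩

/-- The cells of the free cell complex on `f` are the squares to `Ef`. -/
noncomputable def cellEquiv (f : Arrow TopCat.{u}) (k : ℕ) :
    (free f).Cell k ≃ (cellMap.{u} k ⟶ Arrow.mk (E f)) :=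
  Equiv.ofBijective _ ⟨charSquare_E_injective f k, charSquare_E_surjective f k⟩

/-- The lifting operation on `Ef`: the filler of a square is the characteristic map of the cell
given by that square. -/
noncomputable def lifting (f : Arrow TopCat.{u}) : Lifting cellMap.{u} (Arrow.mk (E f)) where
  fill k s := (free f).char ((cellEquiv f k).symm s)
  hom_fill k s := congrArg Arrow.Hom.left ((cellEquiv f k).apply_symm_apply s)
  fill_hom k s := congrArg Arrow.Hom.right ((cellEquiv f k).apply_symm_apply s)

theorem fill_charSquare (s : (free f).Cell k) :
    (lifting f).fill k (charSquare (E f) s) = (free f).char s :=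
  congrArg (free f).char ((cellEquiv f k).symm_apply_apply s)

theorem isHom_lifting_iff {g : Arrow TopCat.{u}} {Γ : Lifting cellMap.{u} g}
    {ψ : Arrow.mk (E f) ⟶ g} : (lifting f).IsHom Γ ψ ↔
      ∀ k (s : (free f).Cell k), (free f).char s ≫ ψ.left = Γ.fill k (charSquare (E f) s ≫ ψ) := by
  refine ⟨fun h k s => ?_, fun h k s => ?_⟩
  · rw [← h, fill_charSquare]
  · obtain ⟨s, rfl⟩ := charSquare_E_surjective f k s
    rw [fill_charSquare, h]

/-- The fillers for the cells of `A` given by a lifting operation. -/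
noncomputable def cellFilling {A : CellCx.{u}} {g : Arrow TopCat.{u}} (Γ : Lifting cellMap.{u} g)
    (q : A.body ⟶ g.right) : A.CellFilling g.hom q where
  fill k s x w := Γ.fill k (Arrow.homMk x (A.char s ≫ q) w)
  hom_fill k s x w := Γ.hom_fill k (Arrow.homMk x (A.char s ≫ q) w)
  fill_hom k s x w := Γ.fill_hom k (Arrow.homMk x (A.char s ≫ q) w)

theorem isLift_cellFilling_iff {A : CellCx.{u}} {g : Arrow TopCat.{u}}
    {Γ : Lifting cellMap.{u} g} {a : A.base ⟶ g.left} {Y : TopCat.{u}} {p : A.body ⟶ Y}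
    {ψ : Arrow.mk p ⟶ g} : (cellFilling Γ (p ≫ ψ.right)).IsLift a ψ.left ↔
      A.map ≫ ψ.left = a ∧ ∀ k s, A.char s ≫ ψ.left = Γ.fill k (charSquare p s ≫ ψ) := by
  have hs {k} (s : A.Cell k) (w) : Arrow.homMk (diskBoundaryInclusion k ≫ A.char s ≫ ψ.left)
      (A.char s ≫ p ≫ ψ.right) w = charSquare p s ≫ ψ :=
    Arrow.hom_ext _ _ (Category.assoc _ _ _).symm (Category.assoc _ _ _).symm
  refine ⟨fun H => ⟨H.map_comp, fun k s => ?_⟩, fun H => ⟨H.1, ψ.w, fun k s w => ?_⟩⟩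
  · refine (H.char_comp k s ?_).trans (congrArg (Γ.fill k) (hs s _))
    rw [Category.assoc, Category.assoc]
    exact congrArg (fun h => _ ≫ _ ≫ h) ψ.w
  · exact (H.2 k s).trans (congrArg (Γ.fill k) (hs s w).symm)

theorem isLift_bodyMap {A : CellCx.{u}} (φ : A ⟶ free f) {a : A.base ⟶ (free f).body}
    {q : A.body ⟶ f.right} (ha : A.map ≫ bodyMap φ = a) (hq : bodyMap φ ≫ E f = q) :
    (cellFilling (lifting f) q).IsLift a (bodyMap φ) where
  map_comp := ha
  comp_right := hq
  char_comp k s w := by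
    subst hq
    refine (char_bodyMap φ s).trans ((fill_charSquare _).symm.trans ?_)
    refine congrArg ((lifting f).fill k) (Arrow.hom_ext _ _ ?_ ?_)
    · exact congrArg (diskBoundaryInclusion k ≫ ·) (char_bodyMap φ s).symm
    · exact (congrArg (· ≫ E f) (char_bodyMap φ s).symm).trans (Category.assoc _ _ _)

theorem left_hom_eq_map_E {g : Arrow TopCat.{u}} (φ : f ⟶ g) :
    φ.left ≫ g.hom = (free f).map ≫ E f ≫ φ.right :=
  φ.w.trans ((congrArg (· ≫ φ.right) (toBody_E f 0).symm).trans (Category.assoc _ _ _))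

end Free

/-- The free lifting operation on `f = Ef ∘ UKf`. -/
noncomputable def freeLifting : FreeLifting cellMap.{u} factorization.{u} where
  lifting := lifting
  isHom_map {f g} φ := isHom_lifting_iff.mpr (isLift_cellFilling_iff.mp
    (isLift_bodyMap (K.map φ) rfl (factorization.R_naturality φ))).2
  desc {f g} Γ φ := Arrow.homMk
    ((cellFilling Γ (E f ≫ φ.right)).lift φ.left (left_hom_eq_map_E φ)) φ.right
    ((cellFilling Γ (E f ≫ φ.right)).isLift_lift φ.left (left_hom_eq_map_E φ)).comp_right
  isHom_desc Γ φ := isHom_lifting_iff.mpr (isLift_cellFilling_iff.mp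
    ((cellFilling Γ (E _ ≫ φ.right)).isLift_lift φ.left (left_hom_eq_map_E φ))).2
  L_desc Γ φ := ((cellFilling Γ (E _ ≫ φ.right)).isLift_lift φ.left (left_hom_eq_map_E φ)).map_comp
  desc_right _ _ := rfl
  hom_ext {f g Γ ψ ψ'} h h' h₀ h₁ := by
    have H := isLift_cellFilling_iff.mpr ⟨rfl, isHom_lifting_iff.mp h⟩
    have H' := isLift_cellFilling_iff.mpr ⟨h₀.symm, isHom_lifting_iff.mp h'⟩
    rw [← h₁] at H'
    exact Arrow.hom_ext _ _ (H.unique H') h₁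

section Adjunction

variable {A : CellCx.{u}} {f : Arrow TopCat.{u}} (h : U.obj A ⟶ f)

theorem map_homEquiv_freeCounit : U.map (adj.homEquiv A f h) ≫ freeCounit f = h := by
  have e : adj.homEquiv A f h = freeEquiv A f h :=
    congrFun (congrArg DFunLike.coe
      (congrFun (congrFun (Adjunction.mkOfHomEquiv_homEquiv _) A) f)) h
  rw [e]
  exact (freeEquiv A f).symm_apply_apply h

theorem homEquiv_base :
    (CellCx.Hom.strat (B := free f) (adj.homEquiv A f h) 0).base = h.left :=
  (map_freeCounit_left (f := f) (adj.homEquiv A f h)).symm.trans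
    (congrArg Arrow.Hom.left (map_homEquiv_freeCounit h))

theorem bodyMap_homEquiv_E : bodyMap (B := free f) (adj.homEquiv A f h) ≫ E f = h.right :=
  (map_freeCounit_right (f := f) (adj.homEquiv A f h)).symm.trans
    (congrArg Arrow.Hom.right (map_homEquiv_freeCounit h))

theorem map_bodyMap_homEquiv :
    A.map ≫ bodyMap (B := free f) (adj.homEquiv A f h) = h.left ≫ (free f).map :=
  (toBody_bodyMap (B := free f) (adj.homEquiv A f h) 0).trans
    (congrArg (· ≫ (free f).map) (homEquiv_base h))

theorem isLift_bodyMap_homEquiv : (cellFilling (lifting f) h.right).IsLift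
    (h.left ≫ (free f).map) (bodyMap (B := free f) (adj.homEquiv A f h)) :=
  isLift_bodyMap (f := f) _ (map_bodyMap_homEquiv h) (bodyMap_homEquiv_E h)

end Adjunction

theorem char_freeLifting_comul {f : Arrow TopCat.{u}} {k : ℕ} (s : (free f).Cell k) (w) :
    (free f).char s ≫ freeLifting.comul f = (lifting (U.obj (free f))).fill k
      (Arrow.homMk (diskBoundaryInclusion k ≫ (free f).char s ≫ freeLifting.comul f)
        ((free f).char s) w) := by
  have h := isHom_lifting_iff.mp (freeLifting.isHom_comulHom f) k s
  refine h.trans (congrArg ((lifting (U.obj (free f))).fill k) (Arrow.hom_ext _ _ ?_ ?_))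
  · exact Category.assoc _ _ _
  · calc (lifting f).fill k ((charSquare (E f) s ≫ freeLifting.comulHom f) ≫ Lifting.compSnd _ _)
      _ = (lifting f).fill k (charSquare (E f) s) := congrArg ((lifting f).fill k)
        ((Category.assoc _ _ _).trans ((congrArg (charSquare (E f) s ≫ ·)
          (freeLifting.comulHom_compSnd f)).trans (Category.comp_id _)))
      _ = (free f).char s := fill_charSquare s

theorem freeLifting_comul (f : Arrow TopCat.{u}) :
    freeLifting.comul f = (adj.toComonad.δ.app f).right := by
  have e : (adj.toComonad.δ.app f).right =
      bodyMap (B := free (U.obj (free f))) (adj.homEquiv (free f) (U.obj (free f)) (𝟙 _)) := by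
    rw [Adjunction.homEquiv_id]
    rfl
  rw [e]
  refine CellFilling.IsLift.unique ?_ (isLift_bodyMap_homEquiv _)
  refine ⟨(freeLifting.L_comul f).trans (Category.id_comp _).symm, freeLifting.comul_R f,
    fun k s w => ?_⟩
  refine (char_freeLifting_comul s ?_).trans (congrArg ((lifting (U.obj (free f))).fill k) ?_)
  · exact w.trans (congrArg (diskBoundaryInclusion k ≫ ·) (Category.comp_id _))
  · exact Arrow.hom_ext _ _ rfl (Category.comp_id _).symm

section CompositeCells

variable {A B : CellCx.{u}} {e : A.body ≅ B.base} (c : Composite A B e) {k : ℕ} {Z : TopCat.{u}}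
  (m : B.body ⟶ Z)

theorem Composite.char_inl_comp (s : A.Cell k) :
    c.cx.char (c.cells k (Sum.inl s)) ≫ c.bodyIso.hom ≫ m = A.char s ≫ e.hom ≫ B.map ≫ m := by
  rw [← Category.assoc, c.char_inl]
  simp only [Category.assoc]

theorem Composite.char_inr_comp (t : B.Cell k) :
    c.cx.char (c.cells k (Sum.inr t)) ≫ c.bodyIso.hom ≫ m = B.char t ≫ m := by
  rw [← Category.assoc, c.char_inr]

theorem Composite.map_comp : c.cx.map ≫ c.bodyIso.hom ≫ m =
    c.baseIso.hom ≫ A.map ≫ e.hom ≫ B.map ≫ m := by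
  rw [← Category.assoc, c.w]
  simp only [Category.assoc]

end CompositeCells

section Mul

variable {f : Arrow TopCat.{u}} (c : Composite (free f) (free (Arrow.mk (E f))) (baseEIso f))

theorem baseEIso_map_mul : (baseEIso f).hom ≫ (free (Arrow.mk (E f))).map ≫
    (freeLifting.mul f).left = 𝟙 _ :=
  (Category.id_comp _).trans (freeLifting.L_mul f)

theorem baseEIso_map_E : (baseEIso f).hom ≫ (free (Arrow.mk (E f))).map ≫ E (Arrow.mk (E f)) =
    E f :=
  (Category.id_comp _).trans (toBody_E (Arrow.mk (E f)) 0)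

theorem Composite.char_inl_mul {k : ℕ} (s : (free f).Cell k) :
    c.cx.char (c.cells k (Sum.inl s)) ≫ c.bodyIso.hom ≫ (freeLifting.mul f).left =
      (free f).char s :=
  (c.char_inl_comp _ s).trans
    ((congrArg ((free f).char s ≫ ·) baseEIso_map_mul).trans (Category.comp_id _))

theorem Composite.char_inl_E {k : ℕ} (s : (free f).Cell k) :
    c.cx.char (c.cells k (Sum.inl s)) ≫ c.bodyIso.hom ≫ E (Arrow.mk (E f)) =
      (free f).char s ≫ E f :=
  (c.char_inl_comp _ s).trans (congrArg ((free f).char s ≫ ·) baseEIso_map_E)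

theorem Composite.char_mul {k : ℕ} (s : c.cx.Cell k) (w) :
    c.cx.char s ≫ c.bodyIso.hom ≫ (freeLifting.mul f).left = (lifting f).fill k (Arrow.homMk
      (diskBoundaryInclusion k ≫ c.cx.char s ≫ c.bodyIso.hom ≫ (freeLifting.mul f).left)
      (c.cx.char s ≫ c.bodyIso.hom ≫ E (Arrow.mk (E f))) w) := by
  obtain ⟨s | t, rfl⟩ := (c.cells k).surjective s
  · refine (c.char_inl_mul s).trans ((fill_charSquare s).symm.trans ?_)
    refine congrArg ((lifting f).fill k) (Arrow.hom_ext _ _ ?_ (c.char_inl_E s).symm)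
    exact congrArg (diskBoundaryInclusion k ≫ ·) (c.char_inl_mul s).symm
  · have h := isHom_lifting_iff.mp (freeLifting.isHom_mul f) k t
    refine (c.char_inr_comp _ t).trans (h.trans ?_)
    refine congrArg ((lifting f).fill k) (Arrow.hom_ext _ _ ?_ ?_)
    · exact (Category.assoc _ _ _).trans
        (congrArg (diskBoundaryInclusion k ≫ ·) (c.char_inr_comp _ t).symm)
    · exact (congrArg (_ ≫ ·) (freeLifting.mul_right f)).trans
        ((Category.comp_id _).trans (c.char_inr_comp _ t).symm)

theorem freeLifting_mul : (freeLifting.mul f).left = c.mul := by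
  refine (Iso.eq_inv_comp c.bodyIso).mpr (CellFilling.IsLift.unique
    ⟨?_, ?_, fun k s w => c.char_mul s w⟩ (isLift_bodyMap_homEquiv (A := c.cx) (f := f)
      (Arrow.homMk c.baseIso.hom (c.bodyIso.hom ≫ E (Arrow.mk (E f))) (comp_EE c))))
  · exact (c.map_comp _).trans (congrArg (c.baseIso.hom ≫ ·)
      ((congrArg ((free f).map ≫ ·) baseEIso_map_mul).trans (Category.comp_id _)))
  · exact (Category.assoc _ _ _).trans (congrArg (c.bodyIso.hom ≫ ·) ((freeLifting.mul f).w.trans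
      ((congrArg (_ ≫ ·) (freeLifting.mul_right f)).trans (Category.comp_id _))))

end Mul

theorem genStructure_right (k : ℕ) : (genStructure.{u} k).right = freeLifting.generator k := by
  refine (fill_charSquare (f := cellMap k) _).symm.trans
    (congrArg ((lifting (cellMap k)).fill k) (Arrow.hom_ext _ _ ?_ ?_))
  · exact (hom_char_free (f := cellMap k) _).trans (Category.id_comp _)
  · exact char_E (f := cellMap k) _

end CellCx

/-! ### Existence of composites -/

namespace CellCx

section Labelled

variable {Z : TopCat.{u}} {I : ℕ → Type u} (r : ∀ k, I k → (disk.{u} k ⟶ Z))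

/-- The stratum with one cell for each label and each allowed lift of the boundary of the labelled
map to `T.X`. -/
noncomputable abbrev FreeStage.labelled (T : FreeStage Z) : Stratum.{u} where
  X := T.X
  cells k := {p : I k × (diskBoundary.{u} k ⟶ T.X) //
    p.2 ≫ T.e = diskBoundaryInclusion.{u} k ≫ r k p.1 ∧ T.ok k p.2}
  attach _ p := p.1.2

/-- The next stage of the free labelled cell complex. -/
noncomputable abbrev FreeStage.labelledNext (T : FreeStage Z) : FreeStage Z where
  X := (T.labelled r).body
  e := (T.labelled r).desc T.e (fun k p => r k p.1.1) (fun _ p => p.2.1)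
  ok k b := ¬ ∃ c : diskBoundary.{u} k ⟶ T.X, c ≫ (T.labelled r).incl = b

/-- The stages of the free labelled cell complex. -/
noncomputable def labelledStage {X : TopCat.{u}} (g : X ⟶ Z) : ℕ → FreeStage Z
  | 0 => ⟨X, g, fun _ _ => True⟩
  | n + 1 => (labelledStage g n).labelledNext r

/-- The free labelled cell complex on `g : X ⟶ Z`. It is built like the free cell complex, but it
only has cells that lie over a map `r k i`, and it has one for each label `i` of that map. -/
noncomputable abbrev labelled {X : TopCat.{u}} (g : X ⟶ Z) : CellCx.{u} where
  stratum n := (labelledStage r g n).labelled r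
  link _ := Iso.refl _
  proper n k s h := s.2.2 (by
    obtain ⟨c, hc⟩ := h
    exact ⟨c, (Category.comp_id _).symm.trans ((Category.assoc _ _ _).trans hc)⟩)

variable {X : TopCat.{u}} (g : X ⟶ Z)

theorem labelled_step (n : ℕ) : (labelled r g).step n = ((labelledStage r g n).labelled r).incl :=
  Category.comp_id _

theorem labelled_step_e (n : ℕ) :
    (labelled r g).step n ≫ (labelledStage r g (n + 1)).e = (labelledStage r g n).e := by
  rw [labelled_step]
  exact Stratum.incl_desc _ _ _ _

/-- The map from the body of the free labelled cell complex to `Z`. -/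
noncomputable def labelledE : (labelled r g).body ⟶ Z :=
  (labelled r g).desc (fun n => (labelledStage r g n).e) (labelled_step_e r g)

theorem toBody_labelledE (n : ℕ) :
    (labelled r g).toBody n ≫ labelledE r g = (labelledStage r g n).e :=
  toBody_desc (labelled r g) (fun n => (labelledStage r g n).e) (labelled_step_e r g) n

/-- The label of a cell and its attaching map to the stage at which it is attached. -/
def indexPair {k : ℕ} (s : (labelled r g).Cell k) :
    I k × (diskBoundary.{u} k ⟶ ((labelled r g).stratum s.1).X) :=
  (show ((labelledStage r g s.1).labelled r).cells k from s.2).1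

theorem char_labelledE {k : ℕ} (s : (labelled r g).Cell k) :
    (labelled r g).char s ≫ labelledE r g = r k (indexPair r g s).1 := by
  rw [char, Category.assoc, Category.assoc, toBody_labelledE]
  exact (congrArg (_ ≫ ·) (Category.id_comp _)).trans (Stratum.char_desc _ _ _ _ k s.2)

theorem hom_char_labelled {k : ℕ} (s : (labelled r g).Cell k) :
    diskBoundaryInclusion.{u} k ≫ (labelled r g).char s =
      (indexPair r g s).2 ≫ (labelled r g).toBody s.1 :=
  (labelled r g).hom_char_mkCell s.2

theorem labelledCell_ext {k : ℕ} {s t : (labelled r g).Cell k}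
    (h₁ : diskBoundaryInclusion.{u} k ≫ (labelled r g).char s =
      diskBoundaryInclusion.{u} k ≫ (labelled r g).char t)
    (h₂ : (indexPair r g s).1 = (indexPair r g t).1) : s = t := by
  rw [hom_char_labelled, hom_char_labelled] at h₁
  have e := IsNew.unique ((labelled r g).isNew_attach s.1 k s.2)
    ((labelled r g).isNew_attach t.1 k t.2) h₁
  obtain ⟨n, ⟨i, c⟩, hs⟩ := s
  obtain ⟨m, ⟨i', c'⟩, ht⟩ := t
  obtain rfl : n = m := congrArg Sigma.fst e
  obtain rfl : c = c' := eq_of_heq (Sigma.mk.inj e).2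
  obtain rfl : i = i' := h₂
  rfl

theorem exists_labelledCell {k : ℕ} (i : I k) (x : diskBoundary.{u} k ⟶ (labelled r g).body)
    (w : x ≫ labelledE r g = diskBoundaryInclusion.{u} k ≫ r k i) :
    ∃ s : (labelled r g).Cell k, diskBoundaryInclusion.{u} k ≫ (labelled r g).char s = x ∧
      (indexPair r g s).1 = i := by
  obtain ⟨n, c, hc, rfl⟩ := (labelled r g).exists_isNew x
  have w' : c ≫ (labelledStage r g n).e = diskBoundaryInclusion.{u} k ≫ r k i := by
    rw [← toBody_labelledE, ← Category.assoc]
    exact w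
  have hok : (labelledStage r g n).ok k c := by
    cases n with
    | zero => exact True.intro
    | succ n =>
      rintro ⟨c', h⟩
      exact hc ⟨c', (congrArg (c' ≫ ·) (labelled_step r g n)).trans h⟩
  exact ⟨⟨n, ⟨(i, c), w', hok⟩⟩, hom_char_labelled r g _, rfl⟩

/-- The cell with a given label and a given boundary. -/
noncomputable def labelledCell {k : ℕ} (i : I k) (x : diskBoundary.{u} k ⟶ (labelled r g).body)
    (w : x ≫ labelledE r g = diskBoundaryInclusion.{u} k ≫ r k i) : (labelled r g).Cell k :=
  (exists_labelledCell r g i x w).choose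

section

variable {k : ℕ} (i : I k) (x : diskBoundary.{u} k ⟶ (labelled r g).body)
  (w : x ≫ labelledE r g = diskBoundaryInclusion.{u} k ≫ r k i)

theorem hom_char_labelledCell :
    diskBoundaryInclusion.{u} k ≫ (labelled r g).char (labelledCell r g i x w) = x :=
  (exists_labelledCell r g i x w).choose_spec.1

theorem indexPair_labelledCell : (indexPair r g (labelledCell r g i x w)).1 = i :=
  (exists_labelledCell r g i x w).choose_spec.2

theorem char_labelledCell_labelledE :
    (labelled r g).char (labelledCell r g i x w) ≫ labelledE r g = r k i := by
  rw [char_labelledE, indexPair_labelledCell]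

end

/-- If the cells of `A` are labelled compatibly with `q : A.body ⟶ Z`, the cells of the free
labelled cell complex are fillers for them. -/
noncomputable def labelledFilling {A : CellCx.{u}} {q : A.body ⟶ Z} (l : ∀ k, A.Cell k → I k)
    (hl : ∀ k s, A.char s ≫ q = r k (l k s)) : A.CellFilling (labelledE r g) q where
  fill k s x w := (labelled r g).char (labelledCell r g (l k s) x (hl k s ▸ w))
  hom_fill _ _ _ _ := hom_char_labelledCell _ _ _ _ _
  fill_hom k s _ _ := (char_labelledCell_labelledE _ _ _ _ _).trans (hl k s).symm

section

variable {r g} {τ : Z ⟶ (labelled r g).body} (h₀ : g ≫ τ = (labelled r g).map)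
  (hE : τ ≫ labelledE r g = 𝟙 Z) (h₁ : ∀ k i w, r k i ≫ τ = (labelled r g).char
    (labelledCell r g i (diskBoundaryInclusion.{u} k ≫ r k i ≫ τ) w))

include h₀ hE h₁ in
theorem labelledE_comp_section : labelledE r g ≫ τ = 𝟙 _ := by
  let Φ := labelledFilling r g (A := labelled r g) (fun _ s => (indexPair r g s).1)
    (fun _ => char_labelledE r g)
  have hτ {k} (s : (labelled r g).Cell k) : (labelled r g).char s ≫ labelledE r g ≫ τ =
      r k (indexPair r g s).1 ≫ τ := by
    rw [← Category.assoc, char_labelledE]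
  refine CellFilling.IsLift.unique (Φ := Φ) (a := (labelled r g).map)
    ⟨?_, ?_, fun k s w => ?_⟩ ⟨Category.comp_id _, Category.id_comp _, fun k s w => ?_⟩
  · exact (Category.assoc _ _ _).symm.trans
      ((congrArg (· ≫ τ) (toBody_labelledE r g 0)).trans h₀)
  · rw [Category.assoc, hE, Category.comp_id]
  · refine (hτ s).trans ((h₁ k _ ?_).trans ?_)
    · rw [Category.assoc, Category.assoc, hE, Category.comp_id]
    · exact congrArg (labelled r g).char (labelledCell_ext r g
        (by rw [hom_char_labelledCell, hom_char_labelledCell, hτ])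
        (by rw [indexPair_labelledCell, indexPair_labelledCell]))
  · exact (Category.comp_id _).trans (congrArg (labelled r g).char (labelledCell_ext r g
      ((congrArg (_ ≫ ·) (Category.comp_id _)).symm.trans (hom_char_labelledCell r g _ _ _).symm)
      (indexPair_labelledCell r g _ _ _).symm))

include hE in
theorem section_boundary {k : ℕ} (i : I k) :
    (diskBoundaryInclusion.{u} k ≫ r k i ≫ τ) ≫ labelledE r g =
      diskBoundaryInclusion.{u} k ≫ r k i := by
  rw [Category.assoc, Category.assoc, hE, Category.comp_id]

/-- If the body of the free labelled cell complex is `Z`, its cells are the labels. -/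
noncomputable def labelEquiv (hτ : labelledE r g ≫ τ = 𝟙 _) (k : ℕ) :
    (labelled r g).Cell k ≃ I k where
  toFun s := (indexPair r g s).1
  invFun i := labelledCell r g i (diskBoundaryInclusion.{u} k ≫ r k i ≫ τ) (section_boundary hE i)
  left_inv s := labelledCell_ext r g
    (by rw [hom_char_labelledCell, ← char_labelledE r g s, Category.assoc, hτ, Category.comp_id])
    (indexPair_labelledCell r g _ _ _)
  right_inv i := indexPair_labelledCell r g _ _ _

theorem char_labelEquiv_symm (hτ : labelledE r g ≫ τ = 𝟙 _) {k : ℕ} (i : I k) :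
    (labelled r g).char ((labelEquiv hE hτ k).symm i) ≫ labelledE r g = r k i :=
  char_labelledCell_labelledE r g i _ (section_boundary hE i)

end

end Labelled

section Composition

variable (A B : CellCx.{u}) (e : A.body ≅ B.base)

/-- The characteristic maps of the composite, labelled by the cells of `A` and of `B`. -/
noncomputable def sumChar (k : ℕ) : A.Cell k ⊕ B.Cell k → (disk.{u} k ⟶ B.body) :=
  Sum.elim (fun s => A.char s ≫ e.hom ≫ B.map) (fun t => B.char t)

/-- The underlying cell complex of the composite of `A` and `B`. -/
noncomputable abbrev compositeCx : CellCx.{u} :=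
  labelled (sumChar A B e) (A.map ≫ e.hom ≫ B.map)

/-- The comparison map of the composite with the body of `B`; it is invertible. -/
noncomputable abbrev compositeE : (compositeCx A B e).body ⟶ B.body :=
  labelledE (sumChar A B e) (A.map ≫ e.hom ≫ B.map)

/-- The fillers in the composite for the cells of `A`. -/
noncomputable abbrev inlFilling : A.CellFilling (compositeE A B e) (e.hom ≫ B.map) :=
  labelledFilling _ _ (fun _ s => Sum.inl s) (fun _ _ => rfl)

/-- The fillers in the composite for the cells of `B`. -/
noncomputable abbrev inrFilling : B.CellFilling (compositeE A B e) (𝟙 B.body) :=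
  labelledFilling _ _ (fun _ t => Sum.inr t) (fun _ _ => Category.comp_id _)

/-- The inclusion of `A` in the composite. -/
noncomputable def inlBody : A.body ⟶ (compositeCx A B e).body :=
  (inlFilling A B e).lift (compositeCx A B e).map (toBody_labelledE _ _ 0)

theorem isLift_inlBody : (inlFilling A B e).IsLift (compositeCx A B e).map (inlBody A B e) :=
  CellFilling.isLift_lift _ _ _

theorem inv_inlBody_compositeE :
    (e.inv ≫ inlBody A B e) ≫ compositeE A B e = B.map ≫ 𝟙 B.body := by
  rw [Category.assoc, (isLift_inlBody A B e).comp_right, Iso.inv_hom_id_assoc, Category.comp_id]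

/-- The map from the body of `B` to the composite that extends the inclusion of `A`. -/
noncomputable def inrBody : B.body ⟶ (compositeCx A B e).body :=
  (inrFilling A B e).lift (e.inv ≫ inlBody A B e) (inv_inlBody_compositeE A B e)

theorem isLift_inrBody : (inrFilling A B e).IsLift (e.inv ≫ inlBody A B e) (inrBody A B e) :=
  CellFilling.isLift_lift _ _ _

theorem hom_map_inrBody : e.hom ≫ B.map ≫ inrBody A B e = inlBody A B e := by
  rw [(isLift_inrBody A B e).map_comp, Iso.hom_inv_id_assoc]

theorem sumChar_inrBody (k : ℕ) (i : A.Cell k ⊕ B.Cell k) (w) :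
    sumChar A B e k i ≫ inrBody A B e = (compositeCx A B e).char (labelledCell _ _ i
      (diskBoundaryInclusion.{u} k ≫ sumChar A B e k i ≫ inrBody A B e) w) := by
  rcases i with s | t
  · have hs : sumChar A B e k (Sum.inl s) ≫ inrBody A B e = A.char s ≫ inlBody A B e := by
      rw [← hom_map_inrBody]
      simp only [sumChar, Sum.elim_inl, Category.assoc]
    simp only [hs] at w ⊢
    exact (isLift_inlBody A B e).char_comp k s w
  · exact (isLift_inrBody A B e).char_comp k t
      (w.trans (congrArg (_ ≫ ·) (Category.comp_id _).symm))

theorem compositeE_inrBody : compositeE A B e ≫ inrBody A B e = 𝟙 _ := by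
  refine labelledE_comp_section ?_ (isLift_inrBody A B e).comp_right (sumChar_inrBody A B e)
  rw [Category.assoc, Category.assoc, hom_map_inrBody, (isLift_inlBody A B e).map_comp]

/-- The cells of the composite are those of `A` and those of `B`. -/
noncomputable def compositeCells (k : ℕ) : A.Cell k ⊕ B.Cell k ≃ (compositeCx A B e).Cell k :=
  (labelEquiv (isLift_inrBody A B e).comp_right (compositeE_inrBody A B e) k).symm

theorem char_compositeCells {k : ℕ} (i : A.Cell k ⊕ B.Cell k) :
    (compositeCx A B e).char (compositeCells A B e k i) ≫ compositeE A B e = sumChar A B e k i :=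
  char_labelEquiv_symm (isLift_inrBody A B e).comp_right (compositeE_inrBody A B e) i

/-- The composite of composable cell complexes. -/
noncomputable def composite : Composite A B e where
  cx := compositeCx A B e
  baseIso := Iso.refl _
  bodyIso := ⟨compositeE A B e, inrBody A B e, compositeE_inrBody A B e,
    (isLift_inrBody A B e).comp_right⟩
  w := (toBody_labelledE (sumChar A B e) (A.map ≫ e.hom ≫ B.map) 0).trans
    (Category.id_comp _).symm
  cells := compositeCells A B e
  char_inl _ s := char_compositeCells A B e (Sum.inl s)
  char_inr _ t := char_compositeCells A B e (Sum.inr t)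

end Composition

theorem isCellStructure : IsCellStructure freeLifting.{u}.awfsStructure where
  comul := freeLifting_comul
  mul f := ⟨composite (free f) (free (Arrow.mk (E f))) (baseEIso f), freeLifting_mul _⟩

end CellCx

/-! ### The free monoid sequence -/

section FreeMonoidSequence

variable {C : Type u} [Category.{v} C]

namespace Lifting

variable {ι : Type t} {j : ι → Arrow C} {f g : Arrow C}

/-- Transport of a lifting operation along an isomorphism of arrows. -/
def ofIso (e : f ≅ g) (Γ : Lifting j g) : Lifting j f where
  fill k s := Γ.fill k (s ≫ e.hom) ≫ e.inv.left
  hom_fill k s := by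
    rw [← Category.assoc, Γ.hom_fill, ← Arrow.comp_left, Category.assoc, e.hom_inv_id,
      Category.comp_id]
  fill_hom k s := by
    rw [Category.assoc, e.inv.w, ← Category.assoc, Γ.fill_hom, ← Arrow.comp_right, Category.assoc,
      e.hom_inv_id, Category.comp_id]

theorem isHom_inv (e : f ≅ g) (Γ : Lifting j g) : Γ.IsHom (Γ.ofIso e) e.inv := fun k s => by
  change _ = Γ.fill k ((s ≫ e.inv) ≫ e.hom) ≫ e.inv.left
  rw [Category.assoc, e.inv_hom_id, Category.comp_id]

theorem isHom_hom (e : f ≅ g) (Γ : Lifting j g) : (Γ.ofIso e).IsHom Γ e.hom := fun k s => by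
  change (Γ.fill k (s ≫ e.hom) ≫ e.inv.left) ≫ e.hom.left = _
  rw [Category.assoc, ← Arrow.comp_left, e.inv_hom_id]
  exact Category.comp_id _

end Lifting

namespace FunctorialFactorization

variable {F G H : FunctorialFactorization C}

/-- A morphism of functorial factorisations with invertible components induces isomorphisms of
right parts. -/
noncomputable def rightIso (a : Hom F G) [∀ f, IsIso (a.χ.app f)] (f : Arrow C) :
    F.right.obj f ≅ G.right.obj f :=
  Arrow.isoMk (asIso (a.χ.app f)) (Iso.refl f.right)
    ((a.comp_right f).trans (Category.comp_id _).symm)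

theorem right_map_eq (a : Hom F G) [∀ f, IsIso (a.χ.app f)] {f g : Arrow C} (φ : f ⟶ g) :
    F.right.map φ = (rightIso a f).hom ≫ G.right.map φ ≫ (rightIso a g).inv := by
  rw [← Category.assoc, Iso.eq_comp_inv]
  exact a.rightTrans.naturality φ

end FunctorialFactorization

namespace FreeLifting

open FunctorialFactorization

variable {ι : Type t} {j : ι → Arrow C} {F F' : FunctorialFactorization C}

/-- Transport of free lifting operations along an isomorphism of functorial factorisations. -/
noncomputable def ofIsIso (Ψ : FreeLifting j F) (a : Hom F' F) [∀ f, IsIso (a.χ.app f)] :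
    FreeLifting j F' where
  lifting f := (Ψ.lifting f).ofIso (rightIso a f)
  isHom_map {f g} φ := by
    rw [right_map_eq a φ]
    exact (Lifting.isHom_hom _ _).comp ((Ψ.isHom_map φ).comp (Lifting.isHom_inv _ _))
  desc {f g} Γ φ := (rightIso a f).hom ≫ Ψ.desc Γ φ
  isHom_desc Γ φ := (Lifting.isHom_hom _ _).comp (Ψ.isHom_desc Γ φ)
  L_desc {f g} Γ φ := (Category.assoc _ _ _).symm.trans
    ((congrArg (· ≫ (Ψ.desc Γ φ).left) (a.left_comp f)).trans (Ψ.L_desc Γ φ))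
  desc_right Γ φ := (Category.id_comp _).trans (Ψ.desc_right Γ φ)
  hom_ext {f g Γ ψ ψ'} h h' hl hr := by
    have hL {χ : F'.right.obj f ⟶ g} :
        F.L f ≫ ((rightIso a f).inv ≫ χ).left = F'.L f ≫ χ.left := by
      refine (Category.assoc _ _ _).symm.trans (congrArg (· ≫ χ.left) ?_)
      exact (IsIso.comp_inv_eq _).2 (a.left_comp f).symm
    refine (cancel_epi (rightIso a f).inv).1 (Ψ.hom_ext
      ((Lifting.isHom_inv _ _).comp h) ((Lifting.isHom_inv _ _).comp h') ?_ ?_)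
    · rw [hL, hL, hl]
    · exact congrArg ((rightIso a f).inv.right ≫ ·) hr

end FreeLifting

namespace FunctorialFactorization

variable {T F G H K : FunctorialFactorization C}

theorem Hom.congr_app {a b : Hom F G} (h : a = b) (f : Arrow C) : a.χ.app f = b.χ.app f :=
  h ▸ rfl

theorem Hom.comp_assoc (a : Hom F G) (b : Hom G H) (c : Hom H K) :
    (a.comp b).comp c = a.comp (b.comp c) := Hom.ext (Category.assoc _ _ _)

theorem Hom.comp_id (a : Hom F G) : a.comp (.id G) = a := Hom.ext (Category.comp_id _)

theorem compMap_comp (a : Hom F G) (b : Hom G H) :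
    (T.compMap a).comp (T.compMap b) = T.compMap (a.comp b) := by
  ext f
  exact (T.M.map_comp (a.rightTrans.app f) (b.rightTrans.app f)).symm.trans
    (congrArg T.M.map (Arrow.hom_ext _ _ rfl (Category.comp_id _)))

theorem point_compMap (a : Hom G H) : (T.point G).comp (T.compMap a) = a.comp (T.point H) := by
  ext f
  exact (T.L_naturality (a.rightTrans.app f)).symm

theorem point_compMap_act {act : Hom (T.comp F) F} (hact : (T.point F).comp act = .id F)
    (q : Hom G F) : (T.point G).comp ((T.compMap q).comp act) = q := by
  rw [← Hom.comp_assoc, point_compMap, Hom.comp_assoc, hact, Hom.comp_id]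

/-- The morphism `(L, 1)` out of the trivial factorisation. -/
def fromTrivial (F : FunctorialFactorization C) : Hom (trivial C) F where
  χ := { app := F.L, naturality := fun _ _ φ => F.L_naturality φ }
  left_comp _ := Category.id_comp _
  comp_right := F.fac

theorem hom_trivial_ext (a b : Hom (trivial C) F) : a = b := by
  ext f
  exact (Category.id_comp _).symm.trans ((a.left_comp f).trans
    ((b.left_comp f).symm.trans (Category.id_comp _)))

/-- The inverse of the unitor `T ⊙ 1 ⟶ T`. -/
def toCompTrivial (T : FunctorialFactorization C) : Hom T (T.comp (trivial C)) where
  χ :=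
    { app := fun f => 𝟙 (T.M.obj f)
      naturality := fun _ _ _ => (Category.comp_id _).trans (Category.id_comp _).symm }
  left_comp _ := (Category.comp_id _).trans (Category.id_comp _).symm
  comp_right _ := Category.id_comp _

/-- A morphism from a stage of the free monoid sequence to a factorisation on which `T` acts. -/
structure ActStage (act : Hom (T.comp F) F) (S : MonoidStage T) where
  p : Hom S.X F
  q : Hom S.Y F
  x_q : S.x.comp q = p
  σ_q : S.σ.comp q = (T.compMap p).comp act

variable {act : Hom (T.comp F) F} (hact : (T.point F).comp act = .id F)

include hact in
theorem ActStage.condition {S : MonoidStage T} (Q : ActStage act S) :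
    (T.compMap S.x).comp ((T.compMap Q.q).comp act) =
      (S.σ.comp (T.point S.Y)).comp ((T.compMap Q.q).comp act) := by
  rw [← Hom.comp_assoc, compMap_comp, Q.x_q, ← Q.σ_q, Hom.comp_assoc, point_compMap_act hact]

section

variable [HasCoequalizers C]

/-- The morphism out of a coequaliser given by the universal property. -/
noncomputable def coeqDesc {a b : Hom F G} (h : Hom G H) (w : a.comp h = b.comp h) :
    Hom (coeq a b) H where
  χ := coequalizer.desc h.χ (congrArg Hom.χ w)
  left_comp f := (Category.assoc _ _ _).trans ((congrArg (G.L f ≫ ·)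
    (NatTrans.congr_app (coequalizer.π_desc _ (congrArg Hom.χ w)) f)).trans (h.left_comp f))
  comp_right f := by
    have e : coequalizer.desc h.χ (congrArg Hom.χ w) ≫ H.trans = (coeq a b).trans := by
      refine coequalizer.hom_ext ((Category.assoc _ _ _).symm.trans
        ((congrArg (· ≫ H.trans) (coequalizer.π_desc _ _)).trans ?_))
      ext f
      exact (h.comp_right f).trans ((coeqProj a b).comp_right f).symm
    exact NatTrans.congr_app e f

theorem coeqProj_coeqDesc {a b : Hom F G} (h : Hom G H) (w : a.comp h = b.comp h) :
    (coeqProj a b).comp (coeqDesc h w) = h :=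
  Hom.ext (coequalizer.π_desc _ _)

/-- The map of stages extending the action. -/
noncomputable def actStage : ∀ n, ActStage act (monoidStage T n)
  | 0 =>
    { p := F.fromTrivial
      q := T.toCompTrivial.comp ((T.compMap F.fromTrivial).comp act)
      x_q := hom_trivial_ext _ _
      σ_q := by
        ext f
        exact (Category.id_comp _).trans (Category.id_comp _) }
  | n + 1 =>
    { p := (actStage n).q
      q := coeqDesc _ ((actStage n).condition hact)
      x_q := by
        exact (Hom.comp_assoc _ _ _).trans ((congrArg (Hom.comp (T.point _))
          (coeqProj_coeqDesc _ _)).trans (point_compMap_act hact _))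
      σ_q := coeqProj_coeqDesc _ _ }

/-- The morphism to a factorisation on which `T` acts from the `n`-th term of the free monoid
sequence. -/
noncomputable def actMap (n : ℕ) : Hom (T.term n) F := (actStage hact n).p

theorem termMap_actMap (n : ℕ) :
    (T.termMap n).comp (actMap hact (n + 1)) = actMap hact n := by
  cases n <;> exact (actStage hact _).x_q

theorem termAct_actMap (n : ℕ) :
    (T.termAct n).comp (actMap hact (n + 1)) = (T.compMap (actMap hact n)).comp act := by
  cases n <;> exact (actStage hact _).σ_q

variable (T) in
theorem point_termAct (n : ℕ) : (T.point (T.term n)).comp (T.termAct n) = T.termMap n := by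
  cases n with
  | zero => exact hom_trivial_ext _ _
  | succ n => rfl

variable (T) in
theorem compMap_termMap_termAct (n : ℕ) :
    (T.compMap (T.termMap n)).comp (T.termAct (n + 1)) =
      (T.termAct n).comp (T.termMap (n + 1)) :=
  (Hom.ext (coequalizer.condition (T.compMap (monoidStage T n).x).χ
    ((monoidStage T n).σ.comp (T.point (monoidStage T n).Y)).χ)).trans (Hom.comp_assoc _ _ _)

variable (T) in
theorem epi_termAct [HasPushouts C] (n : ℕ) (f : Arrow C) : Epi ((T.termAct n).χ.app f) := by
  cases n with
  | zero => exact inferInstanceAs (Epi (𝟙 (T.M.obj f)))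
  | succ n =>
    exact inferInstanceAs (Epi ((coequalizer.π (T.compMap (monoidStage T n).x).χ
      ((monoidStage T n).σ.comp (T.point (monoidStage T n).Y)).χ).app f))

variable [HasColimitsOfShape ℕ C]

variable (T) in
theorem termMap_ι (n : ℕ) : (T.termMap n).comp (T.ι (n + 1)) = T.ι n :=
  Hom.ext (T.termMap_toColim n)

theorem colim_hom_ext {f : Arrow C} {Z : C} {a b : T.colim.M.obj f ⟶ Z}
    (h : ∀ n, (T.ι n).χ.app f ≫ a = (T.ι n).χ.app f ≫ b) : a = b :=
  (isColimitOfPreserves ((evaluation _ _).obj f) (colimit.isColimit T.termSeq)).hom_ext h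

section

variable (a : ∀ n, Hom (T.term n) F) (ha : ∀ n, (T.termMap n).comp (a (n + 1)) = a n)

/-- The natural transformation underlying `colimDesc`. -/
noncomputable def colimDescTrans : colimit T.termSeq ⟶ F.M :=
  colimit.desc T.termSeq
    { pt := F.M
      ι := NatTrans.ofSequence (G := (Functor.const ℕ).obj F.M) (fun n => (a n).χ) (fun n => by
        rw [termSeq_map]
        exact (congrArg Hom.χ (ha n)).trans (Category.comp_id _).symm) }

theorem toColim_colimDescTrans (n : ℕ) : T.toColim n ≫ colimDescTrans a ha = (a n).χ :=
  colimit.ι_desc _ n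

/-- The morphism out of the colimit of the free monoid sequence given by the universal property. -/
noncomputable def colimDesc : Hom T.colim F where
  χ := colimDescTrans a ha
  left_comp f := (NatTrans.congr_app (toColim_colimDescTrans a ha 0) f).trans
    ((Category.id_comp _).symm.trans ((a 0).left_comp f))
  comp_right f := colim_hom_ext fun n => (Category.assoc _ _ _).symm.trans
    ((congrArg (· ≫ F.R f) (NatTrans.congr_app (toColim_colimDescTrans a ha n) f)).trans
      (((a n).comp_right f).trans ((T.ι n).comp_right f).symm))

theorem ι_colimDesc (n : ℕ) : (T.ι n).comp (colimDesc a ha) = a n :=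
  Hom.ext (toColim_colimDescTrans a ha n)

end

end

end FunctorialFactorization

end FreeMonoidSequence

/-! ### Garner's small object argument -/

namespace Garner

open FunctorialFactorization

section OneStep

variable {f g : Arrow TopCat.{u}} (k : ℕ) (s : cellMap.{u} k ⟶ f)

theorem char_oneStep_map (φ : f ⟶ g) :
    (oneStratum f).char k s ≫ oneStep.{u}.M.map φ = (oneStratum g).char k (s ≫ φ) :=
  Stratum.char_bodyMap (oneStratumMap φ) k s

theorem char_oneExt : (oneStratum f).char k s ≫ oneExt f = s.right :=
  Stratum.char_desc (oneStratum f) _ _ _ k s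

/-- The retraction of the one-step factorisation of `f` onto the domain of `f` that maps every cell
to its filler. It makes a lifting operation an algebra for the pointed endofunctor underlying the
one-step factorisation. -/
noncomputable def oneFill (Γ : Lifting cellMap.{u} f) : (oneStratum f).body ⟶ f.left :=
  (oneStratum f).desc (𝟙 f.left) (fun k s => Γ.fill k s)
    fun k s => (Category.comp_id _).trans (Γ.hom_fill k s).symm

variable (Γ : Lifting cellMap.{u} f)

theorem incl_oneFill : (oneStratum f).incl ≫ oneFill Γ = 𝟙 f.left :=
  Stratum.incl_desc _ _ _ _

theorem char_oneFill : (oneStratum f).char k s ≫ oneFill Γ = Γ.fill k s :=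
  Stratum.char_desc (oneStratum f) _ _ _ k s

theorem oneFill_hom : oneFill Γ ≫ f.hom = oneExt f := by
  refine Stratum.body_hom_ext ?_ fun k s => ?_
  · rw [← Category.assoc, incl_oneFill]
    exact (Category.id_comp _).trans (oneStep.{u}.fac f).symm
  · rw [← Category.assoc, char_oneFill, char_oneExt]
    exact Γ.fill_hom k s

theorem oneFill_naturality {Γ : Lifting cellMap.{u} f} {Δ : Lifting cellMap.{u} g} {φ : f ⟶ g}
    (h : Γ.IsHom Δ φ) : oneStep.{u}.M.map φ ≫ oneFill Δ = oneFill Γ ≫ φ.left := by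
  refine Stratum.body_hom_ext ?_ fun k s => ?_
  · calc (oneStratum f).incl ≫ oneStep.{u}.M.map φ ≫ oneFill Δ
      _ = φ.left ≫ (oneStratum g).incl ≫ oneFill Δ := oneStep.{u}.L_map_comp φ _
      _ = φ.left := (congrArg (φ.left ≫ ·) (incl_oneFill Δ)).trans (Category.comp_id _)
      _ = (oneStratum f).incl ≫ oneFill Γ ≫ φ.left := by
        rw [← Category.assoc, incl_oneFill, Category.id_comp]
  · calc (oneStratum f).char k s ≫ oneStep.{u}.M.map φ ≫ oneFill Δ
      _ = Δ.fill k (s ≫ φ) := (Category.assoc _ _ _).symm.trans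
        ((congrArg (· ≫ oneFill Δ) (char_oneStep_map k s φ)).trans (char_oneFill k (s ≫ φ) Δ))
      _ = Γ.fill k s ≫ φ.left := (h k s).symm
      _ = (oneStratum f).char k s ≫ oneFill Γ ≫ φ.left := by
        rw [← Category.assoc, char_oneFill]

end OneStep

section Comparison

variable {F : FunctorialFactorization TopCat.{u}} (Ψ : FreeLifting cellMap.{u} F)

/-- The action of the one-step factorisation on a factorisation with free lifting operations. -/
noncomputable def oneAct : Hom (oneStep.{u}.comp F) F where
  χ :=
    { app f := oneFill (Ψ.lifting f)
      naturality _ _ φ := oneFill_naturality (Ψ.isHom_map φ) }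
  left_comp f := (Category.assoc _ _ _).trans
    ((congrArg (F.L f ≫ ·) (incl_oneFill (Ψ.lifting f))).trans (Category.comp_id _))
  comp_right f := oneFill_hom (Ψ.lifting f)

theorem point_oneAct : (oneStep.{u}.point F).comp (oneAct Ψ) = .id F :=
  Hom.ext (NatTrans.ext (funext fun f => incl_oneFill (Ψ.lifting f)))

/-- The morphism from the `n`-th term of the free monoid sequence to a factorisation with free
lifting operations. -/
noncomputable def termTo (n : ℕ) : Hom (oneStep.{u}.term n) F := actMap (point_oneAct Ψ) n

theorem termMap_termTo (n : ℕ) : (oneStep.{u}.termMap n).comp (termTo Ψ (n + 1)) = termTo Ψ n :=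
  termMap_actMap _ n

/-- The morphism from the colimit of the free monoid sequence to a factorisation with free lifting
operations. -/
noncomputable def colimTo : Hom factorization F := colimDesc (termTo Ψ) (termMap_termTo Ψ)

theorem ι_colimTo (n : ℕ) : (oneStep.{u}.ι n).comp (colimTo Ψ) = termTo Ψ n :=
  ι_colimDesc _ _ n

end Comparison

section ActCell

variable {f : Arrow TopCat.{u}} (n : ℕ) {k : ℕ}
  (s : cellMap.{u} k ⟶ (oneStep.{u}.term n).right.obj f)

/-- The image in the `(n + 1)`-st term of the free monoid sequence of the cell attached to the
`n`-th term along a square. -/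
noncomputable def actCell : disk.{u} k ⟶ (oneStep.{u}.term (n + 1)).M.obj f :=
  (oneStratum ((oneStep.{u}.term n).right.obj f)).char k s ≫ (oneStep.{u}.termAct n).χ.app f

theorem incl_termAct :
    (oneStratum ((oneStep.{u}.term n).right.obj f)).incl ≫ (oneStep.{u}.termAct n).χ.app f =
      (oneStep.{u}.termMap n).χ.app f :=
  Hom.congr_app (oneStep.{u}.point_termAct n) f

theorem hom_actCell :
    diskBoundaryInclusion.{u} k ≫ actCell n s = s.left ≫ (oneStep.{u}.termMap n).χ.app f :=
  (Category.assoc _ _ _).symm.trans ((congrArg (· ≫ (oneStep.{u}.termAct n).χ.app f)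
    (Stratum.attach_incl (oneStratum ((oneStep.{u}.term n).right.obj f)) k s).symm).trans
      ((Category.assoc _ _ _).trans (congrArg (s.left ≫ ·) (incl_termAct n))))

theorem actCell_R : actCell n s ≫ (oneStep.{u}.term (n + 1)).R f = s.right :=
  (Category.assoc _ _ _).trans ((congrArg (_ ≫ ·) ((oneStep.{u}.termAct n).comp_right f)).trans
    (char_oneExt k s))

theorem actCell_termMap : actCell n s ≫ (oneStep.{u}.termMap (n + 1)).χ.app f =
    actCell (n + 1) (s ≫ (oneStep.{u}.termMap n).rightTrans.app f) := by
  refine (Category.assoc _ _ _).trans ((congrArg (_ ≫ ·)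
    (Hom.congr_app (oneStep.{u}.compMap_termMap_termAct n) f).symm).trans ?_)
  exact (Category.assoc _ _ _).symm.trans
    (congrArg (· ≫ (oneStep.{u}.termAct (n + 1)).χ.app f) (char_oneStep_map k s _))

theorem actCell_termTo {F : FunctorialFactorization TopCat.{u}} (Ψ : FreeLifting cellMap.{u} F) :
    actCell n s ≫ (termTo Ψ (n + 1)).χ.app f =
      (Ψ.lifting f).fill k (s ≫ (termTo Ψ n).rightTrans.app f) := by
  refine (Category.assoc _ _ _).trans ((congrArg (_ ≫ ·)
    (Hom.congr_app (termAct_actMap (point_oneAct Ψ) n) f)).trans ?_)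
  exact (Category.assoc _ _ _).symm.trans ((congrArg (· ≫ oneFill (Ψ.lifting f))
    (char_oneStep_map k s _)).trans (char_oneFill k _ _))

variable {n}

theorem term_hom_ext {Z : TopCat.{u}} {a b : (oneStep.{u}.term (n + 1)).M.obj f ⟶ Z}
    (h₀ : (oneStep.{u}.termMap n).χ.app f ≫ a = (oneStep.{u}.termMap n).χ.app f ≫ b)
    (h₁ : ∀ k (s : cellMap.{u} k ⟶ (oneStep.{u}.term n).right.obj f),
      actCell n s ≫ a = actCell n s ≫ b) : a = b := by
  have := oneStep.{u}.epi_termAct n f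
  rw [← cancel_epi ((oneStep.{u}.termAct n).χ.app f)]
  refine Stratum.body_hom_ext ?_ fun k s => ?_
  · rw [← incl_termAct] at h₀
    exact (Category.assoc _ _ _).symm.trans (h₀.trans (Category.assoc _ _ _))
  · exact (Category.assoc _ _ _).symm.trans ((h₁ k s).trans (Category.assoc _ _ _))

theorem range_subset_of_actCell {Z : TopCat.{u}} {a : (oneStep.{u}.term (n + 1)).M.obj f ⟶ Z}
    {S : Set Z} (h₀ : Set.range ((oneStep.{u}.termMap n).χ.app f ≫ a) ⊆ S)
    (h₁ : ∀ k (s : cellMap.{u} k ⟶ (oneStep.{u}.term n).right.obj f),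
      Set.range (actCell n s ≫ a) ⊆ S) : Set.range a ⊆ S := by
  rintro _ ⟨y, rfl⟩
  obtain ⟨y, rfl⟩ := (TopCat.epi_iff_surjective _).mp (oneStep.{u}.epi_termAct n f) y
  rcases (oneStratum _).exists_incl_or_char y with ⟨x, rfl⟩ | ⟨k, s, d, rfl⟩
  · rw [← incl_termAct] at h₀
    exact h₀ ⟨x, rfl⟩
  · exact h₁ k s ⟨d, rfl⟩

end ActCell

open CellCx

section Stages

variable {f : Arrow TopCat.{u}} {n : ℕ} {h : (freeStage f n).X ⟶ (oneStep.{u}.term n).M.obj f}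
  (w : h ≫ (oneStep.{u}.term n).R f = (freeStage f n).e)

/-- The square over the codomain of `f` given by a map from a stage of the free cell complex to a
term of the free monoid sequence. -/
noncomputable abbrev overSquare : Arrow.mk (freeStage f n).e ⟶ (oneStep.{u}.term n).right.obj f :=
  Arrow.homMk h (𝟙 f.right) (w.trans (Category.comp_id _).symm)

/-- The extension of a map from a stage of the free cell complex to the next stage. -/
noncomputable def nextStage : (freeStage f n).stratum.body ⟶ (oneStep.{u}.term (n + 1)).M.obj f :=
  (freeStage f n).stratum.desc (h ≫ (oneStep.{u}.termMap n).χ.app f)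
    (fun _ s => actCell n (s.1 ≫ overSquare w))
    fun _ s => (Category.assoc _ _ _).symm.trans (hom_actCell n (s.1 ≫ overSquare w)).symm

theorem char_nextStage (k : ℕ) (s : (freeStage f n).stratum.cells k) :
    (freeStage f n).stratum.char k s ≫ nextStage w = actCell n (s.1 ≫ overSquare w) :=
  Stratum.char_desc (freeStage f n).stratum _ _ _ k s

theorem nextStage_R :
    nextStage w ≫ (oneStep.{u}.term (n + 1)).R f = (freeStage f (n + 1)).e := by
  refine Stratum.body_hom_ext ?_ fun k s => ?_
  · calc (freeStage f n).stratum.incl ≫ nextStage w ≫ (oneStep.{u}.term (n + 1)).R f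
      _ = h ≫ (oneStep.{u}.termMap n).χ.app f ≫ (oneStep.{u}.term (n + 1)).R f := by
        rw [← Category.assoc, nextStage, Stratum.incl_desc, Category.assoc]
      _ = (freeStage f n).e :=
        (congrArg (h ≫ ·) ((oneStep.{u}.termMap n).comp_right f)).trans w
      _ = (freeStage f n).stratum.incl ≫ (freeStage f n).ext := (freeStage f n).incl_ext.symm
  · calc (freeStage f n).stratum.char k s ≫ nextStage w ≫ (oneStep.{u}.term (n + 1)).R f
      _ = (s.1 ≫ overSquare w).right := by
        rw [← Category.assoc, char_nextStage, actCell_R]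
      _ = s.1.right := Category.comp_id _
      _ = (freeStage f n).stratum.char k s ≫ (freeStage f n).ext :=
        ((freeStage f n).char_ext k s).symm

end Stages

variable (f : Arrow TopCat.{u})

/-- The recursion defining `stageMap`. -/
noncomputable def stageTo : ∀ n, {h : (freeStage f n).X ⟶ (oneStep.{u}.term n).M.obj f //
    h ≫ (oneStep.{u}.term n).R f = (freeStage f n).e}
  | 0 => ⟨𝟙 f.left, Category.id_comp _⟩
  | n + 1 => ⟨nextStage (stageTo n).2, nextStage_R (stageTo n).2⟩

/-- The map from the `n`-th stage of the free cell complex to the `n`-th term of the free monoid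
sequence. -/
noncomputable def stageMap (n : ℕ) : ((free f).stratum n).X ⟶ (oneStep.{u}.term n).M.obj f :=
  (stageTo f n).1

/-- `stageMap` as a square over the codomain of `f`. -/
noncomputable abbrev stageSquare (n : ℕ) :
    Arrow.mk (freeStage f n).e ⟶ (oneStep.{u}.term n).right.obj f :=
  overSquare (stageTo f n).2

theorem step_stageMap (n : ℕ) : (free f).step n ≫ stageMap f (n + 1) =
    stageMap f n ≫ (oneStep.{u}.termMap n).χ.app f :=
  (congrArg (· ≫ stageMap f (n + 1)) (free_step f n)).trans (Stratum.incl_desc _ _ _ _)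

theorem char_stageMap (n k : ℕ) (s : (freeStage f n).stratum.cells k) :
    (freeStage f n).stratum.char k s ≫ stageMap f (n + 1) = actCell n (s.1 ≫ stageSquare f n) :=
  char_nextStage (stageTo f n).2 k s

/-- The map between two stages of the free cell complex as a square over the codomain of `f`. -/
noncomputable abbrev stepSquare {m n : ℕ} (h : m ≤ n) :
    Arrow.mk (freeStage f m).e ⟶ Arrow.mk (freeStage f n).e :=
  Arrow.homMk ((free f).stepMap h) (𝟙 f.right) (by
    change (free f).stepMap h ≫ (freeStage f n).e = (freeStage f m).e ≫ 𝟙 f.right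
    rw [← toBody_E, ← toBody_E, ← Category.assoc, stepMap_toBody, Category.comp_id])

theorem stepSquare_self (n : ℕ) : stepSquare f (le_refl n) = 𝟙 _ :=
  Arrow.hom_ext _ _ ((free f).stepMap_self n) rfl

theorem stepSquare_succ_stageSquare {m n : ℕ} (h : m ≤ n) :
    stepSquare f (Nat.le_succ_of_le h) ≫ stageSquare f (n + 1) =
      stepSquare f h ≫ stageSquare f n ≫ (oneStep.{u}.termMap n).rightTrans.app f := by
  refine Arrow.hom_ext _ _ ?_ rfl
  change (free f).stepMap (Nat.le_succ_of_le h) ≫ stageMap f (n + 1) =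
    (free f).stepMap h ≫ stageMap f n ≫ (oneStep.{u}.termMap n).χ.app f
  rw [stepMap_succ (free f) h, Category.assoc, step_stageMap]

theorem char_stepMap_stageMap {m n : ℕ} (h : m ≤ n) (k : ℕ)
    (s : (freeStage f m).stratum.cells k) :
    (freeStage f m).stratum.char k s ≫ (free f).stepMap (Nat.succ_le_succ h) ≫
      stageMap f (n + 1) = actCell n (s.1 ≫ stepSquare f h ≫ stageSquare f n) := by
  induction n, h using Nat.le_induction with
  | base =>
    calc (freeStage f m).stratum.char k s ≫ (free f).stepMap (le_refl (m + 1)) ≫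
          stageMap f (m + 1)
      _ = (freeStage f m).stratum.char k s ≫ stageMap f (m + 1) :=
        congrArg ((freeStage f m).stratum.char k s ≫ ·) ((congrArg (· ≫ stageMap f (m + 1))
          ((free f).stepMap_self (m + 1))).trans (Category.id_comp _))
      _ = actCell m (s.1 ≫ stepSquare f (le_refl m) ≫ stageSquare f m) := by
        rw [stepSquare_self, Category.id_comp, char_stageMap]
  | succ n h ih =>
    have e : (free f).stepMap (Nat.succ_le_succ (Nat.le_succ_of_le h)) ≫ stageMap f (n + 1 + 1) =
        ((free f).stepMap (Nat.succ_le_succ h) ≫ stageMap f (n + 1)) ≫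
          (oneStep.{u}.termMap (n + 1)).χ.app f := by
      rw [stepMap_succ (free f) (Nat.succ_le_succ h), Category.assoc, step_stageMap, Category.assoc]
    calc (freeStage f m).stratum.char k s ≫
          (free f).stepMap (Nat.succ_le_succ (Nat.le_succ_of_le h)) ≫ stageMap f (n + 1 + 1)
      _ = ((freeStage f m).stratum.char k s ≫ (free f).stepMap (Nat.succ_le_succ h) ≫
          stageMap f (n + 1)) ≫ (oneStep.{u}.termMap (n + 1)).χ.app f :=
        (congrArg ((freeStage f m).stratum.char k s ≫ ·) e).trans (Category.assoc _ _ _).symm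
      _ = actCell (n + 1) ((s.1 ≫ stepSquare f h ≫ stageSquare f n) ≫
          (oneStep.{u}.termMap n).rightTrans.app f) := by rw [ih, actCell_termMap]
      _ = actCell (n + 1) (s.1 ≫ stepSquare f (Nat.le_succ_of_le h) ≫ stageSquare f (n + 1)) := by
        rw [stepSquare_succ_stageSquare f h]
        simp only [Category.assoc]

/-- The map from the `n`-th term of the free monoid sequence to the body of the free cell
complex. -/
noncomputable def termBody (n : ℕ) : (oneStep.{u}.term n).M.obj f ⟶ (free f).body :=
  (termTo CellCx.freeLifting n).χ.app f

theorem termMap_termBody (n : ℕ) :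
    (oneStep.{u}.termMap n).χ.app f ≫ termBody f (n + 1) = termBody f n :=
  Hom.congr_app (termMap_termTo CellCx.freeLifting n) f

/-- `termBody` as a square over the codomain of `f`. -/
noncomputable abbrev termBodySquare (n : ℕ) :
    (oneStep.{u}.term n).right.obj f ⟶ Arrow.mk (E f) :=
  (termTo CellCx.freeLifting n).rightTrans.app f

theorem actCell_termBody (n : ℕ) {k : ℕ} (s : cellMap.{u} k ⟶ (oneStep.{u}.term n).right.obj f) :
    actCell n s ≫ termBody f (n + 1) = (lifting f).fill k (s ≫ termBodySquare f n) :=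
  actCell_termTo n s CellCx.freeLifting

theorem stageMap_termBody (n : ℕ) : stageMap f n ≫ termBody f n = (free f).toBody n := by
  induction n with
  | zero => exact Category.id_comp _
  | succ n ih =>
    refine Stratum.body_hom_ext ?_ fun k s => ?_
    · have h : (free f).step n ≫ stageMap f (n + 1) ≫ termBody f (n + 1) =
          (free f).step n ≫ (free f).toBody (n + 1) := by
        rw [← Category.assoc, step_stageMap, Category.assoc, termMap_termBody, ih, step_toBody]
      rw [free_step] at h
      exact h
    · let c := (free f).mkCell (n := n) s
      have hs : (s.1 ≫ stageSquare f n) ≫ termBodySquare f n = charSquare (E f) c := by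
        refine Arrow.hom_ext _ _ ?_ ?_
        · exact (Category.assoc _ _ _).trans
            ((congrArg (s.1.left ≫ ·) ih).trans (hom_char_free c).symm)
        · exact (Category.comp_id _).trans ((Category.comp_id _).trans (char_E c).symm)
      calc (freeStage f n).stratum.char k s ≫ stageMap f (n + 1) ≫ termBody f (n + 1)
        _ = (lifting f).fill k ((s.1 ≫ stageSquare f n) ≫ termBodySquare f n) :=
          (Category.assoc _ _ _).symm.trans ((congrArg (· ≫ termBody f (n + 1))
            (char_stageMap f n k s)).trans (actCell_termBody f n _))
        _ = (free f).char c := (congrArg _ hs).trans (fill_charSquare c)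
        _ = (freeStage f n).stratum.char k s ≫ (free f).toBody (n + 1) :=
          congrArg (_ ≫ ·) (Category.id_comp _)

section Inverse

variable {f} {n : ℕ} {q : (oneStep.{u}.term n).M.obj f ⟶ ((free f).stratum n).X}
  (hq : q ≫ (free f).toBody n = termBody f n)
include hq

theorem exists_cell_of_square {k : ℕ} (s : cellMap.{u} k ⟶ (oneStep.{u}.term n).right.obj f) :
    ∃ (m : ℕ) (hm : m ≤ n) (c : (freeStage f m).stratum.cells k),
      c.1.left ≫ (free f).stepMap hm = s.left ≫ q ∧
        charSquare (E f) ((free f).mkCell (n := m) c) = s ≫ termBodySquare f n := by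
  obtain ⟨⟨m, c⟩, hc⟩ := charSquare_E_surjective f k (s ≫ termBodySquare f n)
  have h : c.1.left ≫ (free f).toBody m = (s.left ≫ q) ≫ (free f).toBody n := by
    refine (hom_char_free ⟨m, c⟩).symm.trans ((congrArg Arrow.Hom.left hc).trans ?_)
    rw [Category.assoc, hq]
    rfl
  have hm : m ≤ n := ((free f).isNew_attach m k c).le (s.left ≫ q) h
  refine ⟨m, hm, c, ?_, hc⟩
  rw [← cancel_mono ((free f).toBody n), ← h, Category.assoc]
  exact congrArg (c.1.left ≫ ·) ((free f).stepMap_toBody hm)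

/-- Every square to the `n`-th term is already one of the cells of the first `n + 1` strata, by
properness. -/
theorem exists_actCell_termBody (hq' : q ≫ stageMap f n = 𝟙 _) {k : ℕ}
    (s : cellMap.{u} k ⟶ (oneStep.{u}.term n).right.obj f) :
    ∃ d : disk.{u} k ⟶ ((free f).stratum (n + 1)).X,
      d ≫ (free f).toBody (n + 1) = actCell n s ≫ termBody f (n + 1) ∧
        d ≫ stageMap f (n + 1) = actCell n s := by
  obtain ⟨m, hm, c, hl, hc⟩ := exists_cell_of_square hq s
  have hr : c.1.right = s.right := (char_E ⟨m, c⟩).symm.trans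
    ((congrArg Arrow.Hom.right hc).trans (Category.comp_id _))
  have hs : c.1 ≫ stepSquare f hm ≫ stageSquare f n = s := by
    refine Arrow.hom_ext _ _ ?_ ((congrArg (c.1.right ≫ ·) (Category.comp_id _)).trans
      ((Category.comp_id _).trans hr))
    refine (Category.assoc _ _ _).symm.trans ((congrArg (· ≫ stageMap f n) hl).trans ?_)
    rw [Category.assoc, hq']
    exact Category.comp_id _
  refine ⟨(freeStage f m).stratum.char k c ≫ (free f).stepMap (Nat.succ_le_succ hm), ?_, ?_⟩
  · calc _ = (freeStage f m).stratum.char k c ≫ (free f).toBody (m + 1) :=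
          (Category.assoc _ _ _).trans
            (congrArg (_ ≫ ·) ((free f).stepMap_toBody (Nat.succ_le_succ hm)))
      _ = (free f).char ⟨m, c⟩ := congrArg (_ ≫ ·) (Category.id_comp _).symm
      _ = (lifting f).fill k (s ≫ termBodySquare f n) :=
        (fill_charSquare _).symm.trans (congrArg _ hc)
      _ = actCell n s ≫ termBody f (n + 1) := (actCell_termBody f n s).symm
  · exact (Category.assoc _ _ _).trans
      ((char_stepMap_stageMap f hm k c).trans (congrArg (actCell n) hs))

theorem range_termBody_succ_subset (hq' : q ≫ stageMap f n = 𝟙 _) :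
    Set.range (termBody f (n + 1)) ⊆ Set.range ((free f).toBody (n + 1)) := by
  refine range_subset_of_actCell ?_ fun k s => ?_
  · rw [termMap_termBody, ← hq]
    rintro _ ⟨x, rfl⟩
    exact (free f).range_toBody_mono (Nat.le_succ n) ⟨q x, rfl⟩
  · obtain ⟨d, hd, -⟩ := exists_actCell_termBody hq hq' s
    rw [← hd]
    rintro _ ⟨x, rfl⟩
    exact ⟨d x, rfl⟩

end Inverse

theorem exists_stage_inverse (n : ℕ) :
    ∃ q : (oneStep.{u}.term n).M.obj f ⟶ ((free f).stratum n).X,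
      q ≫ (free f).toBody n = termBody f n ∧ q ≫ stageMap f n = 𝟙 _ := by
  induction n with
  | zero => exact ⟨𝟙 f.left, Category.id_comp _, Category.id_comp _⟩
  | succ n ih =>
    obtain ⟨q, hq, hq'⟩ := ih
    obtain ⟨r, hr⟩ := exists_factor_of_range_subset
      ((free f).isClosedEmbedding_toBody (n + 1)).isInducing (termBody f (n + 1))
      (range_termBody_succ_subset hq hq')
    refine ⟨r, hr, term_hom_ext ?_ fun k s => ?_⟩
    · have e : (oneStep.{u}.termMap n).χ.app f ≫ r = q ≫ (free f).step n := by
        rw [← cancel_mono ((free f).toBody (n + 1)), Category.assoc, hr, termMap_termBody,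
          Category.assoc, step_toBody, hq]
      rw [← Category.assoc, e, Category.assoc, step_stageMap, ← Category.assoc, hq',
        Category.id_comp, Category.comp_id]
    · obtain ⟨d, hd, hd'⟩ := exists_actCell_termBody hq hq' s
      have e : actCell n s ≫ r = d := by
        rw [← cancel_mono ((free f).toBody (n + 1)), Category.assoc, hr, hd]
      rw [← Category.assoc, e, hd', Category.comp_id]

/-- The map from the body of the free cell complex to the colimit of the free monoid sequence. -/
noncomputable def bodyTo : (free f).body ⟶ factorization.M.obj f :=
  (free f).desc (fun n => stageMap f n ≫ (oneStep.{u}.ι n).χ.app f) fun n => by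
    calc (free f).step n ≫ stageMap f (n + 1) ≫ (oneStep.{u}.ι (n + 1)).χ.app f
      _ = stageMap f n ≫ (oneStep.{u}.termMap n).χ.app f ≫ (oneStep.{u}.ι (n + 1)).χ.app f := by
        rw [← Category.assoc, step_stageMap, Category.assoc]
      _ = stageMap f n ≫ (oneStep.{u}.ι n).χ.app f :=
        congrArg (stageMap f n ≫ ·) (Hom.congr_app (oneStep.{u}.termMap_ι n) f)

theorem toBody_bodyTo (n : ℕ) :
    (free f).toBody n ≫ bodyTo f = stageMap f n ≫ (oneStep.{u}.ι n).χ.app f :=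
  (free f).toBody_desc _ _ n

theorem ι_colimTo_app (n : ℕ) :
    (oneStep.{u}.ι n).χ.app f ≫ (colimTo CellCx.freeLifting).χ.app f = termBody f n :=
  Hom.congr_app (ι_colimTo CellCx.freeLifting n) f

theorem bodyTo_colimTo : bodyTo f ≫ (colimTo CellCx.freeLifting).χ.app f = 𝟙 (free f).body :=
  CellCx.body_hom_ext fun n => (Category.assoc _ _ _).symm.trans
    ((congrArg (· ≫ (colimTo CellCx.freeLifting).χ.app f) (toBody_bodyTo f n)).trans
      ((Category.assoc _ _ _).trans ((congrArg (stageMap f n ≫ ·) (ι_colimTo_app f n)).trans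
        ((stageMap_termBody f n).trans (Category.comp_id _).symm))))

theorem colimTo_bodyTo : (colimTo CellCx.freeLifting).χ.app f ≫ bodyTo f = 𝟙 _ := by
  refine colim_hom_ext fun n => ?_
  obtain ⟨q, hq, hq'⟩ := exists_stage_inverse f n
  have h : (q ≫ (free f).toBody n) ≫ bodyTo f = (oneStep.{u}.ι n).χ.app f :=
    (Category.assoc _ _ _).trans ((congrArg (q ≫ ·) (toBody_bodyTo f n)).trans
      ((Category.assoc _ _ _).symm.trans
        ((congrArg (· ≫ (oneStep.{u}.ι n).χ.app f) hq').trans (Category.id_comp _))))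
  exact (Category.assoc _ _ _).symm.trans
    ((congrArg (· ≫ bodyTo f) ((ι_colimTo_app f n).trans hq.symm)).trans
      (h.trans (Category.comp_id _).symm))

instance isIso_colimTo_app : IsIso ((colimTo CellCx.freeLifting).χ.app f) :=
  ⟨bodyTo f, colimTo_bodyTo f, bodyTo_colimTo f⟩

/-- The free lifting operations on the factorisation of the small object argument, transported from
the free cell complexes. -/
noncomputable def freeLifting : FreeLifting cellMap.{u} factorization.{u} :=
  CellCx.freeLifting.ofIsIso (colimTo CellCx.freeLifting)

variable {f}

theorem actCell_ι (n : ℕ) {k : ℕ} (s : cellMap.{u} k ⟶ (oneStep.{u}.term n).right.obj f) :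
    actCell n s ≫ (oneStep.{u}.ι (n + 1)).χ.app f =
      (freeLifting.lifting f).fill k (s ≫ (oneStep.{u}.ι n).rightTrans.app f) := by
  refine (IsIso.eq_comp_inv ((colimTo CellCx.freeLifting).χ.app f)).2 ?_
  have h : termBodySquare f n = (oneStep.{u}.ι n).rightTrans.app f ≫
      (colimTo CellCx.freeLifting).rightTrans.app f :=
    Arrow.hom_ext _ _ (ι_colimTo_app f n).symm (Category.id_comp (𝟙 f.right)).symm
  have hs : s ≫ termBodySquare f n = (s ≫ (oneStep.{u}.ι n).rightTrans.app f) ≫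
      (colimTo CellCx.freeLifting).rightTrans.app f :=
    (congrArg (s ≫ ·) h).trans (Category.assoc _ _ _).symm
  exact (Category.assoc _ _ _).trans ((congrArg (actCell n s ≫ ·) (ι_colimTo_app f (n + 1))).trans
    ((actCell_termBody f n s).trans (congrArg ((lifting f).fill k) hs)))

theorem char_ιOne {k : ℕ} (s : cellMap.{u} k ⟶ f) :
    (oneStratum f).char k s ≫ oneStep.{u}.ιOne.χ.app f =
      (freeLifting.lifting f).fill k (s ≫ factorization.unit.app f) :=
  (congrArg (· ≫ oneStep.{u}.ιOne.χ.app f) (Category.comp_id _).symm).trans (actCell_ι 0 s)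

/-- The square from a generating map to the left part of the one-step factorisation of `f` given by
the cell attached along `s`. -/
noncomputable abbrev cellSquare {k : ℕ} (s : cellMap.{u} k ⟶ f) :
    cellMap.{u} k ⟶ oneStep.{u}.left.obj f :=
  Arrow.homMk s.left ((oneStratum f).char k s) ((oneStratum f).attach_incl k s)

variable (f) in
theorem L_comul_eq_L_map : factorization.L f ≫ freeLifting.comul f =
    factorization.L (oneStep.{u}.left.obj f) ≫
      factorization.M.map (oneStep.{u}.ιOne.leftTrans.app f) :=
  (freeLifting.L_comul f).trans ((Category.id_comp _).symm.trans
    (factorization.L_naturality (oneStep.{u}.ιOne.leftTrans.app f)))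

theorem upperSquare_comulHom {k : ℕ} (s : cellMap.{u} k ⟶ f) :
    (freeLifting.lifting f).upperSquare
        ((s ≫ factorization.unit.app f) ≫ freeLifting.comulHom f) =
      (cellSquare s ≫ factorization.unit.app (oneStep.{u}.left.obj f)) ≫
        factorization.right.map (oneStep.{u}.ιOne.leftTrans.app f) := by
  refine Arrow.hom_ext _ _ ?_ ?_
  · exact (Category.assoc _ _ _).trans
      ((congrArg (s.left ≫ ·) (L_comul_eq_L_map f)).trans (Category.assoc _ _ _).symm)
  · have h : ((s ≫ factorization.unit.app f) ≫ freeLifting.comulHom f) ≫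
        Lifting.compSnd _ _ = s ≫ factorization.unit.app f := by
      rw [Category.assoc, freeLifting.comulHom_compSnd, Category.comp_id]
    exact (congrArg ((freeLifting.lifting f).fill k) h).trans ((char_ιOne s).symm.trans
      (congrArg (· ≫ oneStep.{u}.ιOne.χ.app f) (Category.comp_id _).symm))

theorem fill_comul {k : ℕ} (s : cellMap.{u} k ⟶ f) :
    (freeLifting.lifting f).fill k (s ≫ factorization.unit.app f) ≫ freeLifting.comul f =
      (freeLifting.lifting (factorization.left.obj f)).fill k
        ((cellSquare s ≫ factorization.unit.app (oneStep.{u}.left.obj f)) ≫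
          factorization.right.map (oneStep.{u}.ιOne.leftTrans.app f)) :=
  (freeLifting.isHom_comulHom f k (s ≫ factorization.unit.app f)).trans
    (congrArg ((freeLifting.lifting (factorization.left.obj f)).fill k) (upperSquare_comulHom s))

variable (f)

theorem ιOne_comul : oneStep.{u}.ιOne.χ.app f ≫ freeLifting.comul f =
    oneComul f ≫ oneStep.{u}.ιOne.χ.app (oneStep.{u}.left.obj f) ≫
      factorization.M.map (oneStep.{u}.ιOne.leftTrans.app f) := by
  let g := oneStep.{u}.left.obj f
  let φ : g ⟶ factorization.left.obj f := oneStep.{u}.ιOne.leftTrans.app f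
  let β := oneStep.{u}.ιOne.χ.app g ≫ factorization.M.map φ
  refine Stratum.body_hom_ext ?_ fun k s => ?_
  · have h : (oneStratum f).incl ≫ oneComul f = (oneStratum g).incl :=
      (Stratum.incl_bodyMap _).trans (Category.id_comp _)
    have hβ : (oneStratum g).incl ≫ β = factorization.L g ≫ factorization.M.map φ :=
      (Category.assoc _ _ _).symm.trans
        (congrArg (· ≫ factorization.M.map φ) (oneStep.{u}.ιOne.left_comp g))
    have hL : (oneStratum f).incl ≫ oneStep.{u}.ιOne.χ.app f ≫ freeLifting.comul f =
        factorization.L f ≫ freeLifting.comul f :=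
      (Category.assoc _ _ _).symm.trans
        (congrArg (· ≫ freeLifting.comul f) (oneStep.{u}.ιOne.left_comp f))
    exact (hL.trans (L_comul_eq_L_map f)).trans
      (hβ.symm.trans ((congrArg (· ≫ β) h.symm).trans (Category.assoc _ _ _)))
  · have h : (oneStratum f).char k s ≫ oneComul f = (oneStratum g).char k (cellSquare s) :=
      Stratum.char_bodyMap _ k s
    have hβ : (oneStratum g).char k (cellSquare s) ≫ β =
        (freeLifting.lifting (factorization.left.obj f)).fill k
          ((cellSquare s ≫ factorization.unit.app g) ≫ factorization.right.map φ) :=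
      (Category.assoc _ _ _).symm.trans ((congrArg (· ≫ factorization.M.map φ)
        (char_ιOne (cellSquare s))).trans (freeLifting.isHom_map φ k _))
    have hL : (oneStratum f).char k s ≫ oneStep.{u}.ιOne.χ.app f ≫ freeLifting.comul f =
        (freeLifting.lifting (factorization.left.obj f)).fill k
          ((cellSquare s ≫ factorization.unit.app g) ≫ factorization.right.map φ) :=
      (Category.assoc _ _ _).symm.trans ((congrArg (· ≫ freeLifting.comul f) (char_ιOne s)).trans
        (fill_comul s))
    exact hL.trans (hβ.symm.trans ((congrArg (· ≫ β) h.symm).trans (Category.assoc _ _ _)))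

theorem ιOne_mul (n : ℕ) :
    (oneStep.{u}.ιOne.χ.app ((oneStep.{u}.term n).right.obj f) ≫
      factorization.M.map ((oneStep.{u}.ι n).rightTrans.app f)) ≫ (freeLifting.mul f).left =
        (oneStep.{u}.termAct n).χ.app f ≫ (oneStep.{u}.ι (n + 1)).χ.app f := by
  let g := (oneStep.{u}.term n).right.obj f
  let φ : g ⟶ factorization.right.obj f := (oneStep.{u}.ι n).rightTrans.app f
  let ψ : factorization.right.obj g ⟶ factorization.right.obj f :=
    factorization.right.map φ ≫ freeLifting.mul f
  have hψ : factorization.unit.app g ≫ ψ = φ :=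
    (Category.assoc _ _ _).symm.trans ((congrArg (· ≫ freeLifting.mul f)
      (factorization.unit.naturality φ).symm).trans ((Category.assoc _ _ _).trans
        ((congrArg (φ ≫ ·) (freeLifting.unit_mul f)).trans (Category.comp_id φ))))
  refine (Category.assoc _ _ _).trans (Stratum.body_hom_ext ?_ fun k s => ?_)
  · have hL : (oneStratum g).incl ≫ oneStep.{u}.ιOne.χ.app g ≫ ψ.left = φ.left :=
      (Category.assoc _ _ _).symm.trans ((congrArg (· ≫ ψ.left)
        (oneStep.{u}.ιOne.left_comp g)).trans (congrArg Arrow.Hom.left hψ))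
    exact hL.trans ((Hom.congr_app (oneStep.{u}.termMap_ι n) f).symm.trans
      ((congrArg (· ≫ (oneStep.{u}.ι (n + 1)).χ.app f) (incl_termAct n).symm).trans
        (Category.assoc _ _ _)))
  · have hL : (oneStratum g).char k s ≫ oneStep.{u}.ιOne.χ.app g ≫ ψ.left =
        (freeLifting.lifting f).fill k ((s ≫ factorization.unit.app g) ≫ ψ) :=
      (Category.assoc _ _ _).symm.trans ((congrArg (· ≫ ψ.left) (char_ιOne s)).trans
        (((freeLifting.isHom_map φ).comp (freeLifting.isHom_mul f)) k _))
    have hs : (s ≫ factorization.unit.app g) ≫ ψ = s ≫ φ :=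
      (Category.assoc _ _ _).trans (congrArg (s ≫ ·) hψ)
    exact hL.trans ((congrArg ((freeLifting.lifting f).fill k) hs).trans
      ((actCell_ι n s).symm.trans (Category.assoc _ _ _)))

theorem isFreeMonoidStructure : IsFreeMonoidStructure freeLifting.{u}.awfsStructure :=
  ⟨ιOne_comul, fun n f => ιOne_mul f n⟩

end Garner

/-- `(UK, E)` is an algebraic weak factorisation system, it is free on the set of inclusions
`S^{n-1} ⟶ D^n` (via the canonical one-cell structures), and it is isomorphic to the algebraic weak
factorisation system produced by Garner's small object argument. -/
theorem mainTheorem2 :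
    ∃ A : AWFSStructure CellCx.factorization.{u}, CellCx.IsCellStructure A ∧
      (∃ η : Discrete ℕ ⥤ (AWFS.mk CellCx.factorization A).LMap,
        (∀ k : ℕ, ∃ h₁ h₂, η.obj ⟨k⟩ =
          { A := cellInclusions.{u}.obj ⟨k⟩
            a := CellCx.genStructure k
            counit := h₁
            coassoc := h₂ }) ∧
        (AWFS.mk CellCx.factorization A).IsFreeVia cellInclusions.{u} η) ∧
      ∃ G : AWFSStructure Garner.factorization.{u}, Garner.IsFreeMonoidStructure G ∧
        Nonempty (AWFS.mk CellCx.factorization A ≅ AWFS.mk Garner.factorization G) := by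
  refine ⟨CellCx.freeLifting.awfsStructure, CellCx.isCellStructure,
    ⟨CellCx.freeLifting.generatorFamily.functor, fun k => ?_, CellCx.freeLifting.isFreeVia⟩,
    Garner.freeLifting.awfsStructure, Garner.isFreeMonoidStructure,
    CellCx.freeLifting.nonempty_awfs_iso Garner.freeLifting⟩
  have e : CellCx.genStructure k = CellCx.freeLifting.generatorFamily.a k :=
    Arrow.hom_ext _ _ rfl (CellCx.genStructure_right k)
  rw [e]
  exact ⟨CellCx.freeLifting.generatorFamily.counit k,
    CellCx.freeLifting.generatorFamily.coassoc k, rfl⟩
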